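/- Let $\mathcal A$ be a finite, essential, real complexified toric arrangement of connected hypertori in a torus $T$ of dimension $r$, with compact torus $T_c=\mathbb R^r/\mathbb Z^r$. A layer is a connected component of an intersection of hypertori; write $\mathcal A_Z=\{H\in\mathcal A: Z\subseteq H\}$. For $H\in\mathcal A$ let $H_0\subset\mathbb R^r$ be the corresponding linear hyperplane, $\mathcal A_0=\{H_0\}$, and $X_Z=\bigcap_{H\in\mathcal A_Z}H_0$. Let $\mathcal F(\mathcal A)$ be the category of faces of the induced cellularization of $T_c$. For a face $F$ let $\mathcal A[F]=\{H_0: H\in\mathcal A_F\}$, and for a face or chamber $C$ of $\mathcal A_0$ let $C(F)$ be the face or chamber of $\mathcal A[F]$ containing it. Let $\mathcal S(\mathcal A[F])$ be the Salvetti poset of pairs $[G,C]$ ($C$ a chamber, $G\le C$ a face), where $[G',C']\le[G,C]$ if $G\le G'$ and $C_{G'}=C'$; here $C_G$ is the chamber adjacent to $G$ that no hyperplane containing $G$ separates from $C$. Let $\mathscr D:\mathcal F(\mathcal A)^{op}\to\mathrm{Posets}$, $F\mapsto\mathcal S(\mathcal A[F])$, send $m:F\to G$ to the map induced by the inclusion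 $\mathcal F(\mathcal A[G])\to\mathcal F(\mathcal A[F])$, and let $\mathrm{Sal}(\mathcal A)=\int\mathscr D$ be its Grothendieck construction. For a layer $L$ and a face $F_0$ of $\mathcal A_0$ with linear hull $X_L$, let $\mathcal S_{L,F_0}\subseteq\mathrm{Sal}(\mathcal A)$ be the full subcategory of the objects $(F,[G,C_G])$ with $F\subseteq L$ and $C$ a chamber of $\mathcal A[F]$ with $F_0(F)\le C$. Choices. (1) For each one-dimensional layer $M$, a chamber ${}^MC$ of $\mathcal A_0$ adjacent to $X_M$, and a minimal gallery $C_0={}^MC,W_1,C_1,\dots,C_k$ to the chamber $C_k$ separated from ${}^MC$ exactly by the hyperplanes not containing $X_M$. For each hypertorus $H$, a chamber ${}^HC$ of $\mathcal A_0$. (2) For each layer $L$, a chamber $B(L)$ of $\mathcal A_0$ such that $F(L)=\overline{B(L)}\cap X_L$ has maximal dimension; $F(T)=B(T)$ is a chamber. Classes. For a chamber $B$ of $\mathcal A_0$, $\widehat\lambda^M_B$ is the class of the cycle supported on the circle that runs, for all zero-dimensional faces $P\subseteq M$, through the objects $v_j=(P,[C_j(P),C_j(P)])$ and $e_j=(P,[W_{j+1}(P),B(P)_{W_{j+1}(P)}])$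 (for those $j$ with $C_j(P)\ne C_{j+1}(P)$), joined through the objects $(G,[{}^MC(G),{}^MC(G)])$ for the one-dimensional faces $G\subseteq M$; it is oriented so that the edges $v_j\to e_j$ have coefficient $1$. The class $\widehat\omega_H$ is the class, for any morphism $m:F\to G$ of faces with $\mathrm{supp}\,G=H$, of the four-edge cycle on $(F,[C_i,C_i])$ and $(F,[F_m,C_i])$, $i=1,2$, where $F_m$ is the face of $\mathcal A[F]$ corresponding to $m$, $C_1={}^HC(F)_{F_m}$ and $C_2=(-{}^HC(F))_{F_m}$, oriented so that $[C_1,C_1]\to[F_m,C_1]$ has coefficient $1$. Put $\epsilon(H,B)=-1$ if $H_0$ separates ${}^HC$ from $B$, and $\epsilon(H,B)=1$ otherwise. Put $S_F(B,B')=\{H\in\mathcal A_F: H_0\text{ separates }B\text{ from }B'\}$. Let $M_1,\dots,M_r$ be one-dimensional layers such that $\widehat\lambda^{M_1}_{F(T)},\dots,\widehat\lambda^{M_r}_{F(T)}$ is a basis of $H_1(\mathcal S_{T,F(T)};\mathbb Q)$. Let $L$ be a layer of dimension $k\ge0$, and let $N_1,\dots,N_k\subseteq L$ be one-dimensional layers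 such that $\widehat\lambda^{N_1}_{B(L)},\dots,\widehat\lambda^{N_k}_{B(L)}$ are linearly independent in $H_1(\mathcal S_{L,F(L)};\mathbb Q)$. Define $a_{hi}\in\mathbb Q$ by $\widehat\lambda^{N_h}_{F(T)}=\sum_i a_{hi}\widehat\lambda^{M_i}_{F(T)}$ in $H_1(\mathcal S_{T,F(T)};\mathbb Q)$. Then $\{\widehat\lambda^{M_i}_{F(T)}\}_i\cup\{\widehat\omega_H\}_{H\in\mathcal A}$ is a basis of $H_1(\mathrm{Sal}(\mathcal A);\mathbb Q)$, with dual basis $\{\lambda^{M_i}\}_i\cup\{\omega_H\}_H$ of $H^1(\mathrm{Sal}(\mathcal A);\mathbb Q)$. Also $\{\widehat\lambda^{N_h}_{B(L)}\}_h\cup\{\widehat\omega_H\}_{H\supseteq L}$ is a basis of $H_1(\mathcal S_{L,F(L)};\mathbb Q)$, with dual basis $\{\lambda^{N_h}_{B(L)}\}_h\cup\{\omega_H(L)\}_{H\supseteq L}$ of $H^1(\mathcal S_{L,F(L)};\mathbb Q)$. The restriction $\varphi_L^*:H^1(\mathrm{Sal}(\mathcal A);\mathbb Q)\to H^1(\mathcal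 S_{L,F(L)};\mathbb Q)$ along the inclusion satisfies $$\varphi_L^*(\lambda^{M_i})=\sum_{h=1}^k a_{hi}\,\lambda^{N_h}_{B(L)}\qquad(1\le i\le r).$$ For every $H\in\mathcal A$, set $$\sigma_H=\sum_{h=1}^k\ \sum_{\substack{F\subseteq N_h\\ H\in S_F(B(L),F(T))\setminus\mathcal A_{N_h}}}\epsilon(H,{}^{N_h}C)\,\epsilon(H,B(L))\,\lambda^{N_h}_{B(L)},$$ where $F$ runs over the faces of $\mathcal A$ contained in $N_h$. Then $$\varphi_L^*(\omega_H)=\omega_H(L)+\sigma_H\ \text{ if } L\subseteq H,\qquad \varphi_L^*(\omega_H)=\sigma_H\ \text{ if } L\not\subseteq H.$$ -/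

import Mathlib

open CategoryTheory

/-! ### First homology and cohomology of (the nerve of) a small category

The (unnormalised) simplicial chain complex of the nerve of `C` with rational coefficients, in
degrees at most two: vertices are objects, `1`-simplices are arrows, and `2`-simplices are
composable pairs of arrows. -/

namespace CatHom

universe v u v' u'

variable (C : Type u) [Category.{v} C]

/-- Composable pairs of arrows, the `2`-simplices of the nerve. -/
abbrev Pairs : Type (max u v) := Σ (X Y Z : C), (X ⟶ Y) × (Y ⟶ Z)

/-- The boundary of a `1`-simplex `f : X ⟶ Y` is `Y - X`. -/
noncomputable def bdry1 : (Arrow C →₀ ℚ) →ₗ[ℚ] (C →₀ ℚ) :=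
  Finsupp.linearCombination ℚ
    (fun f : Arrow C => Finsupp.single f.right (1 : ℚ) - Finsupp.single f.left 1)

/-- The boundary of a `2`-simplex `(f, g)` is `g - f ≫ g + f`. -/
noncomputable def bdry2 : (Pairs C →₀ ℚ) →ₗ[ℚ] (Arrow C →₀ ℚ) :=
  Finsupp.linearCombination ℚ
    (fun p : Pairs C => Finsupp.single (Arrow.mk p.2.2.2.2) (1 : ℚ)
      - Finsupp.single (Arrow.mk (p.2.2.2.1 ≫ p.2.2.2.2)) 1
      + Finsupp.single (Arrow.mk p.2.2.2.1) 1)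

/-- The rational `1`-cycles. -/
noncomputable abbrev Cycles : Submodule ℚ (Arrow C →₀ ℚ) := LinearMap.ker (bdry1 C)

/-- The first rational homology: cycles modulo boundaries. -/
abbrev H1 : Type (max u v) := ↥(Cycles C) ⧸ (LinearMap.range (bdry2 C)).submoduleOf (Cycles C)

/-- The homology class of a cycle. -/
noncomputable def H1.cls (z : Cycles C) : H1 C := Submodule.Quotient.mk z

/-- The rational `1`-cocycles: functions `c` on arrows with `c (f ≫ g) = c f + c g`. -/
def Cocycles : Submodule ℚ (Arrow C → ℚ) where
  carrier := {c | ∀ (X Y Z : C) (f : X ⟶ Y) (g : Y ⟶ Z),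
    c (Arrow.mk g) - c (Arrow.mk (f ≫ g)) + c (Arrow.mk f) = 0}
  add_mem' := by
    intro a b ha hb X Y Z f g
    have h1 := ha X Y Z f g
    have h2 := hb X Y Z f g
    simp only [Pi.add_apply]
    linarith
  zero_mem' := by intro X Y Z f g; simp
  smul_mem' := by
    intro r a ha X Y Z f g
    have h1 := ha X Y Z f g
    simp only [Pi.smul_apply, smul_eq_mul]
    linear_combination r * h1

/-- The coboundary of a `0`-cochain. -/
def cobdry : (C → ℚ) →ₗ[ℚ] (Arrow C → ℚ) where
  toFun u := fun f => u f.right - u f.left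
  map_add' := by intro a b; funext f; simp only [Pi.add_apply]; ring
  map_smul' := by
    intro r a; funext f; simp only [Pi.smul_apply, smul_eq_mul, RingHom.id_apply]; ring

/-- The first rational cohomology: cocycles modulo coboundaries. -/
abbrev Coh1 : Type (max u v) :=
  ↥(Cocycles C) ⧸ (LinearMap.range (cobdry C)).submoduleOf (Cocycles C)

variable {C}

lemma cocycle_boundary (c : Cocycles C) (w : Pairs C →₀ ℚ) :
    Finsupp.linearCombination ℚ c.1 (bdry2 C w) = 0 := by
  have h : (Finsupp.linearCombination ℚ c.1) ∘ₗ (bdry2 C) = 0 := by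
    ext p
    have := c.2 p.1 p.2.1 p.2.2.1 p.2.2.2.1 p.2.2.2.2
    simpa [bdry2, sub_eq_add_neg] using this
  exact LinearMap.congr_fun h w

lemma coboundary_cycle (u : C → ℚ) (z : Arrow C →₀ ℚ) :
    Finsupp.linearCombination ℚ (cobdry C u) z
      = Finsupp.linearCombination ℚ u (bdry1 C z) := by
  have h : Finsupp.linearCombination ℚ (cobdry C u)
      = (Finsupp.linearCombination ℚ u) ∘ₗ (bdry1 C) := by
    ext p
    simp [bdry1, cobdry]
  exact LinearMap.congr_fun h z

/-- Integration of a fixed cocycle over homology classes. -/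
noncomputable def pairCocycle (c : Cocycles C) : H1 C →ₗ[ℚ] ℚ :=
  Submodule.liftQ _ ((Finsupp.linearCombination ℚ c.1) ∘ₗ (Cycles C).subtype) (by
    rintro ⟨z, hz⟩ ⟨w, hw⟩
    have : bdry2 C w = z := hw
    subst this
    exact cocycle_boundary c w)

/-- The evaluation pairing between first cohomology and first homology. -/
noncomputable def pairing : Coh1 C →ₗ[ℚ] H1 C →ₗ[ℚ] ℚ :=
  Submodule.liftQ _
    { toFun := pairCocycle
      map_add' := by
        intro a b
        apply Submodule.linearMap_qext
        ext z
        simp [pairCocycle, Finsupp.linearCombination_apply, Finsupp.sum, mul_add,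
          Finset.sum_add_distrib]
      map_smul' := by
        intro r a
        apply Submodule.linearMap_qext
        ext z
        simp [pairCocycle, Finsupp.linearCombination_apply, Finsupp.sum, Finset.mul_sum,
          mul_left_comm] } (by
    rintro ⟨c, hc⟩ ⟨u, hu⟩
    have hu' : cobdry C u = c := hu
    subst hu'
    rw [LinearMap.mem_ker]
    apply Submodule.linearMap_qext
    ext ⟨z, hz⟩
    have hz' : bdry1 C z = 0 := hz
    change Finsupp.linearCombination ℚ (cobdry C u) z = 0
    rw [coboundary_cycle, hz', map_zero])

variable {D : Type u'} [Category.{v'} D]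

/-- The map on `1`-chains induced by a functor. -/
noncomputable def chainMap (Φ : D ⥤ C) : (Arrow D →₀ ℚ) →ₗ[ℚ] (Arrow C →₀ ℚ) :=
  Finsupp.lmapDomain ℚ ℚ Φ.mapArrow.obj

/-- The restriction of cocycles along a functor. -/
def pullCocycles (Φ : D ⥤ C) : Cocycles C →ₗ[ℚ] Cocycles D where
  toFun c := ⟨fun f => c.1 (Φ.mapArrow.obj f), by
    intro X Y Z f g
    have := c.2 _ _ _ (Φ.map f) (Φ.map g)
    rw [← Φ.map_comp] at this
    exact this⟩
  map_add' := by intro a b; rfl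
  map_smul' := by intro r a; rfl

/-- The map in first cohomology induced by a functor. -/
noncomputable def pull (Φ : D ⥤ C) : Coh1 C →ₗ[ℚ] Coh1 D :=
  Submodule.mapQ _ _ (pullCocycles Φ) (by
    rintro ⟨c, hc⟩ ⟨u, hu⟩
    have hu' : cobdry C u = c := hu
    subst hu'
    exact ⟨fun X => u (Φ.obj X), rfl⟩)

end CatHom

/-! ### Real complexified toric arrangements -/

/-- A finite real complexified toric arrangement in the torus of dimension `d`, whose hypertori are
indexed by `ι`: the `i`-th hypertorus is `{t | t ^ char i = exp (2 π √-1 shift i)}`, with `char i` a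
primitive character (so that hypertori are connected), and distinct indices give distinct hypertori.
The compact torus is `ℝ ^ d / ℤ ^ d`, and subsets of it are handled through their `ℤ ^ d`-periodic
preimages in `ℝ ^ d`. -/
structure ToricArrangement (ι : Type) (d : ℕ) where
  char : ι → Fin d → ℤ
  shift : ι → ℝ
  primitive : ∀ (i : ι) (k : ℤ), (∀ j, k ∣ char i j) → IsUnit k
  distinct : Function.Injective (fun i : ι =>
    {x : Fin d → ℝ | ∃ n : ℤ, ∑ j, (char i j : ℝ) * x j = shift i + n})

namespace ToricArrangement

variable {ι : Type} {d : ℕ} (A : ToricArrangement ι d)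

/-- The linear form defined by the `i`-th character. -/
noncomputable def ev (i : ι) : (Fin d → ℝ) →ₗ[ℝ] ℝ :=
  ∑ j, (A.char i j : ℝ) • LinearMap.proj j

/-- An integer vector as a real vector. -/
def lat (v : Fin d → ℤ) : Fin d → ℝ := fun j => (v j : ℝ)

/-- The arrangement is essential: the characters span. -/
def Essential : Prop := ∀ x : Fin d → ℝ, (∀ i, A.ev i x = 0) → x = 0

/-- The preimage in `ℝ ^ d` of the `i`-th hypertorus: the union of the lifted hyperplanes
`ev i = shift i + n`, `n ∈ ℤ`. -/
def hyp (i : ι) : Set (Fin d → ℝ) := {x | ∃ n : ℤ, A.ev i x = A.shift i + n}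

/-- `𝒜_Z`, the hypertori that contain `Z`. -/
def above (Z : Set (Fin d → ℝ)) : Set ι := {i | Z ⊆ A.hyp i}

/-- `X_Z`, the intersection of the linear hyperplanes of the hypertori containing `Z`. If `Z` is a
layer or a face, this is the space of directions of `Z`. -/
noncomputable def dirSpace (Z : Set (Fin d → ℝ)) : Submodule ℝ (Fin d → ℝ) :=
  ⨅ i ∈ A.above Z, LinearMap.ker (A.ev i)

/-- The dimension of a layer or of a face. -/
noncomputable def dim (Z : Set (Fin d → ℝ)) : ℕ := Module.finrank ℝ (A.dirSpace Z)

/-- A layer is a connected component of an intersection of hypertori, that is, the image in the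
torus of a nonempty intersection of lifted hyperplanes: the affine subspace through some `x` in
the intersection, parallel to the common kernel. It is given through its periodic preimage. -/
def Layer : Type :=
  {L : Set (Fin d → ℝ) // ∃ (S : Set ι) (x : Fin d → ℝ), (∀ i ∈ S, x ∈ A.hyp i) ∧
    L = {y | ∃ v : Fin d → ℤ, ∀ i ∈ S, A.ev i (y + lat v) = A.ev i x}}

/-- The whole torus as a layer. -/
def torus : A.Layer := ⟨Set.univ, ∅, 0, by simp, by simp⟩

/-- The one-dimensional layers. -/
def Line : Type := {M : A.Layer // A.dim M.1 = 1}

/-! ### The category of faces -/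

/-- The sign of `x` with respect to the lifted hyperplane `ev i = shift i + n`. -/
noncomputable def sgn (x : Fin d → ℝ) (i : ι) (n : ℤ) : SignType :=
  SignType.sign (A.ev i x - A.shift i - n)

/-- The face of the lifted arrangement containing `x` lies in the closure of the one
containing `y`. -/
def FaceLE (x y : Fin d → ℝ) : Prop := ∀ i n, A.sgn x i n = 0 ∨ A.sgn x i n = A.sgn y i n

lemma ev_lat (i : ι) (v : Fin d → ℤ) : A.ev i (lat v) = ((∑ j, A.char i j * v j : ℤ) : ℝ) := by
  simp [ev, lat]

lemma lat_zero : lat (0 : Fin d → ℤ) = 0 := by funext j; simp [lat]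

lemma lat_add (v w : Fin d → ℤ) : lat (v + w) = lat v + lat w := by funext j; simp [lat]

lemma sgn_add_lat (x : Fin d → ℝ) (v : Fin d → ℤ) (i : ι) (n : ℤ) :
    A.sgn (x + lat v) i n = A.sgn x i (n - ∑ j, A.char i j * v j) := by
  unfold sgn
  rw [map_add, ev_lat]
  push_cast
  congr 1
  ring

/-- Two points of `ℝ ^ d` lie in the same face of the toric arrangement if, up to an integer
translation, they lie in the same face of the lifted arrangement. -/
def faceSetoid : Setoid (Fin d → ℝ) where
  r x y := ∃ v : Fin d → ℤ, ∀ i n, A.sgn (x + lat v) i n = A.sgn y i n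
  iseqv :=
    { refl := fun x => ⟨0, fun i n => by rw [lat_zero, add_zero]⟩
      symm := by
        rintro x y ⟨v, h⟩
        refine ⟨-v, fun i n => ?_⟩
        rw [sgn_add_lat, ← h, sgn_add_lat]
        congr 1
        simp
      trans := by
        rintro x y z ⟨v, h⟩ ⟨w, k⟩
        refine ⟨v + w, fun i n => ?_⟩
        rw [← k, sgn_add_lat A y, ← h, lat_add, ← add_assoc, sgn_add_lat A (x + lat v)] }

/-- The faces of the toric arrangement. -/
def Face : Type := Quotient A.faceSetoid

variable {A}

/-- A chosen point in a chosen lift of a face. -/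
noncomputable def Face.rep (F : A.Face) : Fin d → ℝ := Quotient.out F

/-- The periodic preimage of a face. -/
def Face.pts (F : A.Face) : Set (Fin d → ℝ) := {x | Quotient.mk A.faceSetoid x = F}

lemma Face.rep_mem (F : A.Face) : F.rep ∈ F.pts := Quotient.out_eq F

lemma mem_hyp_iff (x : Fin d → ℝ) (i : ι) : x ∈ A.hyp i ↔ ∃ n : ℤ, A.sgn x i n = 0 := by
  simp only [hyp, sgn, Set.mem_ofPred_eq, sign_eq_zero_iff]
  exact exists_congr fun n => ⟨fun h => by linarith, fun h => by linarith⟩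

lemma mem_above_iff (F : A.Face) (i : ι) : i ∈ A.above F.pts ↔ F.rep ∈ A.hyp i := by
  refine ⟨fun h => h F.rep_mem, fun h x hx => ?_⟩
  have hx' : Quotient.mk A.faceSetoid x = Quotient.mk A.faceSetoid F.rep := by
    rw [hx]; exact (Quotient.out_eq F).symm
  obtain ⟨v, hv⟩ := Quotient.exact hx'
  rw [mem_hyp_iff] at h ⊢
  obtain ⟨n, hn⟩ := h
  exact ⟨n - ∑ j, A.char i j * v j, by rw [← sgn_add_lat, hv, hn]⟩

lemma FaceLE.add_lat {x y : Fin d → ℝ} (h : A.FaceLE x y) (v : Fin d → ℤ) :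
    A.FaceLE (x + lat v) (y + lat v) := by
  intro i n
  rw [sgn_add_lat, sgn_add_lat]
  exact h i _

lemma FaceLE.trans {x y z : Fin d → ℝ} (h : A.FaceLE x y) (k : A.FaceLE y z) : A.FaceLE x z := by
  intro i n
  rcases h i n with h1 | h1
  · exact Or.inl h1
  · rcases k i n with h2 | h2
    · exact Or.inl (h1.trans h2)
    · exact Or.inr (h1.trans h2)

/-- The category of faces, the quotient by `ℤ ^ d` of the poset of faces of the lifted arrangement:
a morphism `F ⟶ G` is a lift of `G` (given by the translation of the chosen lift) whose closure
contains the chosen lift of `F`. -/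
noncomputable instance : Category.{0} A.Face where
  Hom F G := {v : Fin d → ℤ // A.FaceLE F.rep (G.rep + lat v)}
  id F := ⟨0, fun i n => Or.inr (by rw [lat_zero, add_zero])⟩
  comp {F G K} f g := ⟨g.1 + f.1, by
    have h := FaceLE.trans f.2 (g.2.add_lat f.1)
    rwa [add_assoc, ← lat_add] at h⟩
  id_comp f := Subtype.ext (add_zero _)
  comp_id f := Subtype.ext (zero_add _)
  assoc f g h := Subtype.ext (add_assoc _ _ _).symm

/-- A vector pointing from the chosen lift of `F` to the lift of `G` given by `m`. -/
noncomputable def dirVec {F G : A.Face} (m : F ⟶ G) : Fin d → ℝ := G.rep + lat m.1 - F.rep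

variable (A)

/-! ### Local linear arrangements

For a set `s` of hypertori, the central arrangement of the linear hyperplanes `ker (ev i)`, `i ∈ s`.
For `s = Set.univ` this is `𝒜₀` (parallel hypertori give the same hyperplane, which does not affect
the faces), and for `s = 𝒜_F` it is `𝒜[F]`. -/

/-- A face of the linear arrangement, given by its sign vector. -/
@[ext]
structure LFace (s : Set ι) where
  sg : s → SignType
  realized : ∃ u : Fin d → ℝ, ∀ i : s, sg i = SignType.sign (A.ev i u)

variable {A}

/-- `G ≤ K` if `G` lies in the closure of `K`. -/
instance (s : Set ι) : LE (A.LFace s) := ⟨fun G K => ∀ i, G.sg i = 0 ∨ G.sg i = K.sg i⟩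

/-- The set of points of a face. -/
def LFace.carrier {s : Set ι} (G : A.LFace s) : Set (Fin d → ℝ) :=
  {u | ∀ i : s, G.sg i = SignType.sign (A.ev i u)}

/-- The linear hull of a face. -/
def LFace.hull {s : Set ι} (G : A.LFace s) : Submodule ℝ (Fin d → ℝ) :=
  Submodule.span ℝ G.carrier

/-- The face of the subarrangement `s` containing a face of a larger arrangement `t`. -/
def LFace.restrict {t : Set ι} (G : A.LFace t) (s : Set ι) (h : s ⊆ t) : A.LFace s where
  sg i := G.sg ⟨i, h i.2⟩
  realized := by
    obtain ⟨u, hu⟩ := G.realized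
    exact ⟨u, fun i => hu ⟨i, h i.2⟩⟩

/-- The negative of a face. -/
def LFace.neg {s : Set ι} (G : A.LFace s) : A.LFace s where
  sg i := -G.sg i
  realized := by
    obtain ⟨u, hu⟩ := G.realized
    exact ⟨-u, fun i => by rw [hu, map_neg, Left.sign_neg]⟩

lemma sign_add_small {a b : ℝ} (h : a ≠ 0) :
    ∃ δ > 0, ∀ ε, 0 < ε → ε < δ → SignType.sign (a + ε * b) = SignType.sign a := by
  have hb : (0 : ℝ) < |b| + 1 := by positivity
  refine ⟨|a| / (|b| + 1), by positivity, fun ε h0 h1 => ?_⟩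
  have h2 : ε * (|b| + 1) < |a| := (lt_div_iff₀ hb).1 h1
  have h3 : |ε * b| < |a| := by
    rw [abs_mul, abs_of_pos h0]
    nlinarith
  have h4 := abs_lt.1 h3
  rcases lt_or_gt_of_ne h with ha | ha
  · rw [abs_of_neg ha] at h4
    rw [sign_neg ha, sign_neg (by linarith)]
  · rw [abs_of_pos ha] at h4
    rw [sign_pos ha, sign_pos (by linarith)]

/-- Moving slightly from `u` in the direction `w` keeps the nonzero signs of `u` and
gives the signs of `w` elsewhere. -/
lemma exists_perturb [Finite ι] (u w : Fin d → ℝ) :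
    ∃ x : Fin d → ℝ, ∀ i : ι, SignType.sign (A.ev i x) =
      if A.ev i u = 0 then SignType.sign (A.ev i w) else SignType.sign (A.ev i u) := by
  have key : ∀ i : ι, ∃ δ : ℝ, δ > 0 ∧ ∀ ε : ℝ, 0 < ε → ε < δ →
      SignType.sign (A.ev i (u + ε • w)) =
        if A.ev i u = 0 then SignType.sign (A.ev i w) else SignType.sign (A.ev i u) := by
    intro i
    by_cases h : A.ev i u = 0
    · refine ⟨1, one_pos, fun ε h0 _ => ?_⟩
      rw [if_pos h, map_add, map_smul, h, zero_add, smul_eq_mul, sign_mul, sign_pos h0, one_mul]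
    · obtain ⟨δ, hδ, hh⟩ := sign_add_small (b := A.ev i w) h
      refine ⟨δ, hδ, fun ε h0 h1 => ?_⟩
      rw [if_neg h, map_add, map_smul, smul_eq_mul]
      exact hh ε h0 h1
  choose δ hδ hh using key
  obtain ⟨ε, h0, h1⟩ : ∃ ε : ℝ, ε > 0 ∧ ∀ i, ε < δ i := by
    have hfin := Set.finite_range δ
    by_cases hne : (Set.range δ).Nonempty
    · obtain ⟨m, ⟨i0, rfl⟩, hm⟩ := hfin.exists_minimal hne
      refine ⟨δ i0 / 2, by have := hδ i0; linarith, fun i => ?_⟩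
      have h2 : δ i0 ≤ δ i := by
        by_contra hc
        have := hm ⟨i, rfl⟩ (not_le.1 hc).le
        exact hc this
      have := hδ i0
      linarith
    · exact ⟨1, one_pos, fun i => absurd ⟨δ i, ⟨i, rfl⟩⟩ hne⟩
  exact ⟨u + ε • w, fun i => hh i ε h0 (h1 i)⟩

/-- `K_G`, the face with the signs of `G` where these do not vanish and the signs of `K` elsewhere.
If `K` is a chamber, then this is the chamber adjacent to `G` that is not separated from `K` by any
hyperplane containing `G`. -/
def LFace.comp [Finite ι] {s : Set ι} (G K : A.LFace s) : A.LFace s where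
  sg i := if G.sg i = 0 then K.sg i else G.sg i
  realized := by
    obtain ⟨u, hu⟩ := G.realized
    obtain ⟨w, hw⟩ := K.realized
    obtain ⟨x, hx⟩ := exists_perturb (A := A) u w
    refine ⟨x, fun i => ?_⟩
    rw [hx, hu, hw]
    simp only [sign_eq_zero_iff]

variable (A) in
/-- The chambers: faces without vanishing signs. -/
@[ext]
structure Chamber (s : Set ι) extends A.LFace s where
  ne_zero : ∀ i, sg i ≠ 0

/-- `C(F)`: the chamber of the subarrangement `s` containing a chamber of `t`. -/
def Chamber.restrict {t : Set ι} (C : A.Chamber t) (s : Set ι) (h : s ⊆ t) : A.Chamber s :=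
  ⟨C.toLFace.restrict s h, fun _ => C.ne_zero _⟩

/-- The opposite chamber. -/
def Chamber.neg {s : Set ι} (C : A.Chamber s) : A.Chamber s :=
  ⟨C.toLFace.neg, fun i h => C.ne_zero i (by
    have h' : -C.sg i = 0 := h
    revert h'
    cases C.sg i <;> decide)⟩

/-- The chamber `C_G`. -/
def LFace.compCh [Finite ι] {s : Set ι} (G : A.LFace s) (C : A.Chamber s) : A.Chamber s :=
  ⟨G.comp C.toLFace, fun i h => by
    have h' : (if G.sg i = 0 then C.sg i else G.sg i) = 0 := h
    split_ifs at h' with h0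
    · exact C.ne_zero i h'
    · exact h0 h'⟩

/-! ### The toric Salvetti complex -/

variable (A) in
/-- The Salvetti poset of a local arrangement: pairs `[G, C]` with `C` a chamber and `G ≤ C`. -/
@[ext]
structure SalPos (s : Set ι) where
  face : A.LFace s
  ch : A.Chamber s
  le : face ≤ ch.toLFace

/-- `[G', C'] ≤ [G, C]` if `G ≤ G'` and `C_{G'} = C'`. -/
instance [Finite ι] (s : Set ι) : PartialOrder (A.SalPos s) where
  le x y := y.face ≤ x.face ∧ x.face.compCh y.ch = x.ch
  le_refl x := ⟨fun i => Or.inr rfl, by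
    ext i
    change (if x.face.sg i = 0 then x.ch.sg i else x.face.sg i) = x.ch.sg i
    split_ifs with h
    · rfl
    · exact (x.le i).resolve_left h⟩
  le_trans x y z := by
    rintro ⟨h1, h2⟩ ⟨h3, h4⟩
    refine ⟨fun i => ?_, ?_⟩
    · rcases h3 i with h | h
      · exact Or.inl h
      · rcases h1 i with h' | h'
        · exact Or.inl (h.trans h')
        · exact Or.inr (h.trans h')
    · rw [← h2, ← h4]
      ext i
      change (if x.face.sg i = 0 then z.ch.sg i else x.face.sg i) =
        (if x.face.sg i = 0 then (if y.face.sg i = 0 then z.ch.sg i else y.face.sg i)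
          else x.face.sg i)
      split_ifs with h h'
      · rfl
      · rcases h1 i with h5 | h5
        · exact absurd h5 h'
        · exact absurd (h5.trans h) h'
      · rfl
  le_antisymm x y := by
    rintro ⟨h1, h2⟩ ⟨h3, h4⟩
    have hf : x.face = y.face := by
      ext i
      rcases h1 i with h | h
      · rcases h3 i with h' | h'
        · rw [h, h']
        · exact h'
      · exact h.symm
    have hc : x.ch = y.ch := by
      rw [← h2, hf]
      ext i
      change (if y.face.sg i = 0 then y.ch.sg i else y.face.sg i) = y.ch.sg i
      split_ifs with h
      · rfl
      · exact (y.le i).resolve_left h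
    exact SalPos.ext hf hc

variable (A) in
/-- The index set of `𝒜[F]`. -/
abbrev loc (F : A.Face) : Set ι := A.above F.pts

/-- `F_m`: the face of `𝒜[F]` corresponding to a morphism `m : F ⟶ G`. -/
noncomputable def germ {F G : A.Face} (m : F ⟶ G) : A.LFace (A.loc F) where
  sg i := SignType.sign (A.ev i (dirVec m))
  realized := ⟨dirVec m, fun _ => rfl⟩

lemma sign_dirVec {F G : A.Face} (m : F ⟶ G) {i : ι} {n : ℤ} (h : A.sgn F.rep i n = 0) :
    SignType.sign (A.ev i (dirVec m)) = A.sgn (G.rep + lat m.1) i n := by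
  unfold sgn at h ⊢
  rw [sign_eq_zero_iff] at h
  congr 1
  unfold dirVec
  rw [map_sub]
  linarith

lemma exists_sgn {F : A.Face} {i : ι} (h : i ∈ A.loc F) : ∃ n, A.sgn F.rep i n = 0 :=
  (mem_hyp_iff _ _).1 ((mem_above_iff F i).1 h)

lemma exists_sgn_of_hom {F G : A.Face} (m : F ⟶ G) {i : ι} (h : i ∈ A.loc G) :
    ∃ n, A.sgn F.rep i n = 0 ∧ A.sgn (G.rep + lat m.1) i n = 0 := by
  obtain ⟨n, hn⟩ := exists_sgn h
  have h2 : A.sgn (G.rep + lat m.1) i (n + ∑ j, A.char i j * m.1 j) = 0 := by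
    rw [sgn_add_lat, add_sub_cancel_right, hn]
  refine ⟨_, ?_, h2⟩
  rcases m.2 i (n + ∑ j, A.char i j * m.1 j) with h3 | h3
  · exact h3
  · exact h3.trans h2

lemma loc_mono {F G : A.Face} (m : F ⟶ G) : A.loc G ⊆ A.loc F := by
  intro i h
  obtain ⟨n, hn, -⟩ := exists_sgn_of_hom m h
  exact (mem_above_iff F i).2 ((mem_hyp_iff _ _).2 ⟨n, hn⟩)

lemma germ_eq_zero_iff {F G : A.Face} (m : F ⟶ G) {i : ι} (hF : i ∈ A.loc F) :
    A.ev i (dirVec m) = 0 ↔ i ∈ A.loc G := by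
  rw [← sign_eq_zero_iff]
  constructor
  · intro h
    obtain ⟨n, hn⟩ := exists_sgn hF
    rw [sign_dirVec m hn, sgn_add_lat] at h
    exact (mem_above_iff G i).2 ((mem_hyp_iff _ _).2 ⟨_, h⟩)
  · intro h
    obtain ⟨n, hn, hn'⟩ := exists_sgn_of_hom m h
    rw [sign_dirVec m hn, hn']

open Classical in
/-- The inclusion `i_m : ℱ(𝒜[G]) → ℱ(𝒜[F])` for `m : F ⟶ G`: the signs of `K` on `𝒜[G]` and the
signs of `F_m` elsewhere. -/
noncomputable def incl [Finite ι] {F G : A.Face} (m : F ⟶ G) (K : A.LFace (A.loc G)) :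
    A.LFace (A.loc F) where
  sg i := if h : i.1 ∈ A.loc G then K.sg ⟨i.1, h⟩ else (germ m).sg i
  realized := by
    obtain ⟨w, hw⟩ := K.realized
    obtain ⟨x, hx⟩ := exists_perturb (A := A) (dirVec m) w
    refine ⟨x, fun i => ?_⟩
    rw [hx]
    by_cases h : i.1 ∈ A.loc G
    · rw [dif_pos h, if_pos ((germ_eq_zero_iff m i.2).2 h), hw]
    · rw [dif_neg h, if_neg (fun h' => h ((germ_eq_zero_iff m i.2).1 h'))]
      rfl

lemma incl_sg_of_mem [Finite ι] {F G : A.Face} (m : F ⟶ G) (K : A.LFace (A.loc G))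
    (i : A.loc F) (h : i.1 ∈ A.loc G) : (incl m K).sg i = K.sg ⟨i.1, h⟩ := by
  simp [incl, h]

lemma incl_sg_of_notMem [Finite ι] {F G : A.Face} (m : F ⟶ G) (K : A.LFace (A.loc G))
    (i : A.loc F) (h : i.1 ∉ A.loc G) : (incl m K).sg i = (germ m).sg i := by
  simp [incl, h]

/-- The inclusion `i_m` on chambers. -/
noncomputable def inclCh [Finite ι] {F G : A.Face} (m : F ⟶ G) (C : A.Chamber (A.loc G)) :
    A.Chamber (A.loc F) where
  toLFace := incl m C.toLFace
  ne_zero i := by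
    by_cases h : i.1 ∈ A.loc G
    · rw [incl_sg_of_mem m _ i h]
      exact C.ne_zero _
    · rw [incl_sg_of_notMem m _ i h]
      intro h'
      exact h ((germ_eq_zero_iff m i.2).1 (sign_eq_zero_iff.1 h'))

lemma incl_mono [Finite ι] {F G : A.Face} (m : F ⟶ G) {K K' : A.LFace (A.loc G)} (h : K ≤ K') :
    incl m K ≤ incl m K' := by
  intro i
  by_cases hi : i.1 ∈ A.loc G
  · rw [incl_sg_of_mem m _ i hi, incl_sg_of_mem m _ i hi]
    exact h _
  · right
    rw [incl_sg_of_notMem m _ i hi, incl_sg_of_notMem m _ i hi]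

lemma incl_id [Finite ι] {F : A.Face} (K : A.LFace (A.loc F)) : incl (𝟙 F) K = K := by
  ext i
  rw [incl_sg_of_mem _ _ i i.2]

lemma incl_comp [Finite ι] {F G H : A.Face} (m : F ⟶ G) (m' : G ⟶ H) (K : A.LFace (A.loc H)) :
    incl m (incl m' K) = incl (m ≫ m') K := by
  ext i
  by_cases hH : i.1 ∈ A.loc H
  · have hG := loc_mono m' hH
    rw [incl_sg_of_mem m _ i hG, incl_sg_of_mem m' _ ⟨i.1, hG⟩ hH,
      incl_sg_of_mem (m ≫ m') K i hH]
  · rw [incl_sg_of_notMem (m ≫ m') _ i hH]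
    have hcomp : dirVec (m ≫ m') = dirVec m' + dirVec m := by
      have : (m ≫ m').1 = m'.1 + m.1 := rfl
      unfold dirVec
      rw [this, lat_add]
      abel
    by_cases hG : i.1 ∈ A.loc G
    · rw [incl_sg_of_mem m _ i hG, incl_sg_of_notMem m' _ ⟨i.1, hG⟩ hH]
      change SignType.sign (A.ev i (dirVec m')) = SignType.sign (A.ev i (dirVec (m ≫ m')))
      rw [hcomp, map_add, (germ_eq_zero_iff m i.2).2 hG, add_zero]
    · rw [incl_sg_of_notMem m _ i hG]
      change SignType.sign (A.ev i (dirVec m)) = SignType.sign (A.ev i (dirVec (m ≫ m')))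
      obtain ⟨n, hn⟩ := exists_sgn i.2
      have h0 : A.ev i (dirVec m) ≠ 0 := fun h => hG ((germ_eq_zero_iff m i.2).1 h)
      rw [sign_dirVec m hn, sign_dirVec (m ≫ m') hn]
      have hle := m'.2.add_lat m.1 i.1 n
      rw [add_assoc, ← lat_add] at hle
      rcases hle with h1 | h1
      · rw [← sign_dirVec m hn, sign_eq_zero_iff] at h1
        exact absurd h1 h0
      · exact h1

/-- The map `𝒮(𝒜[G]) → 𝒮(𝒜[F])`, `[K, C] ↦ [i_m K, i_m C]`, for `m : F ⟶ G`. -/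
noncomputable def salMap [Finite ι] {F G : A.Face} (m : F ⟶ G) :
    A.SalPos (A.loc G) →o A.SalPos (A.loc F) where
  toFun x := ⟨incl m x.face, inclCh m x.ch, incl_mono m x.le⟩
  monotone' := by
    rintro x y ⟨h1, h2⟩
    refine ⟨incl_mono m h1, ?_⟩
    ext i
    have h3 : ∀ j, (if x.face.sg j = 0 then y.ch.sg j else x.face.sg j) = x.ch.sg j :=
      fun j => congrArg (fun C : A.Chamber (A.loc G) => C.sg j) h2
    change (if (incl m x.face).sg i = 0 then (incl m y.ch.toLFace).sg i
      else (incl m x.face).sg i) = (incl m x.ch.toLFace).sg i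
    by_cases hi : i.1 ∈ A.loc G
    · rw [incl_sg_of_mem m _ i hi, incl_sg_of_mem m _ i hi, incl_sg_of_mem m _ i hi]
      exact h3 _
    · rw [incl_sg_of_notMem m _ i hi, incl_sg_of_notMem m _ i hi, incl_sg_of_notMem m _ i hi]
      split_ifs <;> rfl

variable (A)

/-- The diagram of posets `𝒟 : ℱ(𝒜)ᵒᵖ → Posets`, `F ↦ 𝒮(𝒜[F])`. -/
noncomputable def diagram [Finite ι] : (A.Face)ᵒᵖ ⥤ Preord.{0} where
  obj F := Preord.of (A.SalPos (A.loc F.unop))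
  map m := Preord.ofHom (salMap m.unop)
  map_id F := by
    apply Preord.hom_ext
    apply OrderHom.ext
    funext x
    exact SalPos.ext (incl_id _) (Chamber.ext (congrArg LFace.sg (incl_id x.ch.toLFace)))
  map_comp f g := by
    apply Preord.hom_ext
    apply OrderHom.ext
    funext x
    exact SalPos.ext (incl_comp _ _ _).symm
      (Chamber.ext (congrArg LFace.sg (incl_comp g.unop f.unop x.ch.toLFace).symm))

/-- The toric Salvetti complex `Sal(𝒜)`, as the Grothendieck construction `∫ 𝒟`. -/
abbrev Sal [Finite ι] : Type := Grothendieck (A.diagram ⋙ preordToCat)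

variable {A}

/-- The object `(F, x)` of `∫ 𝒟`. -/
noncomputable def pt [Finite ι] (F : A.Face) (x : A.SalPos (A.loc F)) : A.Sal := ⟨Opposite.op F, x⟩

/-- Membership of `[G, K]` in the stratum `𝒮^{F₀}(𝒜[F])`: there is a chamber `C ≥ F₀` such that
`K = C_G`. -/
def InStratum [Finite ι] {s : Set ι} (F₀ : A.LFace Set.univ) (x : A.SalPos s) : Prop :=
  ∃ C : A.Chamber s, F₀.restrict s (Set.subset_univ s) ≤ C.toLFace ∧ x.ch = x.face.compCh C

variable (A) in
/-- The objects `(F, x)` of `∫ 𝒟` with `F ⊆ Y` and `x ∈ 𝒮^{F₀}(𝒜[F])`. -/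
def subProp [Finite ι] (Y : A.Layer) (F₀ : A.LFace Set.univ) : ObjectProperty A.Sal :=
  fun X => X.base.unop.pts ⊆ Y.1 ∧ InStratum (s := A.loc X.base.unop) F₀ X.fiber

variable (A) in
/-- The subcomplex `𝒮_{Y,F₀}` of `Sal(𝒜)`. -/
abbrev SubSal [Finite ι] (Y : A.Layer) (F₀ : A.LFace Set.univ) : Type :=
  (A.subProp Y F₀).FullSubcategory

variable (A) in
/-- The inclusion `φ : 𝒮_{Y,F₀} → Sal(𝒜)`. -/
noncomputable abbrev subIncl [Finite ι] (Y : A.Layer) (F₀ : A.LFace Set.univ) : A.SubSal Y F₀ ⥤ A.Sal :=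
  (A.subProp Y F₀).ι

/-! ### The homology classes `λ̂` -/

variable (A) in
/-- A gallery of chambers in `𝒜₀`; consecutive chambers share a wall, that is, a face of
codimension one. -/
structure Gallery where
  len : ℕ
  chm : Fin (len + 1) → A.Chamber Set.univ
  wall : Fin len → A.LFace Set.univ
  codim : ∀ j, Module.finrank ℝ (wall j).hull + 1 = d
  le_left : ∀ j, wall j ≤ (chm j.castSucc).toLFace
  le_right : ∀ j, wall j ≤ (chm j.succ).toLFace

open Classical in
variable (A) in
/-- The choice attached to a one-dimensional layer `M`: a chamber `ᴹC` adjacent to `X_M` and a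
minimal gallery from `ᴹC` to `op_{X_M}(-ᴹC)`, the chamber separated from `ᴹC` exactly by the
hyperplanes that do not contain `X_M`. -/
structure LineGallery (M : A.Line) extends Gallery A where
  adjacent : ∃ R : A.LFace Set.univ, R ≤ (chm 0).toLFace ∧ R.hull = A.dirSpace M.1.1
  final : ∀ i, (chm (Fin.last len)).sg i =
    if A.dirSpace M.1.1 ≤ LinearMap.ker (A.ev i) then (chm 0).sg i else -(chm 0).sg i
  minimal : ∀ g : Gallery A, g.chm 0 = chm 0 → g.chm (Fin.last g.len) = chm (Fin.last len) →
    len ≤ g.len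

/-- The vertex `(F, [C(F), C(F)])`. -/
noncomputable def vtx [Finite ι] (F : A.Face) (C : A.Chamber Set.univ) : A.Sal :=
  pt F ⟨(C.restrict (A.loc F) (Set.subset_univ _)).toLFace,
    C.restrict (A.loc F) (Set.subset_univ _), fun _ => Or.inr rfl⟩

lemma le_compCh [Finite ι] {s : Set ι} (G : A.LFace s) (C : A.Chamber s) :
    G ≤ (G.compCh C).toLFace := by
  intro i
  change G.sg i = 0 ∨ G.sg i = if G.sg i = 0 then C.sg i else G.sg i
  split_ifs with h
  · exact Or.inl h
  · exact Or.inr rfl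

/-- The vertex `(F, [W, B(F)_W])`, where `W` is now considered in `𝒜[F]`. -/
noncomputable def edg [Finite ι] (F : A.Face) (W : A.LFace Set.univ) (B : A.Chamber Set.univ) : A.Sal :=
  pt F ⟨W.restrict (A.loc F) (Set.subset_univ _),
    (W.restrict (A.loc F) (Set.subset_univ _)).compCh (B.restrict (A.loc F) (Set.subset_univ _)),
    le_compCh _ _⟩

namespace LineGallery

variable [Finite ι] {M : A.Line} (g : A.LineGallery M) (B : A.Chamber Set.univ)

/-- The `j`-th step of the gallery crosses a hyperplane of `𝒜[P]`, that is, `C_j(P) ≠ C_{j+1}(P)`.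
The successive steps of this kind give the gallery `C_0^P, W_1^P, C_1^P, …` of `𝒜[P]`. -/
def Crosses (P : A.Face) (j : Fin g.len) : Prop :=
  (g.chm j.castSucc).restrict (A.loc P) (Set.subset_univ _) ≠
    (g.chm j.succ).restrict (A.loc P) (Set.subset_univ _)

/-- The arrows `v_j → e_j` over the zero-dimensional faces `P` of `M`. -/
def IsForward (f : Arrow A.Sal) : Prop :=
  ∃ P : A.Face, P.pts ⊆ M.1.1 ∧ A.dim P.pts = 0 ∧ ∃ j : Fin g.len, g.Crosses P j ∧
    f.left = vtx P (g.chm j.castSucc) ∧ f.right = edg P (g.wall j) B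

/-- The arrows `v_{j+1} → e_j` over the zero-dimensional faces `P` of `M`. -/
def IsBackward (f : Arrow A.Sal) : Prop :=
  ∃ P : A.Face, P.pts ⊆ M.1.1 ∧ A.dim P.pts = 0 ∧ ∃ j : Fin g.len, g.Crosses P j ∧
    f.left = vtx P (g.chm j.succ) ∧ f.right = edg P (g.wall j) B

/-- The arrows `(G, v) → (P, v_j)` between vertices over faces `G`, `P` of `M` of dimensions one
and zero. -/
def IsLink (f : Arrow A.Sal) : Prop :=
  ∃ P G : A.Face, P.pts ⊆ M.1.1 ∧ G.pts ⊆ M.1.1 ∧ A.dim P.pts = 0 ∧ A.dim G.pts = 1 ∧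
    ∃ j j' : Fin (g.len + 1), f.left = vtx G (g.chm j) ∧ f.right = vtx P (g.chm j')

/-- The cycle `[Λ_B^M]`: the cycle supported on the edges of the circle `Λ_B^M`, with
coefficient `1` on the arrows `v_j → e_j`. -/
def IsLambdaCycle (z : Arrow A.Sal →₀ ℚ) : Prop :=
  CatHom.bdry1 A.Sal z = 0 ∧
    (∀ f ∈ z.support, g.IsForward B f ∨ g.IsBackward B f ∨ g.IsLink f) ∧
    ∀ f, g.IsForward B f → z f = 1

/-- The homology class `λ̂_B^M` in a subcomplex `D` of `Sal(𝒜)` that contains `Λ_B^M`: the class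
of the cycle of `D` with image `[Λ_B^M]` in `Sal(𝒜)`. -/
noncomputable def lambdaHat {D : Type} [Category.{0} D] (Φ : D ⥤ A.Sal) : CatHom.H1 D :=
  Classical.epsilon fun c => ∃ z : CatHom.Cycles D,
    CatHom.H1.cls D z = c ∧ g.IsLambdaCycle B (CatHom.chainMap Φ z.1)

end LineGallery

/-! ### The homology classes `ω̂` -/

section Omega

variable [Finite ι]

/-- `Ω^(m)` for `m : F ⟶ G` and a chamber `C` of `𝒜[F]`: the vertex `(F, [C_{F_m}, C_{F_m}])`. -/
noncomputable def omegaV {F G : A.Face} (m : F ⟶ G) (C : A.Chamber (A.loc F)) : A.Sal :=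
  pt F ⟨((germ m).compCh C).toLFace, (germ m).compCh C, fun _ => Or.inr rfl⟩

/-- `Ω^(m)` for `m : F ⟶ G` and a chamber `C` of `𝒜[F]`: the vertex `(F, [F_m, C_{F_m}])`. -/
noncomputable def omegaE {F G : A.Face} (m : F ⟶ G) (C : A.Chamber (A.loc F)) : A.Sal :=
  pt F ⟨germ m, (germ m).compCh C, le_compCh _ _⟩

/-- The cycle `[Ω^(m)]`: supported on the four arrows between the two vertices `[C_i, C_i]` and the
two vertices `[F_m, C_i]`, where `C_1 = K(F)_{F_m}` and `C_2 = (-K(F))_{F_m}`, with coefficient `1`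
on the arrow `[C_1, C_1] → [F_m, C_1]`. -/
def IsOmegaCycle {F G : A.Face} (m : F ⟶ G) (K : A.Chamber Set.univ) (z : Arrow A.Sal →₀ ℚ) :
    Prop :=
  let K₁ : A.Chamber (A.loc F) := K.restrict (A.loc F) (Set.subset_univ _)
  CatHom.bdry1 A.Sal z = 0 ∧
    (∀ f ∈ z.support, (f.left = omegaV m K₁ ∨ f.left = omegaV m K₁.neg) ∧
      (f.right = omegaE m K₁ ∨ f.right = omegaE m K₁.neg)) ∧
    ∀ f : Arrow A.Sal, f.left = omegaV m K₁ → f.right = omegaE m K₁ → z f = 1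

/-- The homology class `ω̂_H`, for the hypertorus `H` with index `i`, in a subcomplex `D`
of `Sal(𝒜)`: the class of the cycle of `D` with image `[Ω^(m)]`, for any `m : F ⟶ G` such that the
support of `G` is `H`. -/
noncomputable def omegaHat (K : A.Chamber Set.univ) (i : ι) {D : Type} [Category.{0} D]
    (Φ : D ⥤ A.Sal) : CatHom.H1 D :=
  Classical.epsilon fun c => ∃ (F G : A.Face) (m : F ⟶ G), A.above G.pts = {i} ∧
    ∃ z : CatHom.Cycles D, CatHom.H1.cls D z = c ∧ IsOmegaCycle m K (CatHom.chainMap Φ z.1)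

end Omega

/-! ### Signs and separating sets -/

/-- The linear hyperplane of the `i`-th hypertorus separates `B` from `B'`. -/
def Separates (i : ι) (B B' : A.Chamber Set.univ) : Prop :=
  B.sg ⟨i, trivial⟩ ≠ B'.sg ⟨i, trivial⟩

/-- `S_F(B, B')`: the hypertori that contain `F` and whose linear hyperplane separates
`B` from `B'`. -/
def sepSet (F : A.Face) (B B' : A.Chamber Set.univ) : Set ι :=
  {i | i ∈ A.above F.pts ∧ Separates i B B'}

open Classical in
/-- The sign `ε(H, B)`, relative to the chamber `K = ᴴC`: it is `-1` if `H₀` separates `K` from `B`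
and `1` otherwise. -/
noncomputable def eps (i : ι) (K B : A.Chamber Set.univ) : ℚ := if Separates i K B then -1 else 1

end ToricArrangement

/-! ### Duality between the first homology and cohomology of a category. -/

namespace CatHom

universe v u v' u'

variable {C : Type u} [Category.{v} C] {D : Type u'} [Category.{v'} D]

/-! A class in first homology is recognised by two kinds of periods. The cocycle `wind i` gives its
winding number around the `i`-th hypertorus (`windMap`), and the cocycles `shiftForm l` give its
displacement in `ℚ ^ d` (`transMap`), that is, its image in the homology of the compact torus.

The core is `IsCocycleOn.exists_standard_form`: on a stratum `𝒮_{Y,F₀}`, if each hypertorus that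
matters meets `Y` in a single layer, every cocycle is cohomologous to a combination of these. The
value of a cocycle on the small quadrilaterals around a hypertorus `H` is one number, because `Y ∩
H` is connected, and subtracting multiples of `wind i` makes all these numbers zero. What remains is
exact on each fibre `𝒮(𝒜[F])`, hence comes from a cocycle on the category of faces of `Y`. Lifted to
a component of the preimage of `Y` in `ℝ ^ d`, which is convex, that cocycle has a potential
(`AdditiveOn.hasPotential`), and integer translations change the potential by a homomorphism, that
is, by a linear form. Consequently a class without periods is zero (`sal_eq_zero_of_periods`,
`subSal_eq_zero_of_periods`).

The periods of the distinguished classes are then computed from explicit cycles. The class `ω̂_H`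
has winding number `1` around `H`, `0` around the others, and displacement `0`. The displacement of
`λ̂^M_B` does not depend on `B`; its winding number around `H` is zero if `B` is on the negative
side of `H₀`, and otherwise the sign of `ᴹC` times the number of points of `M ∩ H`, counted as zero
if `M ⊆ H` (`wind_lambdaChain`). A dimension count by `exists_basis_of_block` gives both homology
bases.

For the restriction, compare `λ̂^{N_h}_{B(L)}` in `Sal(𝒜)` with `λ̂^{N_h}_{F(T)} = ∑ a_{hi}
λ̂^{M_i}_{F(T)}`. The displacements agree, and the winding numbers differ only at those `H` that
separate `B(L)` from `B(T)`, by the signed number of points counted in `σ_H` (`finsum_eps`). So the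
first class is the second plus the sum of these numbers times `ω̂_H`, while `ω̂_H` goes to `ω̂_H`.
Transposing this yields the formulas. -/

lemma pairing_mk (c : Cocycles C) (z : Cycles C) :
    pairing (Submodule.Quotient.mk c) (H1.cls C z) = Finsupp.linearCombination ℚ c.1 z.1 := rfl

lemma cls_surjective (x : H1 C) : ∃ z, H1.cls C z = x := Submodule.Quotient.mk_surjective _ x

/-- The cocycle given by a linear form on chains that vanishes on boundaries. -/
lemma exists_cocycle_of_vanishing (f : (Arrow C →₀ ℚ) →ₗ[ℚ] ℚ)
    (hf : ∀ w, f (bdry2 C w) = 0) :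
    ∃ c : Cocycles C, ∀ z, Finsupp.linearCombination ℚ c.1 z = f z := by
  refine ⟨⟨fun a => f (Finsupp.single a 1), fun X Y Z g h => ?_⟩, fun z => ?_⟩
  · have := hf (Finsupp.single ⟨X, Y, Z, g, h⟩ 1)
    simpa [bdry2] using this
  · have : Finsupp.linearCombination ℚ (fun a => f (Finsupp.single a 1)) = f := by
      ext a; simp
    exact LinearMap.congr_fun this z

/-- A cycle on which all cocycles vanish is a boundary. -/
lemma cls_eq_zero_of_forall_cocycle (z : Cycles C)
    (h : ∀ c : Cocycles C, Finsupp.linearCombination ℚ c.1 z.1 = 0) : H1.cls C z = 0 := by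
  by_contra hz
  have hz' : z.1 ∉ LinearMap.range (bdry2 C) := fun hc =>
    hz ((Submodule.Quotient.mk_eq_zero _).2 hc)
  -- Over a field, a chain outside the space of boundaries is detected by a linear form vanishing on
  -- that space, and such a form is a cocycle.
  obtain ⟨f, hf, hk⟩ := Submodule.exists_le_ker_of_notMem hz'
  obtain ⟨c, hc⟩ := exists_cocycle_of_vanishing f (fun w => hk ⟨w, rfl⟩)
  exact hf (by rw [← hc]; exact h c)

/-- A cochain vanishing on the kernel of `bdry1` factors through `bdry1`, since over a field the
range of a transpose is the annihilator of the kernel; the factor is the required `0`-cochain. -/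
lemma pairing_injective : Function.Injective (pairing (C := C)) := by
  rw [← LinearMap.ker_eq_bot, LinearMap.ker_eq_bot']
  intro x hx
  obtain ⟨c, rfl⟩ := Submodule.Quotient.mk_surjective _ x
  have h : Finsupp.linearCombination ℚ c.1 ∈ (LinearMap.ker (bdry1 C)).dualAnnihilator := by
    rw [Submodule.mem_dualAnnihilator]
    intro z hz
    have := LinearMap.congr_fun hx (H1.cls C ⟨z, hz⟩)
    rwa [pairing_mk] at this
  rw [← LinearMap.range_dualMap_eq_dualAnnihilator_ker] at h
  obtain ⟨u, hu⟩ := h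
  refine (Submodule.Quotient.mk_eq_zero _).2 ⟨fun X => u (Finsupp.single X 1), ?_⟩
  funext f
  have := LinearMap.congr_fun hu (Finsupp.single f 1)
  simpa [bdry1, cobdry] using this

/-- A functional on homology is a form on cycles. Any extension of it to all chains still vanishes
on boundaries, so the extension is a cocycle. -/
lemma pairing_surjective : Function.Surjective (pairing (C := C)) := by
  intro f
  obtain ⟨g, hg⟩ := LinearMap.exists_extend (f ∘ₗ Submodule.mkQ
    ((LinearMap.range (bdry2 C)).submoduleOf (Cycles C)))
  have hg' : ∀ z : Cycles C, g z.1 = f (H1.cls C z) := fun z => LinearMap.congr_fun hg z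
  have hbd : ∀ w, bdry1 C (bdry2 C w) = 0 := by
    intro w
    have h : bdry1 C ∘ₗ bdry2 C = 0 := by
      ext p : 2
      simp only [bdry1, bdry2, LinearMap.comp_apply, Finsupp.lsingle_apply,
        Finsupp.linearCombination_single, one_smul, map_add, map_sub, LinearMap.zero_apply,
        Arrow.mk_left, Arrow.mk_right]
      abel
    exact LinearMap.congr_fun h w
  obtain ⟨c, hc⟩ := exists_cocycle_of_vanishing g (fun w => by
    rw [hg' ⟨bdry2 C w, hbd w⟩]
    have : H1.cls C ⟨bdry2 C w, hbd w⟩ = 0 := (Submodule.Quotient.mk_eq_zero _).2 ⟨w, rfl⟩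
    rw [this, map_zero])
  refine ⟨Submodule.Quotient.mk c, LinearMap.ext fun x => ?_⟩
  obtain ⟨z, rfl⟩ := cls_surjective x
  rw [pairing_mk, hc, hg']

/-- The basis of the first cohomology dual to a finite basis of the first homology. -/
lemma exists_dual_basis {J : Type*} [Finite J] [DecidableEq J] (β : Module.Basis J ℚ (H1 C)) :
    ∃ βd : Module.Basis J ℚ (Coh1 C), ∀ x y, pairing (βd x) (β y) = if x = y then 1 else 0 := by
  let e := LinearEquiv.ofBijective (pairing (C := C)) ⟨pairing_injective, pairing_surjective⟩
  refine ⟨β.dualBasis.map e.symm, fun x y => ?_⟩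
  have : pairing (e.symm (β.dualBasis x)) = β.dualBasis x := e.apply_symm_apply _
  rw [Module.Basis.map_apply, this, Module.Basis.dualBasis_apply_self]
  exact if_congr eq_comm rfl rfl

lemma bdry1_chainMap (Φ : D ⥤ C) (z : Arrow D →₀ ℚ) :
    bdry1 C (chainMap Φ z) = Finsupp.mapDomain Φ.obj (bdry1 D z) := by
  have h : bdry1 C ∘ₗ chainMap Φ = Finsupp.lmapDomain ℚ ℚ Φ.obj ∘ₗ bdry1 D := by
    ext f : 2
    simp [bdry1, chainMap, Finsupp.mapDomain_sub, Finsupp.mapDomain_single]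
  exact LinearMap.congr_fun h z

lemma bdry1_chainMap_eq_zero (Φ : D ⥤ C) (z : Cycles D) : bdry1 C (chainMap Φ z.1) = 0 := by
  have hz : bdry1 D z.1 = 0 := z.2
  rw [bdry1_chainMap, hz, Finsupp.mapDomain_zero]

lemma linearCombination_pullCocycles (Φ : D ⥤ C) (c : Cocycles C) (z : Arrow D →₀ ℚ) :
    Finsupp.linearCombination ℚ (pullCocycles Φ c).1 z
      = Finsupp.linearCombination ℚ c.1 (chainMap Φ z) := by
  have h : Finsupp.linearCombination ℚ (pullCocycles Φ c).1
      = Finsupp.linearCombination ℚ c.1 ∘ₗ chainMap Φ := by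
    ext f : 2
    simp [chainMap, pullCocycles, Finsupp.mapDomain_single]
  exact LinearMap.congr_fun h z

lemma pairing_pull (Φ : D ⥤ C) (x : Coh1 C) (z : Cycles D) :
    pairing (pull Φ x) (H1.cls D z)
      = pairing x (H1.cls C ⟨chainMap Φ z.1, bdry1_chainMap_eq_zero Φ z⟩) := by
  obtain ⟨c, rfl⟩ := Submodule.Quotient.mk_surjective _ x
  exact linearCombination_pullCocycles Φ c z.1

lemma chainMap_id (z : Arrow C →₀ ℚ) : chainMap (𝟭 C) z = z := by
  have h : chainMap (𝟭 C) = LinearMap.id := by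
    ext f : 2
    simp [chainMap, Finsupp.mapDomain_single]
  exact LinearMap.congr_fun h z

/-- If all but one of the arrows of a cycle avoid an object, then the remaining arrow, ending or
starting there, has coefficient zero. -/
lemma eq_zero_of_unique_arrow {z : Arrow C →₀ ℚ} (hz : bdry1 C z = 0) (X : C) (f : Arrow C)
    (hf : f.left = X ∧ f.right ≠ X ∨ f.left ≠ X ∧ f.right = X)
    (h : ∀ g ∈ z.support, g ≠ f → g.left ≠ X ∧ g.right ≠ X) : z f = 0 := by
  classical
  have h1 : bdry1 C z X = 0 := by rw [hz]; rfl
  rw [bdry1, Finsupp.linearCombination_apply, Finsupp.sum, Finsupp.finsetSum_apply] at h1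
  by_contra hne
  rw [Finset.sum_eq_single f] at h1
  · rcases hf with ⟨ha, hb⟩ | ⟨ha, hb⟩
    · simp [ha, hb] at h1
      exact hne h1
    · simp [ha, hb] at h1
      exact hne h1
  · intro g hg hgf
    obtain ⟨ha, hb⟩ := h g hg hgf
    simp [ha, hb]
  · intro hc
    exact absurd (Finsupp.mem_support_iff.2 hne) hc

/-- A chain supported on a full subcategory lifts to it, together with its boundary. -/
lemma exists_chain_lift {P : ObjectProperty C} (z : Arrow C →₀ ℚ) (hz : bdry1 C z = 0)
    (h : ∀ f ∈ z.support, P f.left ∧ P f.right) :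
    ∃ w : Cycles P.FullSubcategory, chainMap P.ι w.1 = z := by
  classical
  let lift : {f // f ∈ z.support} → Arrow P.FullSubcategory := fun f =>
    Arrow.mk (P.homMk f.1.hom : (⟨f.1.left, (h f.1 f.2).1⟩ : P.FullSubcategory) ⟶
      ⟨f.1.right, (h f.1 f.2).2⟩)
  let w : Arrow P.FullSubcategory →₀ ℚ := ∑ f ∈ z.support.attach, Finsupp.single (lift f) (z f.1)
  have hw : chainMap P.ι w = z := by
    have h1 : chainMap P.ι w = ∑ f ∈ z.support.attach, Finsupp.single f.1 (z f.1) := by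
      rw [map_sum]
      refine Finset.sum_congr rfl fun f _ => ?_
      simp only [chainMap, Finsupp.lmapDomain_apply, Finsupp.mapDomain_single]
      rfl
    rw [h1, Finset.sum_attach z.support (fun f => Finsupp.single f (z f))]
    exact Finsupp.sum_single z
  refine ⟨⟨w, ?_⟩, hw⟩
  have h2 := bdry1_chainMap P.ι w
  rw [hw, hz] at h2
  -- A full subcategory is injective on objects, so the vanishing of the boundary may be tested in
  -- the ambient category.
  refine Finsupp.mapDomain_injective (f := P.ι.obj) ?_ ?_
  · intro X Y hXY
    exact ObjectProperty.FullSubcategory.ext hXY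
  · rw [← h2, Finsupp.mapDomain_zero]

end CatHom

namespace ToricArrangement

variable {ι : Type} {d : ℕ} {A : ToricArrangement ι d}

open Topology Filter

/-! ### Lifted faces -/

lemma continuous_ev (i : ι) : Continuous (A.ev i) := LinearMap.continuous_of_finiteDimensional _

lemma ev_apply (i : ι) (x : Fin d → ℝ) : A.ev i x = ∑ j, (A.char i j : ℝ) * x j := by
  simp [ev]

/-- A locally constant function on a convex set is constant. -/
lemma eq_of_eventually_eq {α : Type*} {K : Set (Fin d → ℝ)} (hK : Convex ℝ K)
    (f : (Fin d → ℝ) → α) (h : ∀ x ∈ K, ∀ᶠ y in 𝓝 x, y ∈ K → f x = f y) {x y : Fin d → ℝ}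
    (hx : x ∈ K) (hy : y ∈ K) : f x = f y := by
  let _ : TopologicalSpace α := ⊥
  have : DiscreteTopology α := ⟨rfl⟩
  refine hK.isPreconnected.constant (f := f) (fun z hz => ?_) hx hy
  refine ContinuousWithinAt.congr_of_eventuallyEq (f := fun _ => f z)
    continuousWithinAt_const ?_ rfl
  rw [EventuallyEq, eventually_nhdsWithin_iff]
  filter_upwards [h z hz] with y hy hyK using (hy hyK).symm

lemma eventually_faceLE [Finite ι] (x : Fin d → ℝ) : ∀ᶠ y in 𝓝 x, A.FaceLE x y := by
  unfold FaceLE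
  rw [eventually_all]
  intro i
  set a := A.ev i x - A.shift i with ha
  have hcont : Continuous fun y => A.ev i y - A.shift i := (continuous_ev i).sub continuous_const
  -- This single interval around `a` contains no integer except possibly `a` itself, so it controls
  -- the infinitely many levels `n` at once.
  have h1 : ∀ᶠ y in 𝓝 x, A.ev i y - A.shift i ∈ Set.Ioo ((⌈a⌉ : ℝ) - 1) (⌊a⌋ + 1) := by
    apply hcont.continuousAt.eventually_mem
    apply Ioo_mem_nhds
    · linarith [Int.ceil_lt_add_one a]
    · exact Int.lt_floor_add_one a
  filter_upwards [h1] with y hy n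
  unfold sgn
  rw [← ha]
  rcases lt_trichotomy a n with h | h | h
  · right
    have h2 : (⌊a⌋ : ℝ) + 1 ≤ n := by exact_mod_cast Int.floor_lt.2 h
    rw [sign_neg (by linarith), sign_neg (by linarith [hy.2])]
  · left
    rw [h, sub_self, sign_zero]
  · right
    have h2 : (n : ℝ) ≤ ⌈a⌉ - 1 := by
      have := Int.lt_ceil.2 h
      have h3 : n ≤ ⌈a⌉ - 1 := by omega
      exact_mod_cast h3
    rw [sign_pos (by linarith), sign_pos (by linarith [hy.1])]

/-- A function on a convex set that does not distinguish a lifted face from the faces in whose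
closure it lies is constant. -/
lemma eq_of_faceLE_invariant [Finite ι] {α : Type*} {K : Set (Fin d → ℝ)} (hK : Convex ℝ K)
    (f : (Fin d → ℝ) → α) (h : ∀ x ∈ K, ∀ y ∈ K, A.FaceLE x y → f x = f y) {x y : Fin d → ℝ}
    (hx : x ∈ K) (hy : y ∈ K) : f x = f y :=
  eq_of_eventually_eq hK f (fun z hz => by
    filter_upwards [eventually_faceLE (A := A) z] with w hw hwK using h z hz w hwK hw) hx hy

lemma lat_neg (v : Fin d → ℤ) : lat (-v) = -lat v := by funext j; simp [lat]

lemma lat_sub (v w : Fin d → ℤ) : lat (v - w) = lat v - lat w := by funext j; simp [lat]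

lemma lat_injective : Function.Injective (lat (d := d)) := fun v w h => by
  funext j
  have := congrFun h j
  simpa [lat] using this

/-- Translation by `v` changes `ev i` by an integer `N`. If `N ≠ 0`, the translate crosses or
reaches the integer level next to `x`, from which `x` is strictly away, so the signs differ. Hence
every character kills `v`, and essentiality gives `v = 0`. This makes the action on lifted faces
free, with unique translations and no nontrivial endomorphisms of faces. -/
lemma eq_zero_of_faceLE_add_lat (hA : A.Essential) {x : Fin d → ℝ} {v : Fin d → ℤ}
    (h : A.FaceLE x (x + lat v)) : v = 0 := by
  apply lat_injective
  rw [lat_zero]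
  refine hA _ fun i => ?_
  set N : ℤ := ∑ j, A.char i j * v j with hN
  rw [ev_lat, ← hN]
  set a := A.ev i x - A.shift i with ha
  have key : ∀ n : ℤ, SignType.sign (a - n) = 0 ∨
      SignType.sign (a - n) = SignType.sign (a + N - n) := by
    intro n
    have := h i n
    unfold sgn at this
    rw [map_add, ev_lat, ← hN, ← ha] at this
    convert this using 4
    rw [ha]; ring
  rcases lt_trichotomy N 0 with hlt | heq | hgt
  · exfalso
    have hN1 : (N : ℝ) ≤ -1 := by exact_mod_cast Int.le_sub_one_of_lt hlt
    have h1 := key (⌈a⌉ - 1)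
    push_cast at h1
    have h2 := Int.ceil_lt_add_one a
    have h3 := Int.le_ceil a
    rw [sign_pos (by linarith)] at h1
    rcases h1 with h1 | h1
    · exact absurd h1 (by decide)
    · have := sign_eq_one_iff.1 h1.symm
      linarith
  · rw [heq, Int.cast_zero]
  · exfalso
    have hN1 : (1 : ℝ) ≤ N := by exact_mod_cast hgt
    have h1 := key (⌊a⌋ + 1)
    push_cast at h1
    have h2 := Int.lt_floor_add_one a
    have h3 := Int.floor_le a
    rw [sign_neg (by linarith)] at h1
    rcases h1 with h1 | h1
    · exact absurd h1 (by decide)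
    · have := sign_eq_neg_one_iff.1 h1.symm
      linarith

/-- The face containing the image of a point. -/
def Face.mk (x : Fin d → ℝ) : A.Face := Quotient.mk A.faceSetoid x

lemma Face.mk_rep (F : A.Face) : Face.mk F.rep = F := Quotient.out_eq F

lemma Face.mem_pts {F : A.Face} {x : Fin d → ℝ} : x ∈ F.pts ↔ Face.mk x = F := Iff.rfl

lemma Face.mk_eq_mk {x y : Fin d → ℝ} :
    (Face.mk x : A.Face) = Face.mk y ↔ ∃ v : Fin d → ℤ, ∀ i n, A.sgn (x + lat v) i n = A.sgn y i n :=
  ⟨fun h => Quotient.exact h, fun h => Quotient.sound h⟩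

lemma exists_translation (A : ToricArrangement ι d) (x : Fin d → ℝ) : ∃ v : Fin d → ℤ, ∀ i n,
    A.sgn ((Face.mk x : A.Face).rep + lat v) i n = A.sgn x i n :=
  Face.mk_eq_mk.1 (Face.mk_rep (Face.mk x))

variable (A) in
/-- The translation that takes the chosen lift of the face of `x` to the lift containing `x`. -/
noncomputable def tr (x : Fin d → ℝ) : Fin d → ℤ := (exists_translation A x).choose

lemma sgn_rep_add_tr (x : Fin d → ℝ) (i : ι) (n : ℤ) :
    A.sgn ((Face.mk x : A.Face).rep + lat (A.tr x)) i n = A.sgn x i n :=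
  (exists_translation A x).choose_spec i n

lemma faceLE_of_sgn_eq {x y : Fin d → ℝ} (h : ∀ i n, A.sgn x i n = A.sgn y i n) : A.FaceLE x y :=
  fun i n => Or.inr (h i n)

lemma eq_of_sgn_add_lat (hA : A.Essential) {x : Fin d → ℝ} {v w : Fin d → ℤ}
    (h : ∀ i n, A.sgn (x + lat v) i n = A.sgn (x + lat w) i n) : v = w := by
  have h1 : A.FaceLE (x + lat v) ((x + lat v) + lat (w - v)) := by
    apply faceLE_of_sgn_eq
    intro i n
    rw [h, add_assoc, ← lat_add]
    congr 3
    abel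
  have := eq_zero_of_faceLE_add_lat hA h1
  rw [sub_eq_zero] at this
  exact this.symm

lemma mk_eq_and_tr_eq (hA : A.Essential) {F : A.Face} {x : Fin d → ℝ} {v : Fin d → ℤ}
    (h : ∀ i n, A.sgn (F.rep + lat v) i n = A.sgn x i n) : Face.mk x = F ∧ A.tr x = v := by
  have h1 : Face.mk x = F := by
    rw [← Face.mk_rep F]
    exact (Face.mk_eq_mk.2 ⟨v, h⟩).symm
  refine ⟨h1, ?_⟩
  subst h1
  apply eq_of_sgn_add_lat hA (x := (Face.mk x : A.Face).rep)
  intro i n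
  rw [h, sgn_rep_add_tr]

lemma tr_add_lat (hA : A.Essential) (x : Fin d → ℝ) (v : Fin d → ℤ) :
    (Face.mk (x + lat v) : A.Face) = Face.mk x ∧ A.tr (x + lat v) = A.tr x + v := by
  apply mk_eq_and_tr_eq hA
  intro i n
  rw [lat_add, ← add_assoc, sgn_add_lat, sgn_add_lat A x, sgn_rep_add_tr]

lemma FaceLE.hom_aux {x y : Fin d → ℝ} (h : A.FaceLE x y) :
    A.FaceLE (Face.mk x : A.Face).rep ((Face.mk y : A.Face).rep + lat (A.tr y - A.tr x)) := by
  have h1 : A.FaceLE ((Face.mk x : A.Face).rep + lat (A.tr x))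
      ((Face.mk y : A.Face).rep + lat (A.tr y)) :=
    ((faceLE_of_sgn_eq (sgn_rep_add_tr x)).trans h).trans
      (faceLE_of_sgn_eq fun i n => (sgn_rep_add_tr y i n).symm)
  have h2 := h1.add_lat (-A.tr x)
  rw [lat_neg, add_neg_cancel_right] at h2
  rw [lat_sub]
  convert h2 using 1
  abel

/-- The morphism of faces given by two points, the second in a larger lifted face. -/
noncomputable def FaceLE.hom {x y : Fin d → ℝ} (h : A.FaceLE x y) :
    (Face.mk x : A.Face) ⟶ Face.mk y := ⟨A.tr y - A.tr x, h.hom_aux⟩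

lemma FaceLE.hom_comp {x y z : Fin d → ℝ} (h : A.FaceLE x y) (k : A.FaceLE y z) :
    h.hom ≫ k.hom = (h.trans k).hom := by
  apply Subtype.ext
  change (A.tr z - A.tr y) + (A.tr y - A.tr x) = A.tr z - A.tr x
  abel

lemma face_arrow_ext {F G F' G' : A.Face} (m : F ⟶ G) (m' : F' ⟶ G') (hF : F = F') (hG : G = G')
    (h : m.1 = m'.1) : Arrow.mk m = Arrow.mk m' := by
  subst hF hG
  congr 1
  exact Subtype.ext h

lemma FaceLE.arrow_eq (hA : A.Essential) {F G : A.Face} (m : F ⟶ G) (v : Fin d → ℤ)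
    (h : A.FaceLE (F.rep + lat v) (G.rep + lat (m.1 + v))) : Arrow.mk h.hom = Arrow.mk m := by
  obtain ⟨h1, h2⟩ := mk_eq_and_tr_eq hA (F := F) (x := F.rep + lat v) (v := v) fun _ _ => rfl
  obtain ⟨h3, h4⟩ := mk_eq_and_tr_eq hA (F := G) (x := G.rep + lat (m.1 + v)) (v := m.1 + v)
    fun _ _ => rfl
  refine face_arrow_ext _ _ h1 h3 ?_
  change A.tr _ - A.tr _ = _
  rw [h2, h4]
  abel

lemma FaceLE.arrow_add_lat (hA : A.Essential) {x y : Fin d → ℝ} (h : A.FaceLE x y)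
    (v : Fin d → ℤ) : Arrow.mk (h.add_lat v).hom = Arrow.mk h.hom := by
  refine face_arrow_ext _ _ (tr_add_lat hA x v).1 (tr_add_lat hA y v).1 ?_
  change A.tr _ - A.tr _ = A.tr _ - A.tr _
  rw [(tr_add_lat hA x v).2, (tr_add_lat hA y v).2]
  abel

lemma hom_self_eq_id (hA : A.Essential) {F : A.Face} (m : F ⟶ F) : m = 𝟙 F :=
  Subtype.ext (eq_zero_of_faceLE_add_lat hA m.2)

/-- The points of a half-open segment ending in a face that is larger than that of the starting
point. -/
lemma FaceLE.sgn_segment {x y : Fin d → ℝ} (h : A.FaceLE x y) {t : ℝ} (h0 : 0 < t) (h1 : t ≤ 1)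
    (i : ι) (n : ℤ) : A.sgn (x + t • (y - x)) i n = A.sgn y i n := by
  unfold FaceLE sgn at *
  set a := A.ev i x - A.shift i - n with ha
  set b := A.ev i y - A.shift i - n with hb
  have e : A.ev i (x + t • (y - x)) - A.shift i - n = (1 - t) * a + t * b := by
    rw [map_add, map_smul, map_sub, smul_eq_mul, ha, hb]; ring
  rw [e]
  rcases h i n with h2 | h2
  · rw [← ha] at h2
    rw [sign_eq_zero_iff.1 h2, mul_zero, zero_add, sign_mul, sign_pos h0, one_mul]
  · rw [← ha, ← hb] at h2
    rcases lt_trichotomy a 0 with h3 | h3 | h3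
    · rw [sign_neg h3] at h2
      have h4 := sign_eq_neg_one_iff.1 h2.symm
      rw [sign_neg h4, sign_neg]
      nlinarith [mul_nonpos_of_nonneg_of_nonpos (sub_nonneg.2 h1) h3.le]
    · rw [h3, sign_zero] at h2
      rw [h3, ← h2, sign_eq_zero_iff.1 h2.symm]; simp
    · rw [sign_pos h3] at h2
      have h4 := sign_eq_one_iff.1 h2.symm
      rw [sign_pos h4, sign_pos]
      nlinarith [mul_nonneg (sub_nonneg.2 h1) h3.le]

lemma mem_hyp_iff_of_sgn_eq {x y : Fin d → ℝ} {i : ι} (h : ∀ n, A.sgn x i n = A.sgn y i n) :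
    x ∈ A.hyp i ↔ y ∈ A.hyp i := by
  rw [mem_hyp_iff, mem_hyp_iff]
  exact exists_congr fun n => by rw [h]

lemma hyp_add_lat (x : Fin d → ℝ) (v : Fin d → ℤ) (i : ι) : x + lat v ∈ A.hyp i ↔ x ∈ A.hyp i := by
  constructor
  · rintro ⟨n, hn⟩
    refine ⟨n - ∑ j, A.char i j * v j, ?_⟩
    rw [map_add, ev_lat] at hn
    push_cast at hn ⊢
    linarith
  · rintro ⟨n, hn⟩
    refine ⟨n + ∑ j, A.char i j * v j, ?_⟩
    rw [map_add, ev_lat, hn]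
    push_cast
    ring

lemma mem_loc_mk {x : Fin d → ℝ} {i : ι} : i ∈ A.loc (Face.mk x) ↔ x ∈ A.hyp i := by
  rw [mem_above_iff, ← mem_hyp_iff_of_sgn_eq (sgn_rep_add_tr x i), hyp_add_lat]

/-- There are finitely many faces. -/
instance [Finite ι] : Finite A.Face := by
  classical
  have := Fintype.ofFinite ι
  have hb : ∀ i, ∃ N : ℤ, ∀ x ∈ Set.Icc (0 : Fin d → ℝ) 1, |A.ev i x - A.shift i| < N := by
    intro i
    have hc : Continuous fun x => |A.ev i x - A.shift i| :=
      ((continuous_ev i).sub continuous_const).abs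
    obtain ⟨c, hc⟩ := (isCompact_Icc (a := (0 : Fin d → ℝ)) (b := 1)).bddAbove_image hc.continuousOn
    obtain ⟨N, hN⟩ := exists_nat_gt c
    exact ⟨N, fun x hx => (hc ⟨x, hx, rfl⟩).trans_lt (by exact_mod_cast hN)⟩
  choose N hN using hb
  have hex : ∀ F : A.Face, ∃ x ∈ Set.Icc (0 : Fin d → ℝ) 1, Face.mk x = F := by
    intro F
    refine ⟨F.rep + lat (fun j => -⌊F.rep j⌋), ⟨fun j => ?_, fun j => ?_⟩, ?_⟩
    · simp only [lat, Pi.zero_apply, Pi.add_apply, Int.cast_neg]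
      linarith [Int.floor_le (F.rep j)]
    · simp only [lat, Pi.one_apply, Pi.add_apply, Int.cast_neg]
      linarith [Int.lt_floor_add_one (F.rep j)]
    · conv_rhs => rw [← Face.mk_rep F]
      exact Face.mk_eq_mk.2 ⟨fun j => ⌊F.rep j⌋, fun i n => by
        congr 1; funext j; simp [lat]⟩
  choose x hx hxF using hex
  -- Every face has a lift meeting the unit cube; there only the levels in `[-N i, N i]` can give
  -- varying signs.
  let f : A.Face → (∀ i, (Set.Icc (-N i) (N i)) → SignType) := fun F i n => A.sgn (x F) i n
  refine Finite.of_injective f fun F G hFG => ?_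
  rw [← hxF F, ← hxF G]
  refine Face.mk_eq_mk.2 ⟨0, fun i n => ?_⟩
  rw [lat_zero, add_zero]
  have h1 := abs_lt.1 (hN i _ (hx F))
  have h2 := abs_lt.1 (hN i _ (hx G))
  by_cases hn : n ∈ Set.Icc (-N i) (N i)
  · exact congrFun (congrFun hFG i) ⟨n, hn⟩
  · rw [Set.mem_Icc, not_and_or, not_le, not_le] at hn
    unfold sgn
    rcases hn with hn | hn
    · have hn' : (n : ℝ) < -N i := by exact_mod_cast hn
      rw [sign_pos (by linarith), sign_pos (by linarith)]
    · have hn' : (N i : ℝ) < n := by exact_mod_cast hn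
      rw [sign_neg (by linarith), sign_neg (by linarith)]

/-! ### Layers -/

/-- A lifted hyperplane is closed: it contains the faces in the closure of each of its faces, so
both points are on the same level. -/
lemma hyp_iff_of_faceLE {x y : Fin d → ℝ} (h : A.FaceLE x y) {i : ι} (hy : y ∈ A.hyp i) :
    A.ev i x = A.ev i y := by
  obtain ⟨n, hn⟩ := (mem_hyp_iff y i).1 hy
  have hx : A.sgn x i n = 0 := by
    rcases h i n with h | h
    · exact h
    · rw [h, hn]
  unfold sgn at hn hx
  have h1 := sign_eq_zero_iff.1 hn
  have h2 := sign_eq_zero_iff.1 hx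
  linarith

lemma mem_layer_iff_of_sgn_eq (L : A.Layer) {x y : Fin d → ℝ}
    (h : ∀ i n, A.sgn x i n = A.sgn y i n) : x ∈ L.1 ↔ y ∈ L.1 := by
  have key : ∀ {x y : Fin d → ℝ}, (∀ i n, A.sgn x i n = A.sgn y i n) → x ∈ L.1 → y ∈ L.1 := by
    intro x y h hx
    obtain ⟨S, x0, hx0, hL⟩ := L.2
    rw [hL] at hx ⊢
    obtain ⟨v, hv⟩ := hx
    refine ⟨v, fun i hi => ?_⟩
    rw [← hv i hi]
    have h1 : A.FaceLE (y + lat v) (x + lat v) :=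
      (faceLE_of_sgn_eq fun i n => (h i n).symm).add_lat v
    apply hyp_iff_of_faceLE h1
    obtain ⟨n, hn⟩ := hx0 i hi
    exact ⟨n, by rw [hv i hi, hn]⟩
  exact ⟨key h, key fun i n => (h i n).symm⟩

lemma layer_add_lat (L : A.Layer) (x : Fin d → ℝ) (v : Fin d → ℤ) :
    x + lat v ∈ L.1 ↔ x ∈ L.1 := by
  obtain ⟨S, x0, hx0, hL⟩ := L.2
  rw [hL]
  constructor
  · rintro ⟨w, hw⟩
    exact ⟨v + w, fun i hi => by rw [lat_add, ← add_assoc]; exact hw i hi⟩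
  · rintro ⟨w, hw⟩
    refine ⟨w - v, fun i hi => ?_⟩
    rw [lat_sub, ← hw i hi]
    congr 1
    abel

lemma pts_subset_layer_iff {F : A.Face} {L : A.Layer} {x : Fin d → ℝ} (hx : x ∈ F.pts) :
    F.pts ⊆ L.1 ↔ x ∈ L.1 := by
  refine ⟨fun h => h hx, fun h y hy => ?_⟩
  have h1 : (Face.mk x : A.Face) = Face.mk y := by rw [Face.mem_pts.1 hx, Face.mem_pts.1 hy]
  obtain ⟨v, hv⟩ := Face.mk_eq_mk.1 h1
  rw [← mem_layer_iff_of_sgn_eq L hv, layer_add_lat]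
  exact h

lemma mk_subset_layer_iff {L : A.Layer} {x : Fin d → ℝ} :
    (Face.mk x : A.Face).pts ⊆ L.1 ↔ x ∈ L.1 := pts_subset_layer_iff (Face.mem_pts.2 rfl)

lemma mem_above_of_mem {L : A.Layer} {S : Set ι} {x0 : Fin d → ℝ} (hx0 : ∀ i ∈ S, x0 ∈ A.hyp i)
    (hL : L.1 = {y | ∃ v : Fin d → ℤ, ∀ i ∈ S, A.ev i (y + lat v) = A.ev i x0}) {i : ι}
    (hi : i ∈ S) : i ∈ A.above L.1 := by
  intro y hy
  rw [hL] at hy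
  obtain ⟨v, hv⟩ := hy
  obtain ⟨n, hn⟩ := hx0 i hi
  rw [← hyp_add_lat y v]
  exact ⟨n, by rw [hv i hi, hn]⟩

lemma mem_dirSpace {Z : Set (Fin d → ℝ)} {v : Fin d → ℝ} :
    v ∈ A.dirSpace Z ↔ ∀ i ∈ A.above Z, A.ev i v = 0 := by
  simp [dirSpace, Submodule.mem_iInf]

lemma layer_add_dirSpace (L : A.Layer) {x v : Fin d → ℝ} (hx : x ∈ L.1)
    (hv : v ∈ A.dirSpace L.1) : x + v ∈ L.1 := by
  obtain ⟨S, x0, hx0, hL⟩ := L.2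
  have hab := fun i (hi : i ∈ S) => mem_above_of_mem hx0 hL hi
  rw [hL] at hx ⊢
  obtain ⟨w, hw⟩ := hx
  refine ⟨w, fun i hi => ?_⟩
  rw [add_right_comm, map_add, hw i hi, mem_dirSpace.1 hv i (hab i hi), add_zero]

/-- A hypertorus whose hyperplane contains the directions of a layer that it meets contains the
layer. -/
lemma mem_above_layer (L : A.Layer) {i : ι} (h : A.dirSpace L.1 ≤ LinearMap.ker (A.ev i))
    {x : Fin d → ℝ} (hx : x ∈ L.1) (hxi : x ∈ A.hyp i) : i ∈ A.above L.1 := by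
  obtain ⟨S, x0, hx0, hL⟩ := L.2
  intro y hy
  have hab := fun i (hi : i ∈ S) => mem_above_of_mem hx0 hL hi
  rw [hL] at hx hy
  obtain ⟨v, hv⟩ := hx
  obtain ⟨w, hw⟩ := hy
  rw [← hyp_add_lat _ v] at hxi
  rw [← hyp_add_lat _ w]
  have hd : (y + lat w) - (x + lat v) ∈ A.dirSpace L.1 := by
    rw [mem_dirSpace]
    intro j hj
    by_contra hne
    set u := (y + lat w) - (x + lat v) with hu
    have hSu : ∀ i ∈ S, A.ev i u = 0 := by
      intro i hi
      rw [hu, map_sub, hv i hi, hw i hi, sub_self]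
    have hmem : ∀ t : ℝ, x + lat v + t • u ∈ A.hyp j := by
      intro t
      apply hj
      rw [hL]
      refine ⟨0, fun i hi => ?_⟩
      rw [lat_zero, add_zero, map_add, map_smul, hSu i hi, smul_zero, add_zero, hv i hi]
    obtain ⟨n, hn⟩ := hmem 0
    -- The parameter is chosen so that `ev j` changes by exactly `1 / 2`, whereas both points should
    -- lie on integer translates of the same level.
    obtain ⟨k, hk⟩ := hmem (1 / (2 * A.ev j u))
    rw [zero_smul, add_zero] at hn
    rw [map_add, map_smul, hn, smul_eq_mul] at hk
    have h2 : (1 / 2 : ℝ) = k - n := by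
      have : 1 / (2 * A.ev j u) * A.ev j u = 1 / 2 := by field_simp
      linarith
    have h3 : (1 : ℝ) = ((2 * (k - n) : ℤ) : ℝ) := by push_cast; linarith
    have h4 : (1 : ℤ) = 2 * (k - n) := by exact_mod_cast h3
    omega
  have h0 : A.ev i ((y + lat w) - (x + lat v)) = 0 := h hd
  obtain ⟨n, hn⟩ := hxi
  refine ⟨n, ?_⟩
  rw [map_sub] at h0
  linarith

lemma layer_nonempty (L : A.Layer) : ∃ x, x ∈ L.1 := by
  obtain ⟨S, x0, hx0, hL⟩ := L.2
  exact ⟨x0, by rw [hL]; exact ⟨0, fun i hi => by rw [lat_zero, add_zero]⟩⟩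

/-- Two faces of a layer cannot be separated by a function that is invariant under morphisms. -/
lemma eq_of_hom_invariant [Finite ι] {α : Type*} (L : A.Layer) (f : A.Face → α)
    (h : ∀ {F G : A.Face}, (F ⟶ G) → F.pts ⊆ L.1 → G.pts ⊆ L.1 → f F = f G) {F G : A.Face}
    (hF : F.pts ⊆ L.1) (hG : G.pts ⊆ L.1) : f F = f G := by
  obtain ⟨S, x0, hx0, hL⟩ := L.2
  -- A single component of the preimage of the layer: it is affine, hence convex, and meets a lift
  -- of every face of the layer.
  set K := {y : Fin d → ℝ | ∀ i ∈ S, A.ev i y = A.ev i x0} with hKdef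
  have hK : Convex ℝ K := by
    intro x hx y hy a b _ _ hab i hi
    rw [map_add, map_smul, map_smul, hx i hi, hy i hi, ← add_smul, hab, one_smul]
  have hKL : ∀ x ∈ K, x ∈ L.1 := fun x hx => by
    rw [hL]; exact ⟨0, fun i hi => by rw [lat_zero, add_zero]; exact hx i hi⟩
  have hex : ∀ F : A.Face, F.pts ⊆ L.1 → ∃ x ∈ K, Face.mk x = F := by
    intro F hF
    have := hF F.rep_mem
    rw [hL] at this
    obtain ⟨v, hv⟩ := this
    refine ⟨F.rep + lat v, hv, ?_⟩
    conv_rhs => rw [← Face.mk_rep F]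
    exact Face.mk_eq_mk.2 ⟨-v, fun i n => by rw [lat_neg, add_neg_cancel_right]⟩
  obtain ⟨x, hx, rfl⟩ := hex F hF
  obtain ⟨y, hy, rfl⟩ := hex G hG
  exact eq_of_faceLE_invariant (A := A) hK (fun x => f (Face.mk x)) (fun x hx y hy hxy =>
    h hxy.hom (mk_subset_layer_iff.2 (hKL x hx)) (mk_subset_layer_iff.2 (hKL y hy))) hx hy

/-! ### Primitive characters -/

/-- Bézout: a common generator of the entries of a primitive character is a unit. -/
lemma exists_char_eq_one (A : ToricArrangement ι d) (i : ι) :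
    ∃ v : Fin d → ℤ, ∑ j, A.char i j * v j = 1 := by
  have h : Ideal.span (Set.range (A.char i)) = ⊤ := by
    obtain ⟨g, hg⟩ := IsPrincipalIdealRing.principal (Ideal.span (Set.range (A.char i)))
    have hg' : Ideal.span (Set.range (A.char i)) = Ideal.span {g} := hg
    rw [hg', Ideal.span_singleton_eq_top]
    refine A.primitive i g fun j => ?_
    rw [← Ideal.mem_span_singleton, ← hg']
    exact Ideal.subset_span ⟨j, rfl⟩
  have h1 : (1 : ℤ) ∈ Ideal.span (Set.range (A.char i)) := by rw [h]; trivial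
  obtain ⟨c, hc⟩ := Ideal.mem_span_range_iff_exists_fun.1 h1
  exact ⟨c, by rw [← hc]; exact Finset.sum_congr rfl fun j _ => mul_comm _ _⟩

lemma exists_ev_eq_one (A : ToricArrangement ι d) (i : ι) : ∃ v, A.ev i (lat v) = 1 := by
  obtain ⟨v, hv⟩ := exists_char_eq_one A i
  exact ⟨v, by rw [ev_lat, hv, Int.cast_one]⟩

/-- Distinct hypertori with a common point have distinct hyperplanes. -/
lemma eq_of_ker_le {i j : ι} (h : LinearMap.ker (A.ev i) ≤ LinearMap.ker (A.ev j))
    {x : Fin d → ℝ} (hi : x ∈ A.hyp i) (hj : x ∈ A.hyp j) : i = j := by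
  obtain ⟨v, hv⟩ := exists_ev_eq_one A i
  set r := A.ev j (lat v) with hr
  have hprop : ∀ u, A.ev j u = r * A.ev i u := by
    intro u
    have : u - A.ev i u • lat v ∈ LinearMap.ker (A.ev i) := by
      rw [LinearMap.mem_ker, map_sub, map_smul, hv, smul_eq_mul, mul_one, sub_self]
    have := h this
    rw [LinearMap.mem_ker, map_sub, map_smul, smul_eq_mul] at this
    linarith
  obtain ⟨w, hw⟩ := exists_ev_eq_one A j
  -- Both factors are integers, so `r = ±1`; with a common point, the two families of levels then
  -- coincide.
  have h1 : r * A.ev i (lat w) = 1 := by rw [← hprop, hw]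
  rw [hr, ev_lat, ev_lat] at h1
  have h2 : (∑ k, A.char j k * v k) * (∑ k, A.char i k * w k) = 1 := by exact_mod_cast h1
  have hr' : r = 1 ∨ r = -1 := by
    rw [hr, ev_lat]
    rcases Int.eq_one_or_neg_one_of_mul_eq_one h2 with h3 | h3
    · left; rw [h3]; simp
    · right; rw [h3]; simp
  obtain ⟨n, hn⟩ := hi
  obtain ⟨k, hk⟩ := hj
  apply A.distinct
  ext y
  simp only [Set.mem_ofPred_eq, ← ev_apply]
  have hx := hprop x
  have hy := hprop y
  rcases hr' with h3 | h3
  · rw [h3, one_mul] at hx hy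
    constructor
    · rintro ⟨m, hm⟩
      exact ⟨m - n + k, by push_cast; linarith⟩
    · rintro ⟨m, hm⟩
      exact ⟨m + n - k, by push_cast; linarith⟩
  · rw [h3] at hx hy
    constructor
    · rintro ⟨m, hm⟩
      exact ⟨-m + n + k, by push_cast; linarith⟩
    · rintro ⟨m, hm⟩
      exact ⟨-m + n + k, by push_cast; linarith⟩

lemma eq_of_mem_loc {F : A.Face} {i j : ι} (hi : i ∈ A.loc F) (hj : j ∈ A.loc F)
    (h : LinearMap.ker (A.ev i) ≤ LinearMap.ker (A.ev j)) : i = j :=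
  eq_of_ker_le h ((mem_above_iff F i).1 hi) ((mem_above_iff F j).1 hj)

/-- A hypertorus as a layer. -/
lemma exists_layer_hyp (A : ToricArrangement ι d) (i : ι) : ∃ L : A.Layer, L.1 = A.hyp i := by
  obtain ⟨v, hv⟩ := exists_ev_eq_one A i
  set x0 := A.shift i • lat v with hx0
  have h0 : A.ev i x0 = A.shift i := by rw [hx0, map_smul, hv, smul_eq_mul, mul_one]
  refine ⟨⟨A.hyp i, {i}, x0, ?_, ?_⟩, rfl⟩
  · rintro j rfl
    exact ⟨0, by rw [h0]; simp⟩
  · ext y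
    simp only [Set.mem_singleton_iff, forall_eq, Set.mem_ofPred_eq, h0]
    constructor
    · rintro ⟨n, hn⟩
      refine ⟨-n • v, ?_⟩
      have : lat (-n • v) = -(n : ℝ) • lat v := by funext j; simp [lat]
      rw [map_add, this, map_smul, hv, hn, smul_eq_mul]
      ring
    · rintro ⟨w, hw⟩
      rw [← hyp_add_lat y w]
      exact ⟨0, by rw [hw]; simp⟩

end ToricArrangement

namespace ToricArrangement

variable {ι : Type} {d : ℕ} {A : ToricArrangement ι d}

open Topology Filter

/-! ### Linear arrangements -/

lemma eq_neg_of_ne {a b : SignType} (ha : a ≠ 0) (hb : b ≠ 0) (h : a ≠ b) : b = -a := by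
  revert a b; decide

lemma eq_of_ne_of_ne {a b c : SignType} (ha : a ≠ 0) (hb : b ≠ 0) (hc : c ≠ 0) (h : a ≠ b)
    (h' : a ≠ c) : b = c := by
  cases a <;> cases b <;> cases c <;> revert ha hb hc h h' <;> decide

variable (A) in
/-- The face of a linear arrangement containing a point. -/
noncomputable def faceOf (s : Set ι) (x : Fin d → ℝ) : A.LFace s := ⟨fun i => SignType.sign (A.ev i x), x, fun _ => rfl⟩

lemma exists_faceOf_eq {s : Set ι} (G : A.LFace s) : ∃ x, A.faceOf s x = G := by
  obtain ⟨u, hu⟩ := G.realized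
  exact ⟨u, LFace.ext (funext fun i => (hu i).symm)⟩

lemma eventually_sign_eq {i : ι} {x : Fin d → ℝ} (h : A.ev i x ≠ 0) :
    ∀ᶠ y in 𝓝 x, SignType.sign (A.ev i x) = SignType.sign (A.ev i y) := by
  rcases lt_or_gt_of_ne h with h | h
  · filter_upwards [(continuous_ev i).continuousAt.eventually_lt continuousAt_const h] with y hy
    rw [sign_neg h, sign_neg hy]
  · filter_upwards [continuousAt_const.eventually_lt (continuous_ev i).continuousAt h] with y hy
    rw [sign_pos h, sign_pos hy]

lemma eventually_faceOf_le [Finite ι] (s : Set ι) (x : Fin d → ℝ) :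
    ∀ᶠ y in 𝓝 x, A.faceOf s x ≤ A.faceOf s y := by
  change ∀ᶠ y in 𝓝 x, ∀ i : s, _
  rw [eventually_all]
  intro i
  by_cases h : A.ev i x = 0
  · exact Eventually.of_forall fun y => Or.inl (sign_eq_zero_iff.2 h)
  · filter_upwards [eventually_sign_eq h] with y hy using Or.inr hy

lemma convex_sign_eq (i : ι) (σ : SignType) : Convex ℝ {x | SignType.sign (A.ev i x) = σ} := by
  have hlin : IsLinearMap ℝ (A.ev i) := (A.ev i).isLinear
  rcases σ with _ | _ | _
  · have : {x | SignType.sign (A.ev i x) = SignType.zero} = {x | A.ev i x = 0} := by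
      ext x; exact sign_eq_zero_iff
    rw [this]
    exact convex_hyperplane hlin 0
  · have : {x | SignType.sign (A.ev i x) = SignType.neg} = {x | A.ev i x < 0} := by
      ext x; exact sign_eq_neg_one_iff
    rw [this]
    exact convex_halfSpace_lt hlin 0
  · have : {x | SignType.sign (A.ev i x) = SignType.pos} = {x | 0 < A.ev i x} := by
      ext x; exact sign_eq_one_iff
    rw [this]
    exact convex_halfSpace_gt hlin 0

/-- A function on the faces with prescribed signs with respect to some of the hyperplanes that does
not distinguish a face from those in whose closure it lies is constant. -/
lemma LFace.eq_of_le_invariant [Finite ι] {α : Type*} {s : Set ι} (R : Set s) (σ : s → SignType)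
    (f : A.LFace s → α) (h : ∀ G K : A.LFace s, (∀ i ∈ R, G.sg i = σ i) →
      (∀ i ∈ R, K.sg i = σ i) → G ≤ K → f G = f K) {G K : A.LFace s}
    (hG : ∀ i ∈ R, G.sg i = σ i) (hK : ∀ i ∈ R, K.sg i = σ i) : f G = f K := by
  obtain ⟨x, rfl⟩ := exists_faceOf_eq G
  obtain ⟨y, rfl⟩ := exists_faceOf_eq K
  have hconv : Convex ℝ {x | ∀ i ∈ R, SignType.sign (A.ev i x) = σ i} := by
    have : {x | ∀ i ∈ R, SignType.sign (A.ev i x) = σ i}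
        = ⋂ i ∈ R, {x | SignType.sign (A.ev i x) = σ i} := by ext; simp
    rw [this]
    exact convex_iInter fun i => convex_iInter fun _ => convex_sign_eq _ _
  refine eq_of_eventually_eq hconv (fun x => f (A.faceOf s x)) (fun z hz => ?_) hG hK
  filter_upwards [eventually_faceOf_le s z] with w hw hwK using h _ _ hz hwK hw

/-- A real vector space is not a finite union of proper subspaces. -/
lemma exists_generic [Finite ι] (W : Submodule ℝ (Fin d → ℝ)) (s : Set ι)
    (h : ∀ j ∈ s, ¬ W ≤ LinearMap.ker (A.ev j)) : ∃ x ∈ W, ∀ j ∈ s, A.ev j x ≠ 0 := by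
  by_contra! hc
  have : (⋃ j : s, (((LinearMap.ker (A.ev j)).comap W.subtype : Submodule ℝ W) : Set W))
      = Set.univ := by
    rw [Set.eq_univ_iff_forall]
    intro x
    obtain ⟨j, hj, hx⟩ := hc x.1 x.2
    exact Set.mem_iUnion.2 ⟨⟨j, hj⟩, hx⟩
  obtain ⟨j, hj⟩ := Subspace.exists_eq_top_of_iUnion_eq_univ this
  refine h j j.2 fun x hx => ?_
  have : (⟨x, hx⟩ : W) ∈ (LinearMap.ker (A.ev j)).comap W.subtype := by rw [hj]; trivial
  exact this

lemma not_top_le_ker (i : ι) : ¬ (⊤ : Submodule ℝ (Fin d → ℝ)) ≤ LinearMap.ker (A.ev i) := by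
  intro h
  obtain ⟨v, hv⟩ := exists_ev_eq_one A i
  have : A.ev i (lat v) = 0 := h trivial
  rw [hv] at this
  exact one_ne_zero this

lemma ev_ne_zero (i : ι) : A.ev i ≠ 0 := by
  intro h
  obtain ⟨v, hv⟩ := exists_ev_eq_one A i
  rw [h] at hv
  exact zero_ne_one hv

lemma finrank_ker_ev (i : ι) : Module.finrank ℝ (LinearMap.ker (A.ev i)) + 1 = d := by
  have h := LinearMap.finrank_range_add_finrank_ker (A.ev i)
  rw [LinearMap.range_eq_top.2 (LinearMap.surjective (ev_ne_zero i)), finrank_top,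
    Module.finrank_self, Module.finrank_fin_fun] at h
  omega

/-- The chamber containing a generic point. -/
noncomputable def chamberOf (s : Set ι) (x : Fin d → ℝ) (h : ∀ i : s, A.ev i x ≠ 0) : A.Chamber s :=
  ⟨A.faceOf s x, fun i => by
    change SignType.sign _ ≠ 0
    rw [Ne, sign_eq_zero_iff]
    exact h i⟩

/-- The index set of the hyperplanes separating two chambers. -/
def diffSet {s : Set ι} (C C' : A.Chamber s) : Set s := {i | C'.sg i ≠ C.sg i}

lemma Chamber.ext_sg {s : Set ι} {C C' : A.Chamber s} (h : ∀ i, C.sg i = C'.sg i) : C = C' :=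
  Chamber.ext (funext h)

lemma diffSet_nonempty {s : Set ι} {C C' : A.Chamber s} (h : C' ≠ C) :
    (diffSet C C').Nonempty := by
  by_contra hc
  rw [Set.not_nonempty_iff_eq_empty] at hc
  refine h (Chamber.ext_sg fun i => ?_)
  by_contra hi
  have : i ∈ diffSet C C' := hi
  rw [hc] at this
  exact this

/-- The point of the segment from `u` to `w` at time `t`. -/
lemma ev_segment (i : ι) (u w : Fin d → ℝ) (t : ℝ) :
    A.ev i (u + t • (w - u)) = (1 - t) * A.ev i u + t * A.ev i w := by
  rw [map_add, map_smul, map_sub, smul_eq_mul]; ring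

lemma sign_segment {a b t : ℝ} (h : SignType.sign a = SignType.sign b) (h0 : 0 ≤ t) (h1 : t ≤ 1) :
    SignType.sign ((1 - t) * a + t * b) = SignType.sign a := by
  rcases lt_trichotomy a 0 with ha | ha | ha
  · rw [sign_neg ha] at h ⊢
    have hb := sign_eq_neg_one_iff.1 h.symm
    apply sign_neg
    rcases h0.eq_or_lt with rfl | h0
    · linarith
    · nlinarith [mul_nonneg (sub_nonneg.2 h1) (neg_nonneg.2 ha.le)]
  · subst ha
    rw [sign_zero] at h
    rw [sign_eq_zero_iff.1 h.symm]
    simp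
  · rw [sign_pos ha] at h ⊢
    have hb := sign_eq_one_iff.1 h.symm
    apply sign_pos
    rcases h0.eq_or_lt with rfl | h0
    · linarith
    · nlinarith [mul_nonneg (sub_nonneg.2 h1) ha.le]

lemma mul_neg_of_sign_ne {a b : ℝ} (ha : a ≠ 0) (hb : b ≠ 0)
    (h : SignType.sign b ≠ SignType.sign a) : a * b < 0 := by
  rcases lt_or_gt_of_ne ha with ha | ha <;> rcases lt_or_gt_of_ne hb with hb | hb
  · rw [sign_neg ha, sign_neg hb] at h; exact absurd rfl h
  · exact mul_neg_of_neg_of_pos ha hb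
  · exact mul_neg_of_pos_of_neg ha hb
  · rw [sign_pos ha, sign_pos hb] at h; exact absurd rfl h

/-- The first crossing time of a segment, for two hyperplanes: if the times differ, there is an
intermediate chamber. -/
lemma exists_intermediate [Finite ι] {s : Set ι} {C C' : A.Chamber s} {u w : Fin d → ℝ}
    (hu : ∀ i : s, C.sg i = SignType.sign (A.ev i u))
    (hw : ∀ i : s, C'.sg i = SignType.sign (A.ev i w)) {i j : s} (hi : i ∈ diffSet C C')
    (hj : j ∈ diffSet C C') (hlt : A.ev i u * A.ev j w < A.ev j u * A.ev i w ∨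
      A.ev j u * A.ev i w < A.ev i u * A.ev j w) :
    ∃ E : A.Chamber s, E ≠ C ∧ diffSet C E ⊂ diffSet C C' := by
  have hne : ∀ (k : s), A.ev k u ≠ 0 ∧ A.ev k w ≠ 0 := fun k => by
    constructor
    · intro h; exact C.ne_zero k (by rw [hu, h, sign_zero])
    · intro h; exact C'.ne_zero k (by rw [hw, h, sign_zero])
  -- crossing times
  let t : s → ℝ := fun k => A.ev k u / (A.ev k u - A.ev k w)
  have hopp : ∀ k ∈ diffSet C C', A.ev k u * A.ev k w < 0 := by
    intro k hk
    have hk' : C'.sg k ≠ C.sg k := hk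
    rw [hu, hw] at hk'
    exact mul_neg_of_sign_ne (hne k).1 (hne k).2 hk'
  have hden : ∀ k ∈ diffSet C C', A.ev k u - A.ev k w ≠ 0 := by
    intro k hk h0
    have h1 : A.ev k u = A.ev k w := by linarith
    have h2 := hopp k hk
    rw [h1] at h2
    nlinarith [mul_self_nonneg (A.ev k w)]
  have ht01 : ∀ k ∈ diffSet C C', 0 < t k ∧ t k < 1 := by
    intro k hk
    have h2 := hopp k hk
    rcases lt_or_gt_of_ne (hne k).1 with ha | ha
    · have hb : 0 < A.ev k w := by
        rcases lt_or_gt_of_ne (hne k).2 with hb | hb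
        · nlinarith
        · exact hb
      constructor
      · exact div_pos_of_neg_of_neg ha (by linarith)
      · rw [div_lt_one_of_neg (by linarith)]; linarith
    · have hb : A.ev k w < 0 := by
        rcases lt_or_gt_of_ne (hne k).2 with hb | hb
        · exact hb
        · nlinarith
      constructor
      · exact div_pos ha (by linarith)
      · rw [div_lt_one (by linarith)]; linarith
  have htm : ∀ k ∈ diffSet C C', t k * (A.ev k u - A.ev k w) = A.ev k u :=
    fun k hk => div_mul_cancel₀ _ (hden k hk)
  clear_value t
  have hval : ∀ k ∈ diffSet C C', ∀ τ, (1 - τ) * A.ev k u + τ * A.ev k w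
      = (t k - τ) * (A.ev k u - A.ev k w) := by
    intro k hk τ
    linear_combination -(htm k hk)
  have htne : t i ≠ t j := by
    intro h
    have h1 := htm i hi
    have h2 := htm j hj
    rw [h] at h1
    have h3 : A.ev i u * A.ev j w = A.ev j u * A.ev i w := by
      have h4 := (ht01 j hj).1
      have h5 : t j * (A.ev i u * A.ev j w) = t j * (A.ev j u * A.ev i w) := by
        linear_combination (A.ev j u) * h1 - (A.ev i u) * h2
      exact mul_left_cancel₀ h4.ne' h5
    rcases hlt with h4 | h4 <;> linarith
  wlog hij : t i < t j generalizing i j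
  · exact this hj hi hlt.symm htne.symm (lt_of_le_of_ne (not_lt.1 hij) htne.symm)
  -- A time strictly between the two crossings that avoids all other crossing times: the point is in
  -- a chamber, past the `i`-th hyperplane but before the `j`-th.
  obtain ⟨τ, hτ, hτn⟩ := (Set.Ioo_infinite hij).exists_notMem_finite (Set.finite_range t)
  have hτ0 : 0 ≤ τ := ((ht01 i hi).1.trans hτ.1).le
  have hτ1 : τ ≤ 1 := (hτ.2.trans (ht01 j hj).2).le
  have hz : ∀ k : s, A.ev k (u + τ • (w - u)) ≠ 0 := by
    intro k
    rw [ev_segment]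
    by_cases hk : k ∈ diffSet C C'
    · rw [hval k hk]
      refine mul_ne_zero (fun h => hτn ⟨k, by linarith⟩) (hden k hk)
    · have hk' : C'.sg k = C.sg k := not_not.1 hk
      rw [hu, hw] at hk'
      rw [← sign_ne_zero, sign_segment hk'.symm hτ0 hτ1, sign_ne_zero]
      exact (hne k).1
  have hsg : ∀ k, (chamberOf s _ hz).sg k = SignType.sign ((1 - τ) * A.ev k u + τ * A.ev k w) := by
    intro k
    rw [← ev_segment]; rfl
  refine ⟨chamberOf s _ hz, ?_, ?_, ?_⟩
  · intro h
    have h1 := hsg i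
    rw [h, hval i hi, hu] at h1
    have h2 := hτ.1
    have h3 := (ht01 i hi).1
    have h4 : SignType.sign (A.ev i u) = 1 * SignType.sign (A.ev i u - A.ev i w) := by
      rw [← sign_pos h3, ← sign_mul, htm i hi]
    rw [sign_mul, sign_neg (show t i - τ < 0 by linarith), h4] at h1
    have h5 : SignType.sign (A.ev i u - A.ev i w) ≠ 0 := sign_ne_zero.2 (hden i hi)
    revert h1 h5
    generalize SignType.sign (A.ev i u - A.ev i w) = σ
    revert σ; decide
  · intro k hk
    by_contra hk2
    have hk' : C'.sg k = C.sg k := not_not.1 hk2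
    apply hk
    rw [hsg]
    rw [hu, hw] at hk'
    rw [sign_segment hk'.symm hτ0 hτ1, hu]
  · intro hsub
    have h1 := hsub hj
    apply h1
    have h3 := (ht01 j hj).1
    rw [hsg, hval j hj, hu, sign_mul, sign_pos (by linarith [hτ.2]), ← sign_pos h3, ← sign_mul,
      htm j hj]

/-- A chamber on the way from `C` to `C'` that is separated from `C` by a single hyperplane, and a
wall between `C` and that chamber. -/
lemma exists_adjacent_chamber [Finite ι] {s : Set ι} {C C' : A.Chamber s} (h : C' ≠ C) :
    ∃ E : A.Chamber s, E ≠ C ∧ diffSet C E ⊆ diffSet C C' ∧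
      (∀ i ∈ diffSet C E, ∀ j ∈ diffSet C E,
        LinearMap.ker (A.ev i) = LinearMap.ker (A.ev (j : ι))) ∧
      ∃ G : A.LFace s, (∀ i, G.sg i = 0 ↔ i ∈ diffSet C E) ∧ G ≤ C.toLFace ∧ G ≤ E.toLFace := by
  -- `E` is chosen with minimal separating set, so no chamber lies properly between `C` and `E`.
  obtain ⟨E, ⟨hE, hsub⟩, hmin⟩ : ∃ E : A.Chamber s, (E ≠ C ∧ diffSet C E ⊆ diffSet C C') ∧
      ∀ E' : A.Chamber s, E' ≠ C → ¬ diffSet C E' ⊂ diffSet C E := by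
    have hwf : WellFounded (fun a b : Set s => a ⊂ b) := wellFounded_lt
    obtain ⟨E, hE, hm⟩ := (InvImage.wf (fun E : A.Chamber s => diffSet C E) hwf).has_min
      {E | E ≠ C ∧ diffSet C E ⊆ diffSet C C'} ⟨C', h, subset_rfl⟩
    exact ⟨E, hE, fun E' h1 h2 => hm E' ⟨h1, h2.subset.trans hE.2⟩ h2⟩
  obtain ⟨w, hw⟩ := E.realized
  -- By minimality all separating hyperplanes are crossed at the same time, whatever point `u` of
  -- `C` the segment starts from.
  have heq : ∀ u, (∀ i : s, C.sg i = SignType.sign (A.ev i u)) → ∀ i ∈ diffSet C E,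
      ∀ j ∈ diffSet C E, A.ev i u * A.ev j w = A.ev j u * A.ev i w := by
    intro u hu i hi j hj
    by_contra hne
    obtain ⟨E', h1, h2⟩ := exists_intermediate hu hw hi hj (lt_or_gt_of_ne hne)
    exact hmin E' h1 h2
  obtain ⟨u, hu⟩ := C.realized
  have hu0 : ∀ k : s, A.ev k u ≠ 0 := fun k h => C.ne_zero k (by rw [hu, h, sign_zero])
  have hw0 : ∀ k : s, A.ev k w ≠ 0 := fun k h => E.ne_zero k (by rw [hw, h, sign_zero])
  have hker : ∀ i ∈ diffSet C E, ∀ j ∈ diffSet C E,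
      LinearMap.ker (A.ev i) ≤ LinearMap.ker (A.ev (j : ι)) := by
    intro i hi j hj b hb
    -- Moving `u` slightly inside `C` along a vector `b` of the `i`-th hyperplane preserves the
    -- equality of crossing times only if `ev j b = 0`. Hence all separating hyperplanes coincide.
    have hev : ∀ᶠ y in 𝓝 u, ∀ k : s, SignType.sign (A.ev k u) = SignType.sign (A.ev k y) :=
      eventually_all.2 fun k => eventually_sign_eq (hu0 k)
    have hlim : Tendsto (fun ε : ℝ => u + ε • b) (𝓝 0) (𝓝 u) := by
      have : Continuous fun ε : ℝ => u + ε • b := by fun_prop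
      simpa using this.tendsto 0
    obtain ⟨ε, hε, hε0⟩ := ((hlim.eventually hev).filter_mono nhdsWithin_le_nhds |>.and
      (self_mem_nhdsWithin (s := Set.Ioi (0 : ℝ)))).exists
    have h1 := heq u hu i hi j hj
    have h2 := heq (u + ε • b) (fun k => by rw [hu, hε]) i hi j hj
    rw [map_add, map_add, map_smul, map_smul, (show A.ev i b = 0 from hb), smul_zero, add_zero,
      h1, smul_eq_mul] at h2
    have h3 : ε * A.ev j b * A.ev i w = 0 := by linarith
    have hε0' : ε ≠ 0 := (show (0 : ℝ) < ε from hε0).ne'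
    rcases mul_eq_zero.1 h3 with h4 | h4
    · exact (mul_eq_zero.1 h4).resolve_left hε0'
    · exact absurd h4 (hw0 i)
  refine ⟨E, hE, hsub, fun i hi j hj => le_antisymm (hker i hi j hj) (hker j hj i hi), ?_⟩
  obtain ⟨i, hi⟩ := diffSet_nonempty hE
  have hopp : A.ev i u * A.ev i w < 0 := by
    have hi' : E.sg i ≠ C.sg i := hi
    rw [hu, hw] at hi'
    exact mul_neg_of_sign_ne (hu0 i) (hw0 i) hi'
  have hden : A.ev i u - A.ev i w ≠ 0 := by
    intro h0
    have h1 : A.ev i u = A.ev i w := by linarith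
    rw [h1] at hopp
    nlinarith [mul_self_nonneg (A.ev i w)]
  -- The common crossing time; the point of the segment at this time lies in the wall.
  set τ := A.ev i u / (A.ev i u - A.ev i w) with hτ
  have hτm : τ * (A.ev i u - A.ev i w) = A.ev i u := div_mul_cancel₀ _ hden
  have hτ01 : 0 ≤ τ ∧ τ ≤ 1 := by
    have e : τ * (A.ev i u - A.ev i w) ^ 2 = A.ev i u ^ 2 - A.ev i u * A.ev i w := by
      linear_combination (A.ev i u - A.ev i w) * hτm
    have hp : 0 < (A.ev i u - A.ev i w) ^ 2 := by positivity
    constructor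
    · by_contra hc
      nlinarith [sq_nonneg (A.ev i u)]
    · by_contra hc
      nlinarith [sq_nonneg (A.ev i w)]
  have hzero : ∀ k ∈ diffSet C E, A.ev k (u + τ • (w - u)) = 0 := by
    intro k hk
    rw [ev_segment]
    have h1 := heq u hu i hi k hk
    have h2 : A.ev i u * ((1 - τ) * A.ev k u + τ * A.ev k w) = 0 := by
      linear_combination (-A.ev k u) * hτm + τ * h1
    exact (mul_eq_zero.1 h2).resolve_left (hu0 i)
  have hsame : ∀ k ∉ diffSet C E,
      SignType.sign (A.ev k (u + τ • (w - u))) = C.sg k ∧ E.sg k = C.sg k := by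
    intro k hk
    have hk' : E.sg k = C.sg k := not_not.1 hk
    refine ⟨?_, hk'⟩
    rw [hu, hw] at hk'
    rw [ev_segment, sign_segment hk'.symm hτ01.1 hτ01.2, hu]
  refine ⟨A.faceOf s (u + τ • (w - u)), fun k => ⟨fun h => ?_, fun h => ?_⟩, fun k => ?_, fun k => ?_⟩
  · by_contra hk
    have : SignType.sign (A.ev k (u + τ • (w - u))) = 0 := h
    rw [(hsame k hk).1] at this
    exact C.ne_zero k this
  · exact sign_eq_zero_iff.2 (hzero k h)
  · by_cases hk : k ∈ diffSet C E
    · exact Or.inl (sign_eq_zero_iff.2 (hzero k hk))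
    · exact Or.inr (hsame k hk).1
  · by_cases hk : k ∈ diffSet C E
    · exact Or.inl (sign_eq_zero_iff.2 (hzero k hk))
    · exact Or.inr ((hsame k hk).1.trans (hsame k hk).2.symm)

end ToricArrangement

namespace ToricArrangement

variable {ι : Type} {d : ℕ} {A : ToricArrangement ι d}

/-! ### Objects and arrows of the toric Salvetti complex -/

section Arrows

variable [Finite ι]

lemma salMap_id {F : A.Face} (x : A.SalPos (A.loc F)) : salMap (𝟙 F) x = x :=
  SalPos.ext (incl_id _) (Chamber.ext (congrArg LFace.sg (incl_id x.ch.toLFace)))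

lemma salMap_comp {F G H : A.Face} (m : F ⟶ G) (m' : G ⟶ H) (x : A.SalPos (A.loc H)) :
    salMap (m ≫ m') x = salMap m (salMap m' x) :=
  SalPos.ext (incl_comp _ _ _).symm
    (Chamber.ext (congrArg LFace.sg (incl_comp m m' x.ch.toLFace).symm))

/-- The arrow of `∫ 𝒟` over a morphism of faces. -/
noncomputable def arr {F F' : A.Face} (m : F' ⟶ F) {x : A.SalPos (A.loc F)}
    {x' : A.SalPos (A.loc F')} (h : salMap m x ≤ x') : pt F x ⟶ pt F' x' :=
  ⟨m.op, @homOfLE (A.SalPos (A.loc F')) _ _ _ h⟩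

lemma salMap_le {X Y : A.Sal} (f : X ⟶ Y) :
    salMap f.base.unop (X.fiber : A.SalPos (A.loc X.base.unop)) ≤
      (Y.fiber : A.SalPos (A.loc Y.base.unop)) := leOfHom f.fiber

/-- The fibres are posets, so an arrow carries no information beyond its base and endpoints. -/
lemma sal_hom_ext {X Y : A.Sal} (f g : X ⟶ Y) (h : f.base = g.base) : f = g :=
  Grothendieck.ext f g h (by
    have : ∀ (F : A.Face) (x y : A.SalPos (A.loc F)) (p q : x ⟶ y), p = q :=
      fun _ _ _ p q => Subsingleton.elim p q
    exact this Y.base.unop _ _ _ _)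

lemma exists_pt (X : A.Sal) : ∃ (F : A.Face) (x : A.SalPos (A.loc F)), X = pt F x :=
  ⟨X.base.unop, X.fiber, rfl⟩

lemma arr_comp {F F' F'' : A.Face} (m : F' ⟶ F) (m' : F'' ⟶ F') {x : A.SalPos (A.loc F)}
    {x' : A.SalPos (A.loc F')} {x'' : A.SalPos (A.loc F'')} (h : salMap m x ≤ x')
    (h' : salMap m' x' ≤ x'') (h'' : salMap (m' ≫ m) x ≤ x'') :
    arr m h ≫ arr m' h' = arr (m' ≫ m) h'' := sal_hom_ext _ _ rfl

lemma eq_arr {X Y : A.Sal} (f : X ⟶ Y) :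
    f = arr (F := X.base.unop) (F' := Y.base.unop) f.base.unop (salMap_le f) :=
  sal_hom_ext _ _ rfl

lemma exists_arr {F F' : A.Face} {x : A.SalPos (A.loc F)} {x' : A.SalPos (A.loc F')}
    (f : pt F x ⟶ pt F' x') : ∃ (m : F' ⟶ F) (h : salMap m x ≤ x'), f = arr m h :=
  ⟨f.base.unop, salMap_le f, eq_arr f⟩

lemma sal_arrow_ext {f g : Arrow A.Sal} (hl : f.left = g.left) (hr : f.right = g.right)
    (hb : f.hom.base.unop.1 = g.hom.base.unop.1) : f = g := by
  obtain ⟨X, Y, f, rfl⟩ := Arrow.mk_surjective f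
  obtain ⟨X', Y', g, rfl⟩ := Arrow.mk_surjective g
  change X = X' at hl
  change Y = Y' at hr
  subst hl hr
  have : f = g := sal_hom_ext _ _ (Quiver.Hom.unop_inj (Subtype.ext hb))
  rw [this]

lemma pt_injective {F : A.Face} {x y : A.SalPos (A.loc F)} (h : pt F x = pt F y) : x = y := by
  have h' : (⟨Opposite.op F, x⟩ : A.Sal) = ⟨Opposite.op F, y⟩ := h
  injection h' with _ h2

lemma pt_base_eq {F F' : A.Face} {x : A.SalPos (A.loc F)} {y : A.SalPos (A.loc F')}
    (h : pt F x = pt F' y) : F = F' := by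
  have := congrArg (fun X : A.Sal => X.base.unop) h
  exact this

/-- The element `[G, C_G]` of the Salvetti poset of `𝒜[F]`, for a chamber `C` of `𝒜₀`. -/
noncomputable def sal (F : A.Face) (G : A.LFace (A.loc F)) (C : A.Chamber Set.univ) :
    A.SalPos (A.loc F) :=
  ⟨G, G.compCh (C.restrict (A.loc F) (Set.subset_univ _)), le_compCh _ _⟩

/-- The sign of a chamber of `𝒜₀` with respect to a hypertorus. -/
abbrev Chamber.at (C : A.Chamber Set.univ) (i : ι) : SignType := C.sg ⟨i, trivial⟩

lemma compCh_sg {s : Set ι} (G : A.LFace s) (C : A.Chamber s) (i : s) :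
    (G.compCh C).sg i = if G.sg i = 0 then C.sg i else G.sg i := rfl

lemma sal_ch_sg (F : A.Face) (G : A.LFace (A.loc F)) (C : A.Chamber Set.univ) (i : A.loc F) :
    (sal F G C).ch.sg i = if G.sg i = 0 then C.at i else G.sg i := rfl

lemma sal_congr {F : A.Face} {G : A.LFace (A.loc F)} {C C' : A.Chamber Set.univ}
    (h : ∀ i : A.loc F, G.sg i = 0 → C.at i = C'.at i) : sal F G C = sal F G C' := by
  refine SalPos.ext rfl (Chamber.ext_sg fun i => ?_)
  rw [sal_ch_sg, sal_ch_sg]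
  split_ifs with h0
  · exact h i h0
  · rfl

/-- For a fixed chamber `C`, the objects `[G, C_G]` form a copy of the opposite of the face poset, a
cone with apex `[0, C]`. A stratum in a fibre is the union of these cones over the chambers `C ≥
F₀`. -/
lemma sal_le_sal {F : A.Face} {G G' : A.LFace (A.loc F)} (C : A.Chamber Set.univ) (h : G' ≤ G) :
    sal F G C ≤ sal F G' C := by
  refine ⟨h, Chamber.ext_sg fun i => ?_⟩
  change (if G.sg i = 0 then (if G'.sg i = 0 then C.at i else G'.sg i) else G.sg i)
    = if G.sg i = 0 then C.at i else G.sg i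
  split_ifs with h1 h2
  · rfl
  · rcases h i with h3 | h3
    · exact absurd h3 h2
    · exact absurd (h3.trans h1) h2
  · rfl

lemma salMap_sal {F F' : A.Face} (m : F' ⟶ F) (G : A.LFace (A.loc F)) (C : A.Chamber Set.univ) :
    salMap m (sal F G C) = sal F' (incl m G) C := by
  refine SalPos.ext rfl (Chamber.ext_sg fun i => ?_)
  change (incl m (sal F G C).ch.toLFace).sg i = if (incl m G).sg i = 0 then C.at i else _
  by_cases hi : i.1 ∈ A.loc F
  · rw [incl_sg_of_mem m _ i hi, incl_sg_of_mem m _ i hi]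
    rfl
  · rw [incl_sg_of_notMem m _ i hi, incl_sg_of_notMem m _ i hi, if_neg]
    exact fun h => hi ((germ_eq_zero_iff m i.2).1 (sign_eq_zero_iff.1 h))

/-! ### The standard cocycles -/

open Classical in
/-- The cochain dual to the loop around the `i`-th hypertorus. -/
noncomputable def wind (i : ι) (f : Arrow A.Sal) : ℚ :=
  if h : i ∈ A.loc f.right.base.unop then
    if (incl f.hom.base.unop (SalPos.face f.left.fiber)).sg ⟨i, h⟩ = 1 ∧
      (SalPos.face f.right.fiber).sg ⟨i, h⟩ = 0 ∧ (SalPos.ch f.right.fiber).sg ⟨i, h⟩ = 1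
    then 1 else 0
  else 0

open Classical in
lemma wind_arr (i : ι) {F F' : A.Face} (m : F' ⟶ F) {x : A.SalPos (A.loc F)}
    {x' : A.SalPos (A.loc F')} (h : salMap m x ≤ x') :
    wind i (Arrow.mk (arr m h)) = if hi : i ∈ A.loc F' then
      if (incl m x.face).sg ⟨i, hi⟩ = 1 ∧ x'.face.sg ⟨i, hi⟩ = 0 ∧ x'.ch.sg ⟨i, hi⟩ = 1
      then 1 else 0 else 0 := rfl

/-- Along arrows the sign of the face either persists or drops to `0`, and `0` persists; `wind i`
counts the drop from `+` when the target chamber is positive. The drop occurs in at most one factor,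
and once the face lies on the hyperplane the chamber keeps its sign. Where `i` is not in the local
arrangement, the sign is that of the germ and no drop has occurred yet. -/
lemma wind_comp (i : ι) {X Y Z : A.Sal} (f : X ⟶ Y) (g : Y ⟶ Z) :
    wind i (Arrow.mk (f ≫ g)) = wind i (Arrow.mk f) + wind i (Arrow.mk g) := by
  obtain ⟨F, x, rfl⟩ := exists_pt X
  obtain ⟨F', x', rfl⟩ := exists_pt Y
  obtain ⟨F'', x'', rfl⟩ := exists_pt Z
  obtain ⟨m, hf, rfl⟩ := exists_arr f
  obtain ⟨m', hg, rfl⟩ := exists_arr g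
  have hfg : salMap (m' ≫ m) x ≤ x'' := by
    rw [salMap_comp]
    exact ((salMap m').monotone hf).trans hg
  rw [arr_comp m m' hf hg hfg, wind_arr, wind_arr, wind_arr]
  by_cases hi'' : i ∈ A.loc F''
  · rw [dif_pos hi'', dif_pos hi'']
    have g1 := hg.1 ⟨i, hi''⟩
    have g2 : (if (incl m' x'.face).sg ⟨i, hi''⟩ = 0 then x''.ch.sg ⟨i, hi''⟩
        else (incl m' x'.face).sg ⟨i, hi''⟩) = (incl m' x'.ch.toLFace).sg ⟨i, hi''⟩ :=
      congrArg (fun C : A.Chamber (A.loc F'') => C.sg ⟨i, hi''⟩) hg.2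
    change x''.face.sg ⟨i, hi''⟩ = 0 ∨ x''.face.sg ⟨i, hi''⟩
      = (incl m' x'.face).sg ⟨i, hi''⟩ at g1
    by_cases hi' : i ∈ A.loc F'
    · rw [dif_pos hi']
      have f1 := hf.1 ⟨i, hi'⟩
      change x'.face.sg ⟨i, hi'⟩ = 0 ∨ x'.face.sg ⟨i, hi'⟩ = (incl m x.face).sg ⟨i, hi'⟩ at f1
      rw [← incl_comp, incl_sg_of_mem m' _ ⟨i, hi''⟩ hi', incl_sg_of_mem m' _ ⟨i, hi''⟩ hi'] at *
      revert f1 g1 g2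
      generalize (incl m x.face).sg ⟨i, hi'⟩ = p1
      generalize x'.face.sg ⟨i, hi'⟩ = p2
      generalize x''.face.sg ⟨i, hi''⟩ = p3
      generalize x''.ch.sg ⟨i, hi''⟩ = p4
      generalize x'.ch.sg ⟨i, hi'⟩ = p5
      intro g2 g1 f1
      rcases f1 with f1 | f1
      · subst f1
        rw [if_pos rfl] at g2
        subst g2
        have : p3 = 0 := by rcases g1 with h | h <;> exact h
        simp [this]
      · subst f1
        by_cases h2 : p2 = 1
        · simp [h2]
        · simp [h2]
    · rw [dif_neg hi', zero_add, ← incl_comp, incl_sg_of_notMem m' _ ⟨i, hi''⟩ hi',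
        incl_sg_of_notMem m' _ ⟨i, hi''⟩ hi']
  · have hi' : i ∉ A.loc F' := fun h => hi'' (loc_mono m' h)
    rw [dif_neg hi'', dif_neg hi'', dif_neg hi', add_zero]

/-- The cochain given by a linear form on translations. -/
noncomputable def shiftForm (l : Fin d → ℚ) (f : Arrow A.Sal) : ℚ :=
  ∑ j, l j * (f.hom.base.unop.1 j : ℚ)

lemma shiftForm_comp (l : Fin d → ℚ) {X Y Z : A.Sal} (f : X ⟶ Y) (g : Y ⟶ Z) :
    shiftForm l (Arrow.mk (f ≫ g)) = shiftForm l (Arrow.mk f) + shiftForm l (Arrow.mk g) := by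
  have h : (f ≫ g).base.unop.1 = f.base.unop.1 + g.base.unop.1 := rfl
  simp only [shiftForm, Arrow.mk_hom, h, Pi.add_apply, Int.cast_add, mul_add,
    Finset.sum_add_distrib]

variable (A) in
/-- The class of `wind i` as a cocycle. -/
noncomputable def windCocycle (i : ι) : CatHom.Cocycles A.Sal :=
  ⟨wind i, fun X Y Z f g => by rw [wind_comp]; ring⟩

variable (A) in
/-- The class of `shiftForm l` as a cocycle. -/
noncomputable def shiftCocycle (l : Fin d → ℚ) : CatHom.Cocycles A.Sal :=
  ⟨shiftForm l, fun X Y Z f g => by rw [shiftForm_comp]; ring⟩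

end Arrows

end ToricArrangement

namespace ToricArrangement

variable {ι : Type} {d : ℕ} {A : ToricArrangement ι d}

/-! ### Integrating cocycles on the poset of lifted faces -/

/-- A function on pairs of points that is additive along chains of lifted faces. -/
def AdditiveOn (A : ToricArrangement ι d) (K : Set (Fin d → ℝ))
    (g : (Fin d → ℝ) → (Fin d → ℝ) → ℚ) : Prop :=
  ∀ x ∈ K, ∀ y ∈ K, ∀ z ∈ K, A.FaceLE x y → A.FaceLE y z → g x z = g x y + g y z

/-- The function is a difference of values of a function of one variable. -/
def HasPotential (A : ToricArrangement ι d) (K : Set (Fin d → ℝ))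
    (g : (Fin d → ℝ) → (Fin d → ℝ) → ℚ) : Prop :=
  ∃ u : (Fin d → ℝ) → ℚ, ∀ x ∈ K, ∀ y ∈ K, A.FaceLE x y → g x y = u y - u x

/-- The set lies on one side of a lifted hyperplane. -/
def OneSided (A : ToricArrangement ι d) (K : Set (Fin d → ℝ)) (p : ι × ℤ) : Prop :=
  (∀ x ∈ K, 0 ≤ A.ev p.1 x - A.shift p.1 - p.2) ∨ (∀ x ∈ K, A.ev p.1 x - A.shift p.1 - p.2 ≤ 0)

lemma OneSided.mono {K K' : Set (Fin d → ℝ)} {p : ι × ℤ} (h : A.OneSided K p) (hK : K' ⊆ K) :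
    A.OneSided K' p := h.imp (fun h x hx => h x (hK hx)) fun h x hx => h x (hK hx)

/-- If the midpoint of two points of a set on one side of a hyperplane lies on the hyperplane, then
so do the points. -/
lemma OneSided.midpoint {K : Set (Fin d → ℝ)} {p : ι × ℤ} (h : A.OneSided K p) {x y : Fin d → ℝ}
    (hx : x ∈ K) (hy : y ∈ K)
    (h0 : A.ev p.1 ((1 / 2 : ℝ) • x + (1 / 2 : ℝ) • y) - A.shift p.1 - p.2 = 0) :
    A.ev p.1 x - A.shift p.1 - p.2 = 0 ∧ A.ev p.1 y - A.shift p.1 - p.2 = 0 := by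
  rw [map_add, map_smul, map_smul, smul_eq_mul, smul_eq_mul] at h0
  rcases h with h | h
  · have h1 := h x hx
    have h2 := h y hy
    constructor <;> linarith
  · have h1 := h x hx
    have h2 := h y hy
    constructor <;> linarith

lemma midpoint_mem_of_convex {K : Set (Fin d → ℝ)} (hK : Convex ℝ K) {x y : Fin d → ℝ}
    (hx : x ∈ K) (hy : y ∈ K) : (1 / 2 : ℝ) • x + (1 / 2 : ℝ) • y ∈ K :=
  hK hx hy (by norm_num) (by norm_num) (by norm_num)

/-- A relative interior point, found by repeated averaging: when nothing cuts `K`, a midpoint lies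
on a hyperplane only if both ends do. One average per index deals with all levels, since the
midpoint of two points with different values of `ev i` lies on no level of `ev i`. -/
lemma exists_maximal_point [Finite ι] {K : Set (Fin d → ℝ)} (hK : Convex ℝ K) (hne : K.Nonempty)
    (h : ∀ p, A.OneSided K p) : ∃ y ∈ K, ∀ x ∈ K, A.FaceLE x y := by
  classical
  have := Fintype.ofFinite ι
  have key : ∀ S : Finset ι, ∃ y ∈ K, ∀ i ∈ S, ∀ n : ℤ, A.ev i y - A.shift i - n = 0 →
      ∀ x ∈ K, A.ev i x - A.shift i - n = 0 := by
    intro S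
    induction S using Finset.induction_on with
    | empty =>
      obtain ⟨y, hy⟩ := hne
      exact ⟨y, hy, by simp⟩
    | insert i S _ ih =>
      obtain ⟨y, hy, hyS⟩ := ih
      obtain ⟨z, hz, hzi⟩ : ∃ z ∈ K, ∀ n : ℤ, A.ev i z - A.shift i - n = 0 →
          ∀ x ∈ K, A.ev i x - A.shift i - n = 0 := by
        by_cases hc : ∀ x ∈ K, A.ev i x = A.ev i y
        · exact ⟨y, hy, fun n hn x hx => by rw [hc x hx]; exact hn⟩
        · push Not at hc
          obtain ⟨z, hz, hzy⟩ := hc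
          refine ⟨_, midpoint_mem_of_convex hK hz hy, fun n hn => ?_⟩
          obtain ⟨h1, h2⟩ := (h (i, n)).midpoint hz hy hn
          exact absurd (by linarith : A.ev i z = A.ev i y) hzy
      refine ⟨_, midpoint_mem_of_convex hK hz hy, fun j hj n hn => ?_⟩
      obtain ⟨h1, h2⟩ := (h (j, n)).midpoint hz hy hn
      rcases Finset.mem_insert.1 hj with rfl | hj
      · exact hzi n h1
      · exact hyS j hj n h2
  obtain ⟨y, hy, hyS⟩ := key Finset.univ
  refine ⟨y, hy, fun x hx i n => ?_⟩
  unfold sgn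
  by_cases h0 : A.ev i x - A.shift i - n = 0
  · left; rw [h0, sign_zero]
  right
  have hy0 : A.ev i y - A.shift i - n ≠ 0 := fun h1 => h0 (hyS i (Finset.mem_univ _) n h1 x hx)
  rcases h (i, n) with h1 | h1
  · rw [sign_pos (lt_of_le_of_ne (h1 x hx) (Ne.symm h0)),
      sign_pos (lt_of_le_of_ne (h1 y hy) (Ne.symm hy0))]
  · rw [sign_neg (lt_of_le_of_ne (h1 x hx) h0), sign_neg (lt_of_le_of_ne (h1 y hy) hy0)]

/-- Gluing potentials on the two sides of a lifted hyperplane. -/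
lemma HasPotential.glue [Finite ι] {K : Set (Fin d → ℝ)} (hK : Convex ℝ K)
    {g : (Fin d → ℝ) → (Fin d → ℝ) → ℚ} (p : ι × ℤ)
    (h1 : A.HasPotential (K ∩ {x | A.ev p.1 x - A.shift p.1 - p.2 ≤ 0}) g)
    (h2 : A.HasPotential (K ∩ {x | 0 ≤ A.ev p.1 x - A.shift p.1 - p.2}) g) :
    A.HasPotential K g := by
  classical
  obtain ⟨u1, h1⟩ := h1
  obtain ⟨u2, h2⟩ := h2
  set φ : (Fin d → ℝ) → ℝ := fun x => A.ev p.1 x - A.shift p.1 - p.2 with hφ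
  -- Both potentials have the same differences on the slice `φ = 0`, which is convex and therefore
  -- connected, so they differ there by a constant.
  obtain ⟨c, hc⟩ : ∃ c : ℚ, ∀ x ∈ K, φ x = 0 → u1 x - u2 x = c := by
    by_cases hne : ∃ x ∈ K, φ x = 0
    · obtain ⟨x0, hx0, h0⟩ := hne
      refine ⟨u1 x0 - u2 x0, fun x hx hx' => ?_⟩
      have hconv : Convex ℝ (K ∩ {x | φ x = 0}) := by
        refine hK.inter ?_
        have : {x | φ x = 0} = {x | A.ev p.1 x = A.shift p.1 + p.2} := by
          ext x
          simp only [hφ, Set.mem_ofPred_eq]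
          constructor <;> intro h <;> linarith
        rw [this]
        exact convex_hyperplane (A.ev p.1).isLinear _
      refine eq_of_faceLE_invariant (A := A) hconv (fun x => u1 x - u2 x) ?_ ⟨hx, hx'⟩ ⟨hx0, h0⟩
      rintro a ⟨ha, ha'⟩ b ⟨hb, hb'⟩ hab
      have e1 := h1 a ⟨ha, le_of_eq ha'⟩ b ⟨hb, le_of_eq hb'⟩ hab
      have e2 := h2 a ⟨ha, ge_of_eq ha'⟩ b ⟨hb, ge_of_eq hb'⟩ hab
      change u1 a - u2 a = u1 b - u2 b
      linarith
    · exact ⟨0, fun x hx h0 => absurd ⟨x, hx, h0⟩ hne⟩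
  refine ⟨fun x => if φ x ≤ 0 then u1 x else u2 x + c, fun x hx y hy hxy => ?_⟩
  have hs := hxy p.1 p.2
  unfold sgn at hs
  change SignType.sign (φ x) = 0 ∨ SignType.sign (φ x) = SignType.sign (φ y) at hs
  dsimp only
  rcases lt_trichotomy (φ x) 0 with h | h | h
  · rw [sign_neg h] at hs
    have hy' : φ y < 0 := by
      rcases hs with hs | hs
      · exact absurd hs (by decide)
      · exact sign_eq_neg_one_iff.1 hs.symm
    rw [if_pos h.le, if_pos hy'.le]
    exact h1 x ⟨hx, h.le⟩ y ⟨hy, hy'.le⟩ hxy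
  · rw [if_pos h.le]
    split_ifs with hy'
    · exact h1 x ⟨hx, h.le⟩ y ⟨hy, hy'⟩ hxy
    · have e := h2 x ⟨hx, h.ge⟩ y ⟨hy, (not_le.1 hy').le⟩ hxy
      have := hc x hx h
      linarith
  · rw [sign_pos h] at hs
    have hy' : 0 < φ y := by
      rcases hs with hs | hs
      · exact absurd hs (by decide)
      · exact sign_eq_one_iff.1 hs.symm
    rw [if_neg (not_le.2 h), if_neg (not_le.2 hy')]
    have e := h2 x ⟨hx, h.le⟩ y ⟨hy, hy'.le⟩ hxy
    linarith

lemma AdditiveOn.mono {K K' : Set (Fin d → ℝ)} {g : (Fin d → ℝ) → (Fin d → ℝ) → ℚ}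
    (h : A.AdditiveOn K g) (hK : K' ⊆ K) : A.AdditiveOn K' g :=
  fun x hx y hy z hz => h x (hK hx) y (hK hy) z (hK hz)

lemma convex_halves (A : ToricArrangement ι d) (p : ι × ℤ) :
    Convex ℝ {x | A.ev p.1 x - A.shift p.1 - p.2 ≤ 0} ∧
      Convex ℝ {x | 0 ≤ A.ev p.1 x - A.shift p.1 - p.2} := by
  constructor
  · have : {x | A.ev p.1 x - A.shift p.1 - p.2 ≤ 0} = {x | A.ev p.1 x ≤ A.shift p.1 + p.2} := by
      ext x; simp only [Set.mem_ofPred_eq]; constructor <;> intro h <;> linarith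
    rw [this]
    exact convex_halfSpace_le (A.ev p.1).isLinear _
  · have : {x | 0 ≤ A.ev p.1 x - A.shift p.1 - p.2} = {x | A.shift p.1 + p.2 ≤ A.ev p.1 x} := by
      ext x; simp only [Set.mem_ofPred_eq]; constructor <;> intro h <;> linarith
    rw [this]
    exact convex_halfSpace_ge (A.ev p.1).isLinear _

/-- Induction on the hyperplanes that may cut `K`: cut along one of them and glue. If none cuts,
there is a maximal point, the poset is a cone, and integrating towards the apex gives the potential.
-/
lemma AdditiveOn.hasPotential_of_finset [Finite ι] (T : Finset (ι × ℤ)) :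
    ∀ {K : Set (Fin d → ℝ)} {g : (Fin d → ℝ) → (Fin d → ℝ) → ℚ}, Convex ℝ K →
      A.AdditiveOn K g → (∀ p ∉ T, A.OneSided K p) → A.HasPotential K g := by
  classical
  induction T using Finset.induction_on with
  | empty =>
    intro K g hK hg hT
    by_cases hne : K.Nonempty
    · obtain ⟨y, hy, hmax⟩ := exists_maximal_point hK hne (fun p => hT p (by simp))
      refine ⟨fun x => -g x y, fun a ha b hb hab => ?_⟩
      have := hg a ha b hb y hy hab (hmax b hb)
      linarith
    · exact ⟨0, fun x hx => absurd ⟨x, hx⟩ hne⟩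
  | insert p T _ ih =>
    intro K g hK hg hT
    refine HasPotential.glue hK p ?_ ?_
    · refine ih (hK.inter (convex_halves A p).1) (hg.mono Set.inter_subset_left) fun q hq => ?_
      by_cases hqp : q = p
      · subst hqp; exact Or.inr fun x hx => hx.2
      · exact (hT q (by simp [hqp, hq])).mono Set.inter_subset_left
    · refine ih (hK.inter (convex_halves A p).2) (hg.mono Set.inter_subset_left) fun q hq => ?_
      by_cases hqp : q = p
      · subst hqp; exact Or.inl fun x hx => hx.2
      · exact (hT q (by simp [hqp, hq])).mono Set.inter_subset_left

/-- A bounded set is cut by only finitely many lifted hyperplanes. -/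
lemma AdditiveOn.hasPotential_ball [Finite ι] {K : Set (Fin d → ℝ)} (hK : Convex ℝ K)
    {g : (Fin d → ℝ) → (Fin d → ℝ) → ℚ} (hg : A.AdditiveOn K g) (x0 : Fin d → ℝ) (R : ℝ) :
    A.HasPotential (K ∩ Metric.closedBall x0 R) g := by
  classical
  have hfin : {p : ι × ℤ | ¬ A.OneSided (K ∩ Metric.closedBall x0 R) p}.Finite := by
    have hb : ∀ i, ∃ N : ℤ, ∀ x ∈ Metric.closedBall x0 R, |A.ev i x - A.shift i| < N := by
      intro i
      have hc : Continuous fun x => |A.ev i x - A.shift i| :=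
        ((continuous_ev i).sub continuous_const).abs
      obtain ⟨c, hc⟩ := (isCompact_closedBall x0 R).bddAbove_image hc.continuousOn
      obtain ⟨N, hN⟩ := exists_nat_gt c
      exact ⟨N, fun x hx => (hc ⟨x, hx, rfl⟩).trans_lt (by exact_mod_cast hN)⟩
    choose N hN using hb
    refine (Set.finite_iUnion (fun i => ((Set.finite_Icc (-N i) (N i)).image
      (fun n => ((i, n) : ι × ℤ))))).subset ?_
    rintro ⟨i, n⟩ hp
    refine Set.mem_iUnion.2 ⟨i, n, ?_, rfl⟩
    by_contra hn
    rw [Set.mem_Icc, not_and_or, not_le, not_le] at hn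
    apply hp
    rcases hn with hn | hn
    · left
      intro x hx
      have h1 := abs_lt.1 (hN i x hx.2)
      have hn' : (n : ℝ) < -N i := by exact_mod_cast hn
      change 0 ≤ A.ev i x - A.shift i - n
      linarith
    · right
      intro x hx
      have h1 := abs_lt.1 (hN i x hx.2)
      have hn' : (N i : ℝ) < n := by exact_mod_cast hn
      change A.ev i x - A.shift i - n ≤ 0
      linarith
  refine AdditiveOn.hasPotential_of_finset hfin.toFinset (hK.inter (convex_closedBall x0 R))
    (hg.mono Set.inter_subset_left) fun p hp => ?_
  simpa using hp

/-- Cocycles on the poset of lifted faces meeting a convex set are coboundaries. -/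
lemma AdditiveOn.hasPotential [Finite ι] {K : Set (Fin d → ℝ)} (hK : Convex ℝ K)
    {g : (Fin d → ℝ) → (Fin d → ℝ) → ℚ} (hg : A.AdditiveOn K g) : A.HasPotential K g := by
  by_cases hne : K.Nonempty
  swap
  · exact ⟨0, fun x hx => absurd ⟨x, hx⟩ hne⟩
  obtain ⟨x0, hx0⟩ := hne
  have h : ∀ R : ℝ, ∃ u : (Fin d → ℝ) → ℚ, u x0 = 0 ∧ ∀ x ∈ K ∩ Metric.closedBall x0 R,
      ∀ y ∈ K ∩ Metric.closedBall x0 R, A.FaceLE x y → g x y = u y - u x := by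
    intro R
    obtain ⟨u, hu⟩ := hg.hasPotential_ball hK x0 R
    refine ⟨fun x => u x - u x0, sub_self _, fun x hx y hy hxy => ?_⟩
    rw [hu x hx y hy hxy]; ring
  choose u hu0 hu using h
  -- Potentials on a connected poset agree once normalised at `x0`, so those on growing balls fit
  -- together.
  have huniq : ∀ R R', 0 ≤ R → R ≤ R' → ∀ x ∈ K ∩ Metric.closedBall x0 R, u R x = u R' x := by
    intro R R' hR hRR x hx
    have hx0' : x0 ∈ K ∩ Metric.closedBall x0 R := ⟨hx0, Metric.mem_closedBall_self hR⟩
    have hsub : K ∩ Metric.closedBall x0 R ⊆ K ∩ Metric.closedBall x0 R' :=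
      Set.inter_subset_inter_right _ (Metric.closedBall_subset_closedBall hRR)
    have := eq_of_faceLE_invariant (A := A) (hK.inter (convex_closedBall x0 R))
      (fun x => u R x - u R' x) (fun a ha b hb hab => by
        have e1 := hu R a ha b hb hab
        have e2 := hu R' a (hsub ha) b (hsub hb) hab
        change u R a - u R' a = u R b - u R' b
        linarith) hx hx0'
    simp only [hu0] at this
    linarith
  refine ⟨fun x => u (dist x x0) x, fun x hx y hy hxy => ?_⟩
  set R := max (dist x x0) (dist y x0) with hR
  have hxR : x ∈ K ∩ Metric.closedBall x0 R := ⟨hx, Metric.mem_closedBall.2 (le_max_left _ _)⟩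
  have hyR : y ∈ K ∩ Metric.closedBall x0 R := ⟨hy, Metric.mem_closedBall.2 (le_max_right _ _)⟩
  dsimp only
  rw [huniq _ R dist_nonneg (le_max_left _ _) x ⟨hx, Metric.mem_closedBall.2 le_rfl⟩,
    huniq _ R dist_nonneg (le_max_right _ _) y ⟨hy, Metric.mem_closedBall.2 le_rfl⟩]
  exact hu R x hxR y hyR hxy

/-! ### Cocycles on the category of faces -/

/-- An additive function on a subgroup of `ℤ ^ d` extends to a linear form. -/
lemma exists_linear_extension (H : AddSubgroup (Fin d → ℤ)) (φ : H →+ ℚ) :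
    ∃ l : Fin d → ℚ, ∀ v : H, φ v = ∑ j, l j * (v.1 j : ℚ) := by
  -- The group `ℚ` is divisible, hence injective, so the homomorphism extends to `ℤ ^ d`.
  obtain ⟨ψ, hψ⟩ := (Module.Baer.of_divisible ℚ).extension_property_addMonoidHom H.subtype
    H.subtype_injective φ
  refine ⟨fun j => ψ (Pi.single j 1), fun v => ?_⟩
  have h1 : φ v = ψ v.1 := by rw [← hψ]; rfl
  have h2 : v.1 = ∑ j, v.1 j • (Pi.single j 1 : Fin d → ℤ) := by
    funext k
    simp [Finset.sum_apply, Pi.single_apply]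
  rw [h1]
  conv_lhs => rw [h2]
  rw [map_sum]
  refine Finset.sum_congr rfl fun j _ => ?_
  rw [map_zsmul, zsmul_eq_mul, mul_comm]

/-- Cocycles on the category of the faces of a layer are cohomologous to linear forms in the
translations. -/
lemma exists_face_potential [Finite ι] (hA : A.Essential) (L : A.Layer) (γ : Arrow A.Face → ℚ)
    (hγ : ∀ {F G H : A.Face} (m : F ⟶ G) (m' : G ⟶ H), F.pts ⊆ L.1 → G.pts ⊆ L.1 → H.pts ⊆ L.1 →
      γ (Arrow.mk (m ≫ m')) = γ (Arrow.mk m) + γ (Arrow.mk m')) :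
    ∃ (l : Fin d → ℚ) (u : A.Face → ℚ), ∀ {F G : A.Face} (m : F ⟶ G), F.pts ⊆ L.1 →
      G.pts ⊆ L.1 → γ (Arrow.mk m) = ∑ j, l j * (m.1 j : ℚ) + (u G - u F) := by
  classical
  obtain ⟨S, x0, hx0, hL⟩ := L.2
  set K := {y : Fin d → ℝ | ∀ i ∈ S, A.ev i y = A.ev i x0} with hKdef
  have hK : Convex ℝ K := by
    intro x hx y hy a b _ _ hab i hi
    rw [map_add, map_smul, map_smul, hx i hi, hy i hi, ← add_smul, hab, one_smul]
  have hKL : ∀ x ∈ K, (Face.mk x : A.Face).pts ⊆ L.1 := fun x hx => by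
    rw [mk_subset_layer_iff, hL]
    exact ⟨0, fun i hi => by rw [lat_zero, add_zero]; exact hx i hi⟩
  set g : (Fin d → ℝ) → (Fin d → ℝ) → ℚ := fun x y =>
    if h : A.FaceLE x y then γ (Arrow.mk h.hom) else 0 with hg
  have hgval : ∀ {x y} (h : A.FaceLE x y), g x y = γ (Arrow.mk h.hom) := fun h => dif_pos h
  have hadd : A.AdditiveOn K g := by
    intro x hx y hy z hz hxy hyz
    rw [hgval hxy, hgval hyz, hgval (hxy.trans hyz), ← hγ _ _ (hKL x hx) (hKL y hy) (hKL z hz),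
      FaceLE.hom_comp]
  obtain ⟨u, hu⟩ := hadd.hasPotential hK
  -- The integer translations preserving the chosen component `K` of the preimage of the layer.
  let Λ : AddSubgroup (Fin d → ℤ) :=
    { carrier := {v | ∀ i ∈ S, A.ev i (lat v) = 0}
      add_mem' := fun {a b} ha hb i hi => by rw [lat_add, map_add, ha i hi, hb i hi, add_zero]
      zero_mem' := fun i _ => by rw [lat_zero, map_zero]
      neg_mem' := fun {a} ha i hi => by rw [lat_neg, map_neg, ha i hi, neg_zero] }
  have hKΛ : ∀ x ∈ K, ∀ v ∈ Λ, x + lat v ∈ K := fun x hx v hv i hi => by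
    rw [map_add, hx i hi, hv i hi, add_zero]
  have hx0K : x0 ∈ K := fun i _ => rfl
  -- The cocycle is periodic, so the change of its potential under a translation is locally constant
  -- on the convex set `K`. Being independent of the point, it is additive in `v`.
  have hper : ∀ v ∈ Λ, ∀ x ∈ K, u (x + lat v) - u x = u (x0 + lat v) - u x0 := by
    intro v hv x hx
    refine eq_of_faceLE_invariant (A := A) hK (fun x => u (x + lat v) - u x)
      (fun a ha b hb hab => ?_) hx hx0K
    have e1 := hu a ha b hb hab
    have e2 := hu _ (hKΛ a ha v hv) _ (hKΛ b hb v hv) (hab.add_lat v)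
    rw [hgval (hab.add_lat v), FaceLE.arrow_add_lat hA hab v] at e2
    rw [hgval hab] at e1
    change u (a + lat v) - u a = u (b + lat v) - u b
    linarith
  obtain ⟨l, hl⟩ := exists_linear_extension Λ
    { toFun := fun v => u (x0 + lat v.1) - u x0
      map_zero' := by
        change u (x0 + lat 0) - u x0 = 0
        rw [lat_zero, add_zero, sub_self]
      map_add' := fun v w => by
        have h1 := hper w.1 w.2 (x0 + lat v.1) (hKΛ x0 hx0K v.1 v.2)
        change u (x0 + lat (v.1 + w.1)) - u x0 = (u (x0 + lat v.1) - u x0)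
          + (u (x0 + lat w.1) - u x0)
        rw [lat_add, ← add_assoc]
        linarith }
  have hlift : ∀ F : A.Face, ∃ v : Fin d → ℤ, F.pts ⊆ L.1 → F.rep + lat v ∈ K := by
    intro F
    by_cases hF : F.pts ⊆ L.1
    · have := hF F.rep_mem
      rw [hL] at this
      obtain ⟨v, hv⟩ := this
      exact ⟨v, fun _ => hv⟩
    · exact ⟨0, fun h => absurd h hF⟩
  choose t ht using hlift
  -- The translation `t F` moves the chosen lift of `F` into `K`; the correction term makes up for
  -- the different choices at the two ends of a morphism.
  refine ⟨l, fun F => u (F.rep + lat (t F)) - ∑ j, l j * (t F j : ℚ), ?_⟩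
  intro F G m hF hG
  have hSG : ∀ i ∈ S, i ∈ A.loc G := fun i hi => hG.trans (mem_above_of_mem hx0 hL hi)
  have hx := ht F hF
  have hy' := ht G hG
  have hle : A.FaceLE (F.rep + lat (t F)) (G.rep + lat (m.1 + t F)) := by
    have := m.2.add_lat (t F)
    rwa [add_assoc, ← lat_add] at this
  have hy : G.rep + lat (m.1 + t F) ∈ K := by
    intro i hi
    rw [← hx i hi]
    refine (hyp_iff_of_faceLE hle ?_).symm
    rw [hyp_add_lat, ← mem_above_iff]
    exact hSG i hi
  have e := hu _ hx _ hy hle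
  rw [hgval hle, FaceLE.arrow_eq hA m (t F) hle] at e
  have hΛ : m.1 + t F - t G ∈ Λ := by
    intro i hi
    have h1 := hy i hi
    have h2 := hy' i hi
    rw [map_add] at h1 h2
    rw [lat_sub, map_sub]
    linarith
  have h3 := hper _ hΛ _ hy'
  have h4 := hl ⟨_, hΛ⟩
  change u (x0 + lat (m.1 + t F - t G)) - u x0 = _ at h4
  rw [h4, add_assoc, ← lat_add, add_sub_cancel] at h3
  have h5 : ∑ j, l j * (((m.1 + t F - t G) j : ℤ) : ℚ) = ∑ j, l j * (m.1 j : ℚ)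
      + ∑ j, l j * (t F j : ℚ) - ∑ j, l j * (t G j : ℚ) := by
    rw [← Finset.sum_add_distrib, ← Finset.sum_sub_distrib]
    refine Finset.sum_congr rfl fun j _ => ?_
    simp only [Pi.sub_apply, Pi.add_apply]
    push_cast
    ring
  rw [e]
  dsimp only at h3 ⊢
  rw [h5] at h3
  linarith

end ToricArrangement

namespace ToricArrangement

variable {ι : Type} {d : ℕ} {A : ToricArrangement ι d}

/-! ### Cocycles on the strata -/

section Strata

variable [Finite ι]

/-- The face `{0}` of a central arrangement, or its smallest face if it is not essential. -/
def zeroFace (A : ToricArrangement ι d) (s : Set ι) : A.LFace s := ⟨0, 0, fun i => by simp⟩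

lemma zeroFace_le {s : Set ι} (G : A.LFace s) : A.zeroFace s ≤ G := fun _ => Or.inl rfl

lemma nonempty_chamber (A : ToricArrangement ι d) : Nonempty (A.Chamber Set.univ) := by
  obtain ⟨x, -, hx⟩ := exists_generic (A := A) ⊤ Set.univ fun i _ => not_top_le_ker i
  exact ⟨chamberOf _ x fun i => hx i trivial⟩

/-- A chamber of a local arrangement that is adjacent to `F₀(F)` contains a chamber of `𝒜₀`
adjacent to `F₀`. -/
lemma exists_chamber_extension {F₀ : A.LFace Set.univ} {s : Set ι} (C : A.Chamber s)
    (h : F₀.restrict s (Set.subset_univ s) ≤ C.toLFace) :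
    ∃ C' : A.Chamber Set.univ, F₀ ≤ C'.toLFace ∧ ∀ i : s, C'.at i = C.sg i := by
  obtain ⟨K⟩ := nonempty_chamber A
  obtain ⟨w, hw⟩ := C.realized
  -- Signs are taken from `F₀` first, then from a point `w` of `C`, and the arbitrary chamber `K`
  -- decides what is left.
  refine ⟨F₀.compCh ((A.faceOf Set.univ w).compCh K), le_compCh _ _, fun i => ?_⟩
  change (if F₀.sg ⟨i, trivial⟩ = 0 then (if SignType.sign (A.ev i w) = 0 then K.at i
    else SignType.sign (A.ev i w)) else F₀.sg ⟨i, trivial⟩) = C.sg i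
  rw [← hw i, if_neg (C.ne_zero i)]
  split_ifs with h0
  · rfl
  · exact (h i).resolve_left h0

lemma inStratum_sal {F₀ : A.LFace Set.univ} {F : A.Face} (G : A.LFace (A.loc F))
    {C : A.Chamber Set.univ} (h : F₀ ≤ C.toLFace) : InStratum F₀ (sal F G C) :=
  ⟨C.restrict _ _, fun i => h _, rfl⟩

lemma InStratum.exists_sal {F₀ : A.LFace Set.univ} {F : A.Face} {x : A.SalPos (A.loc F)}
    (h : InStratum F₀ x) : ∃ C : A.Chamber Set.univ, F₀ ≤ C.toLFace ∧ x = sal F x.face C := by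
  obtain ⟨C, hC, hx⟩ := h
  obtain ⟨C', hC', hCC⟩ := exists_chamber_extension C hC
  refine ⟨C', hC', SalPos.ext rfl (Chamber.ext_sg fun i => ?_)⟩
  rw [hx, sal_ch_sg, compCh_sg, hCC i]

lemma InStratum.salMap {F₀ : A.LFace Set.univ} {F F' : A.Face} (m : F' ⟶ F)
    {x : A.SalPos (A.loc F)} (h : InStratum F₀ x) : InStratum F₀ (salMap m x) := by
  obtain ⟨C, hC, hx⟩ := h.exists_sal
  rw [hx, salMap_sal]
  exact inStratum_sal _ hC

lemma subProp_pt {Y : A.Layer} {F₀ : A.LFace Set.univ} {F : A.Face} {x : A.SalPos (A.loc F)} :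
    A.subProp Y F₀ (pt F x) ↔ F.pts ⊆ Y.1 ∧ InStratum F₀ x := Iff.rfl

/-- A function on arrows that is additive on compositions within a stratum. -/
def IsCocycleOn (Y : A.Layer) (F₀ : A.LFace Set.univ) (c : Arrow A.Sal → ℚ) : Prop :=
  ∀ {X X' X'' : A.Sal} (f : X ⟶ X') (g : X' ⟶ X''), A.subProp Y F₀ X → A.subProp Y F₀ X' →
    A.subProp Y F₀ X'' → c (Arrow.mk (f ≫ g)) = c (Arrow.mk f) + c (Arrow.mk g)

/-- The arrow within a fibre. -/
noncomputable def fibArr {F : A.Face} {x y : A.SalPos (A.loc F)} (h : x ≤ y) : pt F x ⟶ pt F y :=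
  arr (𝟙 F) (by rw [salMap_id]; exact h)

open Classical in
/-- The value on an arrow within a fibre. -/
noncomputable def fibVal (c : Arrow A.Sal → ℚ) (F : A.Face) (x y : A.SalPos (A.loc F)) : ℚ :=
  if h : x ≤ y then c (Arrow.mk (fibArr h)) else 0

/-- The value on the arrow from `(F, x)` to its image over `F'`. -/
noncomputable def transVal (c : Arrow A.Sal → ℚ) {F F' : A.Face} (m : F' ⟶ F)
    (x : A.SalPos (A.loc F)) : ℚ := c (Arrow.mk (arr m (le_refl (salMap m x))))

lemma fibVal_of_le (c : Arrow A.Sal → ℚ) {F : A.Face} {x y : A.SalPos (A.loc F)} (h : x ≤ y) :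
    fibVal c F x y = c (Arrow.mk (fibArr h)) := dif_pos h

/-- The value on the arrow `[G, C_G] → [0, C]`. -/
noncomputable def coneVal (c : Arrow A.Sal → ℚ) (F : A.Face) (C : A.Chamber Set.univ)
    (G : A.LFace (A.loc F)) : ℚ := fibVal c F (sal F G C) (sal F (A.zeroFace _) C)

/-- The value on the cycle through `[D, D]`, `[0, C]`, `[D', D']` and `[0, C']`. -/
noncomputable def quadVal (c : Arrow A.Sal → ℚ) (F : A.Face) (C C' : A.Chamber Set.univ)
    (D D' : A.LFace (A.loc F)) : ℚ :=
  coneVal c F C D' - coneVal c F C' D' - (coneVal c F C D - coneVal c F C' D)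

/-- The chambers are separated by the `i`-th hypertorus and by no other one containing `F`. -/
def AdjacentAt (F : A.Face) (i : ι) (C C' : A.Chamber Set.univ) : Prop :=
  C.at i ≠ C'.at i ∧ ∀ j ∈ A.loc F, j ≠ i → C.at j = C'.at j

/-- The localization of a chamber at a face, as a face. -/
abbrev locCh (F : A.Face) (C : A.Chamber Set.univ) : A.LFace (A.loc F) :=
  (C.restrict (A.loc F) (Set.subset_univ _)).toLFace

lemma locCh_sg (F : A.Face) (C : A.Chamber Set.univ) (i : A.loc F) :
    (locCh F C).sg i = C.at i := rfl

/-- Distinct hypertori through a common face have distinct hyperplanes, so a generic vector of the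
`i`-th hyperplane avoids the others of `𝒜[F]`. Perturb it to both sides, then push both chambers
next to `F₀`, which leaves the `i`-th signs alone because `F₀` vanishes there. -/
lemma exists_adjacentAt (F₀ : A.LFace Set.univ) {F : A.Face} {i : ι} (hi : i ∈ A.loc F)
    (h0 : F₀.sg ⟨i, trivial⟩ = 0) : ∃ C C' : A.Chamber Set.univ, F₀ ≤ C.toLFace ∧
      F₀ ≤ C'.toLFace ∧ AdjacentAt F i C C' := by
  obtain ⟨K⟩ := nonempty_chamber A
  obtain ⟨h, hh, hgen⟩ := exists_generic (A := A) (LinearMap.ker (A.ev i)) (A.loc F \ {i})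
    (fun j hj hle => hj.2 (eq_of_mem_loc hi hj.1 hle).symm)
  set H : A.LFace Set.univ := A.faceOf Set.univ h
  have hHi : H.sg ⟨i, trivial⟩ = 0 := sign_eq_zero_iff.2 hh
  refine ⟨F₀.compCh (H.compCh K), F₀.compCh (H.compCh K.neg), le_compCh _ _, le_compCh _ _,
    ?_, ?_⟩
  · change (if F₀.sg ⟨i, trivial⟩ = 0 then (if H.sg ⟨i, trivial⟩ = 0 then K.at i else _) else _)
      ≠ (if F₀.sg ⟨i, trivial⟩ = 0 then (if H.sg ⟨i, trivial⟩ = 0 then -K.at i else _) else _)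
    rw [if_pos h0, if_pos h0, if_pos hHi, if_pos hHi]
    have : ∀ σ : SignType, σ ≠ 0 → σ ≠ -σ := by decide
    exact this _ (K.ne_zero _)
  · intro j hj hji
    have hHj : H.sg ⟨j, trivial⟩ ≠ 0 := sign_ne_zero.2 (hgen j ⟨hj, hji⟩)
    change (if F₀.sg ⟨j, trivial⟩ = 0 then (if H.sg ⟨j, trivial⟩ = 0 then K.at j else _) else _)
      = (if F₀.sg ⟨j, trivial⟩ = 0 then (if H.sg ⟨j, trivial⟩ = 0 then -K.at j else _) else _)
    rw [if_neg hHj, if_neg hHj]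

variable {Y : A.Layer} {F₀ : A.LFace Set.univ} {c : Arrow A.Sal → ℚ}

lemma IsCocycleOn.fibVal_add (hc : A.IsCocycleOn Y F₀ c) {F : A.Face} (hF : F.pts ⊆ Y.1)
    {x y z : A.SalPos (A.loc F)} (hx : InStratum F₀ x) (hy : InStratum F₀ y)
    (hz : InStratum F₀ z) (h : x ≤ y) (k : y ≤ z) :
    fibVal c F x z = fibVal c F x y + fibVal c F y z := by
  rw [fibVal_of_le c h, fibVal_of_le c k, fibVal_of_le c (h.trans k),
    ← hc _ _ (subProp_pt.2 ⟨hF, hx⟩) (subProp_pt.2 ⟨hF, hy⟩) (subProp_pt.2 ⟨hF, hz⟩)]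
  congr 2

/-- Every arrow is a transport to the new fibre followed by an arrow inside it. -/
lemma IsCocycleOn.val_arr (hc : A.IsCocycleOn Y F₀ c) {F F' : A.Face} (hF : F.pts ⊆ Y.1)
    (hF' : F'.pts ⊆ Y.1) (m : F' ⟶ F) {x : A.SalPos (A.loc F)} {x' : A.SalPos (A.loc F')}
    (hx : InStratum F₀ x) (hx' : InStratum F₀ x') (h : salMap m x ≤ x') :
    c (Arrow.mk (arr m h)) = transVal c m x + fibVal c F' (salMap m x) x' := by
  rw [fibVal_of_le c h, transVal, ← hc _ _ (subProp_pt.2 ⟨hF, hx⟩)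
    (subProp_pt.2 ⟨hF', hx.salMap m⟩) (subProp_pt.2 ⟨hF', hx'⟩)]
  congr 2
  exact sal_hom_ext _ _ (Category.comp_id _).symm

lemma IsCocycleOn.naturality (hc : A.IsCocycleOn Y F₀ c) {F F' : A.Face} (hF : F.pts ⊆ Y.1)
    (hF' : F'.pts ⊆ Y.1) (m : F' ⟶ F) {x y : A.SalPos (A.loc F)} (hx : InStratum F₀ x)
    (hy : InStratum F₀ y) (h : x ≤ y) :
    fibVal c F x y + transVal c m y
      = transVal c m x + fibVal c F' (salMap m x) (salMap m y) := by
  rw [← hc.val_arr hF hF' m hx (hy.salMap m) ((salMap m).monotone h), fibVal_of_le c h, transVal,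
    ← hc _ _ (subProp_pt.2 ⟨hF, hx⟩) (subProp_pt.2 ⟨hF, hy⟩) (subProp_pt.2 ⟨hF', hy.salMap m⟩)]
  congr 2
  exact sal_hom_ext _ _ (Category.id_comp _)

lemma IsCocycleOn.fibVal_sal (hc : A.IsCocycleOn Y F₀ c) {F : A.Face} (hF : F.pts ⊆ Y.1)
    {C : A.Chamber Set.univ} (hC : F₀ ≤ C.toLFace) {G K : A.LFace (A.loc F)} (h : G ≤ K) :
    fibVal c F (sal F K C) (sal F G C) = coneVal c F C K - coneVal c F C G := by
  have := hc.fibVal_add hF (inStratum_sal K hC) (inStratum_sal G hC) (inStratum_sal _ hC)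
    (sal_le_sal C h) (sal_le_sal C (zeroFace_le G))
  unfold coneVal
  linarith

/-- The difference of the values on two cones is locally constant. -/
lemma IsCocycleOn.coneVal_sub_of_le (hc : A.IsCocycleOn Y F₀ c) {F : A.Face}
    (hF : F.pts ⊆ Y.1) {C C' : A.Chamber Set.univ} (hC : F₀ ≤ C.toLFace)
    (hC' : F₀ ≤ C'.toLFace) {G K : A.LFace (A.loc F)} (h : G ≤ K)
    (hG : ∀ i : A.loc F, G.sg i = 0 → C.at i = C'.at i) :
    coneVal c F C G - coneVal c F C' G = coneVal c F C K - coneVal c F C' K := by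
  have hK : ∀ i : A.loc F, K.sg i = 0 → C.at i = C'.at i := fun i hi => hG i (by
    rcases h i with h | h
    · exact h
    · rw [h, hi])
  have h1 := hc.fibVal_sal hF hC h
  have h2 := hc.fibVal_sal hF hC' h
  rw [← sal_congr hK, ← sal_congr hG] at h2
  linarith

/-- On the faces strictly on a fixed side of each hyperplane separating `C` from `C'`, one has `[G,
C_G] = [G, C'_G]`: the two cones share this region. It is convex, so the locally constant difference
of the cone values is constant on it. -/
lemma IsCocycleOn.coneVal_sub_eq (hc : A.IsCocycleOn Y F₀ c) {F : A.Face}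
    (hF : F.pts ⊆ Y.1) {C C' : A.Chamber Set.univ} (hC : F₀ ≤ C.toLFace)
    (hC' : F₀ ≤ C'.toLFace) {D D' : A.LFace (A.loc F)}
    (h : ∀ i : A.loc F, C.at i ≠ C'.at i → D.sg i ≠ 0 ∧ D.sg i = D'.sg i) :
    coneVal c F C D - coneVal c F C' D = coneVal c F C D' - coneVal c F C' D' := by
  refine LFace.eq_of_le_invariant (A := A) {i : A.loc F | C.at i ≠ C'.at i} D.sg
    (fun G => coneVal c F C G - coneVal c F C' G) (fun G K hG hK hGK => ?_)
    (fun _ _ => rfl) (fun i hi => (h i hi).2.symm)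
  refine hc.coneVal_sub_of_le hF hC hC' hGK fun i hi => ?_
  by_contra hne
  exact (h i hne).1 ((hG i hne).symm.trans hi)

/-- The value of a quadrilateral around a hyperplane does not depend on the chambers. -/
lemma IsCocycleOn.quadVal_eq_aux (hc : A.IsCocycleOn Y F₀ c) {F : A.Face} (hF : F.pts ⊆ Y.1)
    {i : ι} {C₁ C₂ C C' : A.Chamber Set.univ} (h₁ : F₀ ≤ C₁.toLFace) (h₂ : F₀ ≤ C₂.toLFace)
    (h : F₀ ≤ C.toLFace) (h' : F₀ ≤ C'.toLFace) (ha : AdjacentAt F i C₁ C₂)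
    (hb : AdjacentAt F i C C') (hi : i ∈ A.loc F) (hs : C.at i = C₁.at i) (hs' : C'.at i = C₂.at i)
    {D D' : A.LFace (A.loc F)} (hD : D.sg ⟨i, hi⟩ = C.at i) (hD' : D'.sg ⟨i, hi⟩ = C'.at i) :
    quadVal c F C C' D D' = quadVal c F C₁ C₂ (locCh F C₁) (locCh F C₂) := by
  have hne : ∀ (E : A.Chamber Set.univ) (j : ι), E.at j ≠ 0 := fun E j => E.ne_zero _
  have only : ∀ {E E' : A.Chamber Set.univ}, AdjacentAt F i E E' → ∀ j : A.loc F,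
      E.at j ≠ E'.at j → j = ⟨i, hi⟩ := by
    intro E E' hE j hj
    by_contra hji
    exact hj (hE.2 j j.2 fun h => hji (Subtype.ext h))
  have e1 : coneVal c F C D - coneVal c F C' D
      = coneVal c F C (locCh F C₁) - coneVal c F C' (locCh F C₁) :=
    hc.coneVal_sub_eq hF h h' fun j hj => by
      rw [only hb j hj, hD, locCh_sg]
      exact ⟨hne _ _, hs⟩
  have e2 : coneVal c F C D' - coneVal c F C' D'
      = coneVal c F C (locCh F C₂) - coneVal c F C' (locCh F C₂) :=
    hc.coneVal_sub_eq hF h h' fun j hj => by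
      rw [only hb j hj, hD', locCh_sg]
      exact ⟨hne _ _, hs'⟩
  have e3 : coneVal c F C (locCh F C₁) - coneVal c F C₁ (locCh F C₁)
      = coneVal c F C (locCh F C₂) - coneVal c F C₁ (locCh F C₂) :=
    -- `C` and `C₁` are on the same side of the `i`-th hyperplane, so any hyperplane separating them
    -- differs from it and does not separate `C₁` from `C₂`.
    hc.coneVal_sub_eq hF h h₁ fun j hj => by
      refine ⟨hne _ _, ?_⟩
      by_contra hj'
      have := only ha j hj'
      subst this
      exact hj hs
  have e4 : coneVal c F C' (locCh F C₁) - coneVal c F C₂ (locCh F C₁)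
      = coneVal c F C' (locCh F C₂) - coneVal c F C₂ (locCh F C₂) :=
    hc.coneVal_sub_eq hF h' h₂ fun j hj => by
      refine ⟨hne _ _, ?_⟩
      by_contra hj'
      have := only ha j hj'
      subst this
      exact hj hs'
  unfold quadVal
  linarith

lemma AdjacentAt.symm {F : A.Face} {i : ι} {C C' : A.Chamber Set.univ} (h : AdjacentAt F i C C') :
    AdjacentAt F i C' C := ⟨h.1.symm, fun j hj hji => (h.2 j hj hji).symm⟩

/-- Exchanging `C` with `C'` and `D` with `D'` simultaneously does not change `quadVal`, so the
assumption on the sides made in `quadVal_eq_aux` can be dropped. -/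
lemma IsCocycleOn.quadVal_eq (hc : A.IsCocycleOn Y F₀ c) {F : A.Face} (hF : F.pts ⊆ Y.1)
    {i : ι} {C₁ C₂ C C' : A.Chamber Set.univ} (h₁ : F₀ ≤ C₁.toLFace) (h₂ : F₀ ≤ C₂.toLFace)
    (h : F₀ ≤ C.toLFace) (h' : F₀ ≤ C'.toLFace) (ha : AdjacentAt F i C₁ C₂)
    (hb : AdjacentAt F i C C') (hi : i ∈ A.loc F)
    {D D' : A.LFace (A.loc F)} (hD : D.sg ⟨i, hi⟩ = C.at i) (hD' : D'.sg ⟨i, hi⟩ = C'.at i) :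
    quadVal c F C C' D D' = quadVal c F C₁ C₂ (locCh F C₁) (locCh F C₂) := by
  have hne : ∀ (E : A.Chamber Set.univ), E.at i ≠ 0 := fun E => E.ne_zero _
  by_cases hs : C.at i = C₁.at i
  · refine hc.quadVal_eq_aux hF h₁ h₂ h h' ha hb hi hs ?_ hD hD'
    exact eq_of_ne_of_ne (hne C) (hne _) (hne _) hb.1 (hs ▸ ha.1)
  · have hs2 : C.at i = C₂.at i :=
      eq_of_ne_of_ne (hne C₁) (hne _) (hne _) (Ne.symm hs) ha.1
    have hs1 : C'.at i = C₁.at i :=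
      eq_of_ne_of_ne (hne C) (hne _) (hne _) hb.1 hs
    rw [← hc.quadVal_eq_aux hF h₁ h₂ h' h ha hb.symm hi hs1 hs2 hD' hD]
    unfold quadVal
    ring

/-- The value of a quadrilateral around a hypertorus is the same for comparable faces. -/
lemma IsCocycleOn.quadVal_hom (hc : A.IsCocycleOn Y F₀ c) {F F' : A.Face} (hF : F.pts ⊆ Y.1)
    (hF' : F'.pts ⊆ Y.1) (m : F' ⟶ F) {i : ι} (hi : i ∈ A.loc F) {C₁ C₂ : A.Chamber Set.univ}
    (h₁ : F₀ ≤ C₁.toLFace) (h₂ : F₀ ≤ C₂.toLFace) (ha : AdjacentAt F' i C₁ C₂) :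
    quadVal c F C₁ C₂ (locCh F C₁) (locCh F C₂)
      = quadVal c F' C₁ C₂ (locCh F' C₁) (locCh F' C₂) := by
  have hi' := loc_mono m hi
  -- In the alternating sum the transport terms cancel: the apex terms occur twice with opposite
  -- signs, and over a chamber the object `[D, D]` is the same for `C₁` and `C₂`.
  have key : ∀ {C : A.Chamber Set.univ} (_ : F₀ ≤ C.toLFace) (D : A.LFace (A.loc F)),
      coneVal c F C D = transVal c m (sal F D C) - transVal c m (sal F (A.zeroFace _) C)
        + (coneVal c F' C (incl m D) - coneVal c F' C (incl m (A.zeroFace _))) := by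
    intro C hC D
    have e1 := hc.naturality hF hF' m (inStratum_sal D hC) (inStratum_sal _ hC)
      (sal_le_sal C (zeroFace_le D))
    rw [salMap_sal, salMap_sal, hc.fibVal_sal hF' hC (incl_mono m (zeroFace_le D))] at e1
    change coneVal c F C D + _ = _ at e1
    linarith
  have hcong : ∀ E : A.Chamber Set.univ, sal F (locCh F E) C₁ = sal F (locCh F E) C₂ :=
    fun E => sal_congr fun i h => absurd h (E.ne_zero _)
  rw [← hc.quadVal_eq hF' h₁ h₂ h₁ h₂ ha ha hi' (D := incl m (locCh F C₁))
    (D' := incl m (locCh F C₂)) (incl_sg_of_mem m _ ⟨i, hi'⟩ hi)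
    (incl_sg_of_mem m _ ⟨i, hi'⟩ hi)]
  unfold quadVal
  rw [key h₁ (locCh F C₂), key h₂ (locCh F C₂), key h₁ (locCh F C₁), key h₂ (locCh F C₁),
    hcong C₁, hcong C₂]
  ring

/-- The number attached to a face is invariant under morphisms of faces, and `Y ∩ H` is one layer,
hence connected, so a single number serves for the whole hypertorus. -/
lemma IsCocycleOn.exists_quadVal (hc : A.IsCocycleOn Y F₀ c) {i : ι}
    (h0 : F₀.sg ⟨i, trivial⟩ = 0) (hconn : ∃ L : A.Layer, L.1 = Y.1 ∩ A.hyp i) :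
    ∃ w : ℚ, ∀ F : A.Face, F.pts ⊆ Y.1 → ∀ (hi : i ∈ A.loc F) (C C' : A.Chamber Set.univ),
      F₀ ≤ C.toLFace → F₀ ≤ C'.toLFace → AdjacentAt F i C C' → ∀ D D' : A.LFace (A.loc F),
        D.sg ⟨i, hi⟩ = C.at i → D'.sg ⟨i, hi⟩ = C'.at i → quadVal c F C C' D D' = w := by
  have hex : ∀ F : A.Face, ∃ w : ℚ, F.pts ⊆ Y.1 → ∀ (hi : i ∈ A.loc F)
      (C C' : A.Chamber Set.univ), F₀ ≤ C.toLFace → F₀ ≤ C'.toLFace → AdjacentAt F i C C' →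
        ∀ D D' : A.LFace (A.loc F), D.sg ⟨i, hi⟩ = C.at i → D'.sg ⟨i, hi⟩ = C'.at i →
          quadVal c F C C' D D' = w := by
    intro F
    by_cases hi : i ∈ A.loc F
    · obtain ⟨C₁, C₂, h₁, h₂, ha⟩ := exists_adjacentAt F₀ hi h0
      exact ⟨_, fun hF _ C C' h h' hb D D' hD hD' =>
        hc.quadVal_eq hF h₁ h₂ h h' ha hb hi hD hD'⟩
    · exact ⟨0, fun _ h => absurd h hi⟩
  choose w hw using hex
  obtain ⟨L, hL⟩ := hconn
  have hsub : ∀ F : A.Face, F.pts ⊆ L.1 → F.pts ⊆ Y.1 ∧ i ∈ A.loc F := by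
    intro F hF
    rw [hL] at hF
    exact ⟨fun x hx => (hF hx).1, fun x hx => (hF hx).2⟩
  obtain ⟨x, hx⟩ := layer_nonempty L
  refine ⟨w (Face.mk x), fun F hF hi => ?_⟩
  have heq : w (Face.mk x) = w F := by
    refine eq_of_hom_invariant L w (fun {F' F} m hF' hF => ?_) (mk_subset_layer_iff.2 hx)
      (by rw [hL]; exact Set.subset_inter hF hi)
    obtain ⟨hF1, hF2⟩ := hsub F hF
    obtain ⟨hF1', hF2'⟩ := hsub F' hF'
    obtain ⟨C₁, C₂, h₁, h₂, ha⟩ := exists_adjacentAt F₀ hF2' h0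
    have ha' : AdjacentAt F i C₁ C₂ := ⟨ha.1, fun j hj => ha.2 j (loc_mono m hj)⟩
    rw [← hw F hF1 hF2 C₁ C₂ h₁ h₂ ha' (locCh F C₁) (locCh F C₂) rfl rfl,
      ← hw F' hF1' hF2' C₁ C₂ h₁ h₂ ha (locCh F' C₁) (locCh F' C₂) rfl rfl]
    exact (hc.quadVal_hom hF1 hF1' m hF2 h₁ h₂ ha).symm
  rw [heq]
  exact hw F hF hi

/-- All quadrilaterals around single hyperplanes have value zero. -/
def HasNoWinding (Y : A.Layer) (F₀ : A.LFace Set.univ) (c : Arrow A.Sal → ℚ) : Prop :=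
  ∀ F : A.Face, F.pts ⊆ Y.1 → ∀ (i : ι) (hi : i ∈ A.loc F), F₀.sg ⟨i, trivial⟩ = 0 →
    ∀ C C' : A.Chamber Set.univ, F₀ ≤ C.toLFace → F₀ ≤ C'.toLFace → AdjacentAt F i C C' →
      ∀ D D' : A.LFace (A.loc F), D.sg ⟨i, hi⟩ = C.at i → D'.sg ⟨i, hi⟩ = C'.at i →
        quadVal c F C C' D D' = 0

/-- Two cones are glued without monodromy. Walk from `C` to `C'` through chambers next to `F₀`, one
hyperplane at a time, by induction on the number of separating hyperplanes. -/
lemma IsCocycleOn.coneVal_sub_const (hc : A.IsCocycleOn Y F₀ c) (hw : A.HasNoWinding Y F₀ c)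
    {F : A.Face} (hF : F.pts ⊆ Y.1) (D D' : A.Chamber (A.loc F)) (n : ℕ) :
    ∀ C C' : A.Chamber Set.univ, F₀ ≤ C.toLFace → F₀ ≤ C'.toLFace →
      (diffSet (C.restrict (A.loc F) (Set.subset_univ _))
        (C'.restrict (A.loc F) (Set.subset_univ _))).ncard = n →
      coneVal c F C D.toLFace - coneVal c F C' D.toLFace
        = coneVal c F C D'.toLFace - coneVal c F C' D'.toLFace := by
  induction n using Nat.strong_induction_on with
  | _ n ih =>
    intro C C' hC hC' hn
    set R := C.restrict (A.loc F) (Set.subset_univ _) with hR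
    set R' := C'.restrict (A.loc F) (Set.subset_univ _) with hR'
    by_cases hRR : R' = R
    · have : ∀ G, sal F G C = sal F G C' := fun G => sal_congr fun i _ =>
        (congrArg (fun E : A.Chamber (A.loc F) => E.sg i) hRR).symm
      have h2 : ∀ G, coneVal c F C G = coneVal c F C' G := fun G => by
        unfold coneVal; rw [this, this]
      rw [h2, h2, sub_self, sub_self]
    obtain ⟨E, hE, hsub, hpar, -⟩ := exists_adjacent_chamber hRR
    have hF₀E : F₀.restrict (A.loc F) (Set.subset_univ _) ≤ E.toLFace := by
      intro i
      by_cases hi : i ∈ diffSet R E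
      · have h1 : R'.sg i ≠ R.sg i := hsub hi
        rcases hC ⟨i, trivial⟩ with h2 | h2
        · exact Or.inl h2
        · rcases hC' ⟨i, trivial⟩ with h3 | h3
          · exact Or.inl h3
          · exact absurd (h3.symm.trans h2) h1
      · have h1 : E.sg i = R.sg i := not_not.1 hi
        rw [h1]
        exact hC ⟨i, trivial⟩
    obtain ⟨Ê, hÊ, hÊE⟩ := exists_chamber_extension E hF₀E
    obtain ⟨i, hi⟩ := diffSet_nonempty hE
    have hadj : AdjacentAt F i C Ê := by
      constructor
      · rw [hÊE i]; exact Ne.symm hi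
      · intro j hj hji
        rw [hÊE ⟨j, hj⟩]
        by_contra hne
        have hj' : (⟨j, hj⟩ : A.loc F) ∈ diffSet R E := Ne.symm hne
        exact hji (eq_of_mem_loc hj i.2 (hpar _ hj' _ hi).le)
    have e1 : coneVal c F C D.toLFace - coneVal c F Ê D.toLFace
        = coneVal c F C D'.toLFace - coneVal c F Ê D'.toLFace := by
      -- On the same side of the crossed wall the difference is constant anyway; on opposite sides
      -- its jump is a `quadVal`, zero by assumption. In that case the wall contains `F₀`, since
      -- both `C` and `Ê` are adjacent to `F₀`.
      by_cases hDD : D.sg i = D'.sg i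
      · refine hc.coneVal_sub_eq hF hC hÊ fun j hj => ⟨D.ne_zero j, ?_⟩
        have : j = i := by
          by_contra hji
          exact hj (hadj.2 j j.2 fun h => hji (Subtype.ext h))
        rw [this, hDD]
      · have h0 : F₀.sg ⟨i, trivial⟩ = 0 := by
          rcases hC ⟨i, trivial⟩ with h | h
          · exact h
          · rcases hÊ ⟨i, trivial⟩ with h' | h'
            · exact h'
            · exact absurd (h.symm.trans h') hadj.1
        by_cases hDC : D.sg i = C.at i
        · have hD'E : D'.sg i = Ê.at i :=
            eq_of_ne_of_ne (D.ne_zero i) (D'.ne_zero i) (Ê.ne_zero _) hDD (hDC ▸ hadj.1)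
          have := hw F hF i i.2 h0 C Ê hC hÊ hadj D.toLFace D'.toLFace hDC hD'E
          unfold quadVal at this
          linarith
        · have hD'C : D'.sg i = C.at i :=
            eq_of_ne_of_ne (D.ne_zero i) (D'.ne_zero i) (C.ne_zero _) hDD hDC
          have hDE : D.sg i = Ê.at i :=
            eq_of_ne_of_ne (C.ne_zero ⟨i, trivial⟩) (D.ne_zero i) (Ê.ne_zero _) (Ne.symm hDC) hadj.1
          have := hw F hF i i.2 h0 C Ê hC hÊ hadj D'.toLFace D.toLFace hD'C hDE
          unfold quadVal at this
          linarith
    have hlt : (diffSet (Ê.restrict (A.loc F) (Set.subset_univ _)) R').ncard < n := by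
      rw [← hn]
      have hER : Ê.restrict (A.loc F) (Set.subset_univ _) = E := Chamber.ext_sg hÊE
      rw [hER]
      refine Set.ncard_lt_ncard ⟨fun j hj => ?_, fun h => ?_⟩ (Set.toFinite _)
      · by_contra hj'
        have h1 : R'.sg j = R.sg j := not_not.1 hj'
        have h2 : j ∈ diffSet R E := by
          intro h3
          exact hj (h1.trans h3.symm)
        exact hsub h2 h1
      · have h1 : R'.sg i ≠ E.sg i := h (hsub hi)
        exact h1 (eq_of_ne_of_ne (R.ne_zero i) (R'.ne_zero i) (E.ne_zero i) (Ne.symm (hsub hi))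
          (Ne.symm hi))
    have e2 := ih _ hlt Ê C' hÊ hC' rfl
    linarith

/-- A cocycle without winding is exact on each fibre. -/
lemma IsCocycleOn.exists_fibre_potential (hc : A.IsCocycleOn Y F₀ c)
    (hw : A.HasNoWinding Y F₀ c) {F : A.Face} (hF : F.pts ⊆ Y.1) :
    ∃ u : A.SalPos (A.loc F) → ℚ, ∀ x y, InStratum F₀ x → InStratum F₀ y → x ≤ y →
      fibVal c F x y = u y - u x := by
  classical
  obtain ⟨K⟩ := nonempty_chamber A
  set D₀ := K.restrict (A.loc F) (Set.subset_univ _)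
  have hex : ∀ x : A.SalPos (A.loc F), ∃ C : A.Chamber Set.univ, InStratum F₀ x →
      F₀ ≤ C.toLFace ∧ x = sal F x.face C := by
    intro x
    by_cases hx : InStratum F₀ x
    · obtain ⟨C, hC⟩ := hx.exists_sal
      exact ⟨C, fun _ => hC⟩
    · exact ⟨K, fun h => absurd h hx⟩
  choose Cx hCx using hex
  -- Different cones through the same object give the same integral. The difference of cone values
  -- at `G` equals that at the adjacent chamber `G.compCh C`, and then that at `D₀`.
  have hwell : ∀ (G : A.LFace (A.loc F)) (C C' : A.Chamber Set.univ), F₀ ≤ C.toLFace →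
      F₀ ≤ C'.toLFace → sal F G C = sal F G C' →
      coneVal c F C D₀.toLFace - coneVal c F C G = coneVal c F C' D₀.toLFace - coneVal c F C' G := by
    intro G C C' hC hC' h
    have h0 : ∀ i : A.loc F, G.sg i = 0 → C.at i = C'.at i := by
      intro i hi
      have := congrArg (fun x : A.SalPos (A.loc F) => x.ch.sg i) h
      simp only [sal_ch_sg, if_pos hi] at this
      exact this
    have e1 := hc.coneVal_sub_of_le hF hC hC' (sal F G C).le h0
    have e2 := hc.coneVal_sub_const hw hF D₀ (sal F G C).ch _ C C' hC hC' rfl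
    change coneVal c F C G - coneVal c F C' G = _ at e1
    linarith
  -- Integration from the base vertex `[D₀, D₀]` up to the apex `[0, C]` of a cone containing `x`,
  -- and back down to `x`.
  refine ⟨fun x => coneVal c F (Cx x) D₀.toLFace - coneVal c F (Cx x) x.face,
    fun x y hx hy hxy => ?_⟩
  obtain ⟨hCX, hx'⟩ := hCx x hx
  obtain ⟨hCY, hy'⟩ := hCx y hy
  -- If `x ≤ y`, then `x` lies in every cone containing `y`, so a single cone suffices for the
  -- comparison.
  have hxC : x = sal F x.face (Cx y) := by
    refine SalPos.ext rfl (Chamber.ext_sg fun i => ?_)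
    have h1 := congrArg (fun C : A.Chamber (A.loc F) => C.sg i) hxy.2
    simp only [compCh_sg] at h1
    rw [← h1, sal_ch_sg]
    split_ifs with h2
    · have h3 := congrArg (fun z : A.SalPos (A.loc F) => z.ch.sg i) hy'
      simp only [sal_ch_sg] at h3
      rw [h3, if_pos]
      rcases hxy.1 i with h4 | h4
      · exact h4
      · rw [h4, h2]
    · rfl
  have e1 := hwell x.face (Cx x) (Cx y) hCX hCY (hx'.symm.trans hxC)
  have e2 := hc.fibVal_sal hF hCY hxy.1
  rw [← hxC, ← hy'] at e2
  dsimp only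
  rw [e1, e2]
  ring

/-- Functions that are constant along the order of a fibre are constant on the fibre. -/
lemma stratum_connected {F : A.Face} {α : Type*} (f : A.SalPos (A.loc F) → α)
    (h : ∀ x y, InStratum F₀ x → InStratum F₀ y → x ≤ y → f x = f y) {x y : A.SalPos (A.loc F)}
    (hx : InStratum F₀ x) (hy : InStratum F₀ y) : f x = f y := by
  obtain ⟨K⟩ := nonempty_chamber A
  -- From `x` pass through the apex of its cone to the vertex of `K`, which lies in all cones.
  have key : ∀ {x : A.SalPos (A.loc F)} {C : A.Chamber Set.univ}, F₀ ≤ C.toLFace →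
      x = sal F x.face C → f x = f (sal F (locCh F K) C) := by
    intro x C hC hx
    rw [hx, h _ _ (inStratum_sal _ hC) (inStratum_sal (A.zeroFace _) hC)
      (sal_le_sal C (zeroFace_le _)), ← h _ _ (inStratum_sal (locCh F K) hC)
      (inStratum_sal (A.zeroFace _) hC) (sal_le_sal C (zeroFace_le _))]
  obtain ⟨C, hC, hxC⟩ := hx.exists_sal
  obtain ⟨C', hC', hyC⟩ := hy.exists_sal
  rw [key hC hxC, key hC' hyC, sal_congr (C := C) (C' := C') fun i hi => absurd hi (K.ne_zero _)]

/-- A cocycle without winding is cohomologous to a linear form in the translations. -/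
lemma IsCocycleOn.exists_of_noWinding (hA : A.Essential) (hc : A.IsCocycleOn Y F₀ c)
    (hw : A.HasNoWinding Y F₀ c) : ∃ (l : Fin d → ℚ) (u : A.Sal → ℚ), ∀ {X X' : A.Sal}
      (f : X ⟶ X'), A.subProp Y F₀ X → A.subProp Y F₀ X' →
        c (Arrow.mk f) = shiftForm l (Arrow.mk f) + (u X' - u X) := by
  classical
  obtain ⟨K⟩ := nonempty_chamber A
  have hB : F₀ ≤ (F₀.compCh K).toLFace := le_compCh _ _
  set B := F₀.compCh K with hBdef
  have hex : ∀ F : A.Face, ∃ u : A.SalPos (A.loc F) → ℚ, F.pts ⊆ Y.1 → ∀ x y, InStratum F₀ x →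
      InStratum F₀ y → x ≤ y → fibVal c F x y = u y - u x := by
    intro F
    by_cases hF : F.pts ⊆ Y.1
    · obtain ⟨u, hu⟩ := hc.exists_fibre_potential hw hF
      exact ⟨u, fun _ => hu⟩
    · exact ⟨0, fun h => absurd h hF⟩
  choose u hu using hex
  -- The transport, corrected by the fibre potentials, is constant along the order of the fibre by
  -- naturality, hence constant on the connected fibre. It thus depends on the morphism of faces
  -- only, and gives a cocycle `γ` on the category of faces.
  let δ : ∀ {F' F : A.Face} (_ : F' ⟶ F) (_ : A.SalPos (A.loc F)), ℚ := fun {F' F} m x =>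
    transVal c m x - u F' (salMap m x) + u F x
  let γ : Arrow A.Face → ℚ := fun f => δ f.hom (sal f.right (A.zeroFace _) B)
  have hδ : ∀ {F' F : A.Face} (m : F' ⟶ F), F'.pts ⊆ Y.1 → F.pts ⊆ Y.1 →
      ∀ x, InStratum F₀ x → δ m x = γ (Arrow.mk m) := by
    intro F' F m hF' hF x hx
    refine stratum_connected (F₀ := F₀) (fun x => δ m x) (fun x y hx hy hxy => ?_) hx
      (inStratum_sal _ hB)
    have e1 := hc.naturality hF hF' m hx hy hxy
    rw [hu F hF x y hx hy hxy, hu F' hF' _ _ (hx.salMap m) (hy.salMap m)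
      ((salMap m).monotone hxy)] at e1
    change transVal c m x - u F' (salMap m x) + u F x = transVal c m y - u F' (salMap m y) + u F y
    linarith
  have hval : ∀ {F' F : A.Face} (m : F' ⟶ F) (_ : F'.pts ⊆ Y.1) (_ : F.pts ⊆ Y.1)
      {x : A.SalPos (A.loc F)} {x' : A.SalPos (A.loc F')} (_ : InStratum F₀ x)
      (_ : InStratum F₀ x') (h : salMap m x ≤ x'),
      c (Arrow.mk (arr m h)) = γ (Arrow.mk m) + (u F' x' - u F x) := by
    intro F' F m hF' hF x x' hx hx' h
    rw [hc.val_arr hF hF' m hx hx' h, hu F' hF' _ _ (hx.salMap m) hx' h, ← hδ m hF' hF x hx]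
    change _ = transVal c m x - u F' (salMap m x) + u F x + _
    ring
  obtain ⟨l, v, hl⟩ := exists_face_potential hA Y γ (by
    intro F G H m m' hF hG hH
    set x := sal H (A.zeroFace _) B with hx
    have hxs : InStratum F₀ x := inStratum_sal _ hB
    have e1 := hval m' hG hH hxs (hxs.salMap m') le_rfl
    have e2 := hval m hF hG (hxs.salMap m') ((hxs.salMap m').salMap m) le_rfl
    have h3 : salMap (m ≫ m') x ≤ salMap m (salMap m' x) := (salMap_comp m m' x).le
    have e3 := hval (m ≫ m') hF hH hxs ((hxs.salMap m').salMap m) h3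
    have e4 := hc (arr m' (le_refl (salMap m' x))) (arr m (le_refl (salMap m (salMap m' x))))
      (subProp_pt.2 ⟨hH, hxs⟩) (subProp_pt.2 ⟨hG, hxs.salMap m'⟩)
      (subProp_pt.2 ⟨hF, (hxs.salMap m').salMap m⟩)
    rw [arr_comp m' m _ _ h3, e1, e2, e3] at e4
    linarith)
  refine ⟨l, fun X => u X.base.unop X.fiber - v X.base.unop, ?_⟩
  intro X X' f hX hX'
  obtain ⟨F, x, rfl⟩ := exists_pt X
  obtain ⟨F', x', rfl⟩ := exists_pt X'
  obtain ⟨m, h, rfl⟩ := exists_arr f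
  rw [subProp_pt] at hX hX'
  rw [hval m hX'.1 hX.1 hX.2 hX'.2 h, hl m hX'.1 hX.1]
  change _ = ∑ j, l j * (m.1 j : ℚ) + ((u F' x' - v F') - (u F x - v F))
  ring

open Classical in
lemma coneVal_wind (i : ι) (F : A.Face) (C : A.Chamber Set.univ) (D : A.LFace (A.loc F)) :
    coneVal (wind i) F C D = if h : i ∈ A.loc F then
      if D.sg ⟨i, h⟩ = 1 ∧ C.at i = 1 then 1 else 0 else 0 := by
  unfold coneVal
  rw [fibVal_of_le _ (sal_le_sal C (zeroFace_le D))]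
  unfold fibArr
  rw [wind_arr]
  refine dite_congr rfl (fun h => ?_) fun _ => rfl
  refine if_congr ?_ rfl rfl
  rw [incl_id]
  change D.sg _ = 1 ∧ (0 : SignType) = 0 ∧ (if (0 : SignType) = 0 then C.at i else 0) = 1 ↔ _
  simp

/-- Only the cone value with both the face and the chamber on the positive side of the `i`-th
hyperplane is nonzero. It enters with coefficient `-1` whichever of `C`, `C'` is the positive one.
-/
lemma quadVal_wind {i j : ι} {F : A.Face} (hi : i ∈ A.loc F) {C C' : A.Chamber Set.univ}
    (h : AdjacentAt F i C C') {D D' : A.LFace (A.loc F)} (hD : D.sg ⟨i, hi⟩ = C.at i)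
    (hD' : D'.sg ⟨i, hi⟩ = C'.at i) [DecidableEq ι] :
    quadVal (wind j) F C C' D D' = if j = i then -1 else 0 := by
  unfold quadVal
  simp only [coneVal_wind]
  by_cases hji : j = i
  · subst hji
    rw [if_pos rfl, dif_pos hi, dif_pos hi, dif_pos hi, dif_pos hi, hD, hD']
    have key : ∀ σ τ : SignType, σ ≠ τ → σ ≠ 0 → τ ≠ 0 →
        ((if τ = 1 ∧ σ = 1 then (1 : ℚ) else 0) - (if τ = 1 ∧ τ = 1 then 1 else 0)
          - ((if σ = 1 ∧ σ = 1 then 1 else 0) - (if σ = 1 ∧ τ = 1 then 1 else 0))) = -1 := by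
      intro σ τ h1 h2 h3
      rcases σ with _ | _ | _ <;> rcases τ with _ | _ | _ <;> first
        | exact absurd rfl h1
        | exact absurd rfl h2
        | exact absurd rfl h3
        | norm_num [show (SignType.neg : SignType) ≠ 1 by decide,
            show (SignType.pos : SignType) = 1 from rfl]
    exact key _ _ h.1 (C.ne_zero _) (C'.ne_zero _)
  · rw [if_neg hji]
    by_cases hjF : j ∈ A.loc F
    · simp only [dif_pos hjF, h.2 j hjF hji, sub_self]
    · simp only [dif_neg hjF, sub_self]

lemma fibVal_sub_sum [Fintype ι] (a : ι → ℚ) (F : A.Face) (x y : A.SalPos (A.loc F)) :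
    fibVal (fun f => c f - ∑ i, a i * wind i f) F x y
      = fibVal c F x y - ∑ i, a i * fibVal (wind i) F x y := by
  unfold fibVal
  split_ifs
  · rfl
  · simp

/-- Every cocycle on a stratum is cohomologous to a combination of the standard ones. -/
theorem IsCocycleOn.exists_standard_form [Fintype ι] (hA : A.Essential)
    (hc : A.IsCocycleOn Y F₀ c)
    (hconn : ∀ i, F₀.sg ⟨i, trivial⟩ = 0 → (∃ F : A.Face, F.pts ⊆ Y.1 ∧ i ∈ A.loc F) →
      ∃ L : A.Layer, L.1 = Y.1 ∩ A.hyp i) :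
    ∃ (a : ι → ℚ) (l : Fin d → ℚ) (u : A.Sal → ℚ),
      (∀ i, a i ≠ 0 → F₀.sg ⟨i, trivial⟩ = 0 ∧ ∃ F : A.Face, F.pts ⊆ Y.1 ∧ i ∈ A.loc F) ∧
      ∀ {X X' : A.Sal} (f : X ⟶ X'), A.subProp Y F₀ X → A.subProp Y F₀ X' →
        c (Arrow.mk f) = ∑ i, a i * wind i (Arrow.mk f) + shiftForm l (Arrow.mk f)
          + (u X' - u X) := by
  classical
  have hex : ∀ i, ∃ w : ℚ, (w ≠ 0 → F₀.sg ⟨i, trivial⟩ = 0 ∧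
      ∃ F : A.Face, F.pts ⊆ Y.1 ∧ i ∈ A.loc F) ∧ (F₀.sg ⟨i, trivial⟩ = 0 →
      ∀ F : A.Face, F.pts ⊆ Y.1 → ∀ (hi : i ∈ A.loc F) (C C' : A.Chamber Set.univ),
      F₀ ≤ C.toLFace → F₀ ≤ C'.toLFace → AdjacentAt F i C C' → ∀ D D' : A.LFace (A.loc F),
        D.sg ⟨i, hi⟩ = C.at i → D'.sg ⟨i, hi⟩ = C'.at i → quadVal c F C C' D D' = w) := by
    intro i
    by_cases h : F₀.sg ⟨i, trivial⟩ = 0 ∧ ∃ F : A.Face, F.pts ⊆ Y.1 ∧ i ∈ A.loc F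
    · obtain ⟨w, hw⟩ := hc.exists_quadVal h.1 (hconn i h.1 h.2)
      exact ⟨w, fun _ => h, fun _ => hw⟩
    · exact ⟨0, fun h => absurd rfl h, fun h0 F hF hi => absurd ⟨h0, F, hF, hi⟩ h⟩
  choose w hw0 hw using hex
  -- The sign compensates the value `-1` of `wind i` on its own quadrilaterals.
  set a : ι → ℚ := fun i => -w i with ha
  set c' : Arrow A.Sal → ℚ := fun f => c f - ∑ i, a i * wind i f with hc'def
  have hc' : A.IsCocycleOn Y F₀ c' := by
    intro X X' X'' f g hX hX' hX''
    have e1 := hc f g hX hX' hX''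
    have e2 : ∑ i, a i * wind i (Arrow.mk (f ≫ g)) = ∑ i, a i * wind i (Arrow.mk f)
        + ∑ i, a i * wind i (Arrow.mk g) := by
      rw [← Finset.sum_add_distrib]
      exact Finset.sum_congr rfl fun i _ => by rw [wind_comp, mul_add]
    simp only [hc'def]
    rw [e1, e2]
    ring
  have hnw : A.HasNoWinding Y F₀ c' := by
    intro F hF i hi h0 C C' hC hC' hadj D D' hD hD'
    have e1 := hw i h0 F hF hi C C' hC hC' hadj D D' hD hD'
    have e2 : quadVal c' F C C' D D'
        = quadVal c F C C' D D' - ∑ j, a j * quadVal (wind j) F C C' D D' := by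
      simp only [quadVal, coneVal, hc'def, fibVal_sub_sum, mul_sub, Finset.sum_sub_distrib]
      ring
    rw [e2, e1]
    simp only [quadVal_wind hi hadj hD hD', mul_ite, mul_zero, Finset.sum_ite_eq',
      Finset.mem_univ, if_true, ha]
    ring
  obtain ⟨l, u, hu⟩ := hc'.exists_of_noWinding hA hnw
  refine ⟨a, l, u, fun i hi => hw0 i (fun h => hi (by simp [ha, h])), ?_⟩
  intro X X' f hX hX'
  have := hu f hX hX'
  simp only [hc'def] at this
  linarith

end Strata

end ToricArrangement

namespace ToricArrangement

variable {ι : Type} {d : ℕ} {A : ToricArrangement ι d}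

open Topology Filter

/-! ### Galleries -/

lemma LFace.hull_le_ker {s : Set ι} {G : A.LFace s} {i : s} (h : G.sg i = 0) :
    G.hull ≤ LinearMap.ker (A.ev i) := by
  refine Submodule.span_le.2 fun u hu => ?_
  exact sign_eq_zero_iff.1 ((hu i).symm.trans h)

lemma LFace.sg_eq_zero_of_hull_le {s : Set ι} {G : A.LFace s} {i : s}
    (h : G.hull ≤ LinearMap.ker (A.ev i)) : G.sg i = 0 := by
  obtain ⟨u, hu⟩ := G.realized
  rw [hu i]
  exact sign_eq_zero_iff.2 (h (Submodule.subset_span hu))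

/-- A face is relatively open: a small multiple of such a `w`, added to a point of the face, stays
in it, so `w` is a multiple of a difference of two points of the face. -/
lemma LFace.mem_hull_iff [Finite ι] {s : Set ι} {G : A.LFace s} {w : Fin d → ℝ} :
    w ∈ G.hull ↔ ∀ i, G.sg i = 0 → A.ev i w = 0 := by
  refine ⟨fun h i hi => LFace.hull_le_ker hi h, fun h => ?_⟩
  obtain ⟨u, hu⟩ := G.realized
  have hcont : Tendsto (fun t : ℝ => u + t • w) (𝓝[>] 0) (𝓝 u) := by
    have : Continuous fun t : ℝ => u + t • w := by fun_prop
    have h2 := this.tendsto 0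
    rw [zero_smul, add_zero] at h2
    exact h2.mono_left nhdsWithin_le_nhds
  obtain ⟨t, ht, ht0⟩ := ((hcont.eventually (eventually_faceOf_le s u)).and
    self_mem_nhdsWithin).exists
  have hmem : u + t • w ∈ G.carrier := by
    intro i
    rcases ht i with h1 | h1
    · change SignType.sign (A.ev i u) = 0 at h1
      have h2 : G.sg i = 0 := (hu i).trans h1
      rw [h2, map_add, map_smul, h i h2, sign_eq_zero_iff.1 h1]
      simp
    · exact (hu i).trans h1
  have h3 : w = t⁻¹ • ((u + t • w) - u) := by
    rw [add_sub_cancel_left, smul_smul, inv_mul_cancel₀ (ne_of_gt ht0), one_smul]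
  rw [h3]
  exact Submodule.smul_mem _ _ (Submodule.sub_mem _ (Submodule.subset_span hmem)
    (Submodule.subset_span hu))

lemma LFace.hull_eq_ker [Finite ι] {s : Set ι} {G : A.LFace s} {i : s} (hi : G.sg i = 0)
    (h : ∀ j, G.sg j = 0 → LinearMap.ker (A.ev j) = LinearMap.ker (A.ev i)) :
    G.hull = LinearMap.ker (A.ev i) := by
  refine le_antisymm (LFace.hull_le_ker hi) fun w hw => LFace.mem_hull_iff.2 fun j hj => ?_
  rw [← h j hj] at hw
  exact hw

lemma hull_eq_ker_of_codim {G : A.LFace Set.univ} (hG : Module.finrank ℝ G.hull + 1 = d)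
    {i : ι} (hi : G.sg ⟨i, trivial⟩ = 0) : G.hull = LinearMap.ker (A.ev i) := by
  have h0 : G.hull ≤ LinearMap.ker (A.ev i) :=
    LFace.hull_le_ker (i := (⟨i, trivial⟩ : (Set.univ : Set ι))) hi
  refine Submodule.eq_of_le_of_finrank_eq h0 ?_
  have := finrank_ker_ev (A := A) i
  omega

/-- Parallel hyperplanes separate the same chambers. -/
lemma ne_of_ker_eq {C E : A.Chamber Set.univ} {i j : ι}
    (hij : LinearMap.ker (A.ev i) = LinearMap.ker (A.ev j)) (h : E.at i ≠ C.at i) :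
    E.at j ≠ C.at j := by
  obtain ⟨v, hv⟩ := exists_ev_eq_one A i
  have hprop : ∀ u, A.ev j u = A.ev j (lat v) * A.ev i u := by
    intro u
    have h0 : u - A.ev i u • lat v ∈ LinearMap.ker (A.ev i) := by
      rw [LinearMap.mem_ker, map_sub, map_smul, hv, smul_eq_mul, mul_one, sub_self]
    rw [hij, LinearMap.mem_ker, map_sub, map_smul, smul_eq_mul, sub_eq_zero] at h0
    rw [h0, mul_comm]
  obtain ⟨x, hx⟩ := C.realized
  obtain ⟨y, hy⟩ := E.realized
  have sg : ∀ (D : A.Chamber Set.univ) (z : Fin d → ℝ),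
      (∀ k : (Set.univ : Set ι), D.sg k = SignType.sign (A.ev k z)) →
      D.at j = SignType.sign (A.ev j (lat v)) * D.at i := by
    intro D z hz
    rw [Chamber.at, Chamber.at, hz, hz, ← sign_mul, ← hprop]
  have h0 := C.ne_zero ⟨j, trivial⟩
  change C.at j ≠ 0 at h0
  rw [sg C x hx] at h0 ⊢
  rw [sg E y hy]
  intro h'
  exact h (mul_left_cancel₀ (left_ne_zero_of_mul h0) h')

namespace Gallery

/-- A gallery extended by one chamber. -/
def cons (g : Gallery A) (C : A.Chamber Set.univ) (W : A.LFace Set.univ)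
    (hW : Module.finrank ℝ W.hull + 1 = d) (h : W ≤ C.toLFace) (h' : W ≤ (g.chm 0).toLFace) :
    Gallery A where
  len := g.len + 1
  chm := Fin.cons C g.chm
  wall := Fin.cons W g.wall
  codim j := by
    refine Fin.cases ?_ (fun j => ?_) j
    · exact hW
    · exact g.codim j
  le_left j := by
    refine Fin.cases ?_ (fun j => ?_) j
    · exact h
    · exact g.le_left j
  le_right j := by
    refine Fin.cases ?_ (fun j => ?_) j
    · exact h'
    · exact g.le_right j

variable [Finite ι]

/-- The bound counts distinct linear hyperplanes and not indices: parallel hypertori share a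
hyperplane and are crossed together at one wall. Each step to an adjacent chamber on the way removes
one hyperplane. -/
lemma exists_short (C C' : A.Chamber Set.univ) : ∃ g : Gallery A, g.chm 0 = C ∧
    g.chm (Fin.last g.len) = C' ∧
    g.len ≤ ((fun i : (Set.univ : Set ι) => LinearMap.ker (A.ev i)) '' diffSet C C').ncard := by
  suffices H : ∀ n, ∀ C : A.Chamber Set.univ,
      ((fun i : (Set.univ : Set ι) => LinearMap.ker (A.ev i)) '' diffSet C C').ncard = n →
      ∃ g : Gallery A, g.chm 0 = C ∧ g.chm (Fin.last g.len) = C' ∧ g.len ≤ n from H _ C rfl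
  intro n
  induction n using Nat.strong_induction_on with
  | _ n ih =>
    intro C hn
    by_cases hC : C' = C
    · subst hC
      exact ⟨⟨0, fun _ => C', Fin.elim0, fun j => j.elim0, fun j => j.elim0, fun j => j.elim0⟩,
        rfl, rfl, Nat.zero_le _⟩
    obtain ⟨E, hE, hsub, hpar, G, hG, hGC, hGE⟩ := exists_adjacent_chamber hC
    obtain ⟨i, hi⟩ := diffSet_nonempty hE
    have hcodim : Module.finrank ℝ G.hull + 1 = d := by
      rw [LFace.hull_eq_ker ((hG i).2 hi) fun j hj => hpar j ((hG j).1 hj) i hi]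
      exact finrank_ker_ev _
    have hlt : ((fun i : (Set.univ : Set ι) => LinearMap.ker (A.ev i)) '' diffSet E C').ncard < n := by
      rw [← hn]
      refine Set.ncard_lt_ncard ?_ (Set.toFinite _)
      have hdiff : diffSet E C' ⊆ diffSet C C' := by
        intro j hj hjC
        by_cases hjE : j ∈ diffSet C E
        · exact hsub hjE hjC
        · exact hj (hjC.trans (not_not.1 hjE).symm)
      refine ⟨Set.image_mono hdiff, fun hss => ?_⟩
      obtain ⟨j, hj, hji⟩ := hss ⟨i, hsub hi, rfl⟩
      have h1 : E.at j ≠ C.at j := ne_of_ker_eq hji.symm hi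
      exact hj (eq_of_ne_of_ne (C.ne_zero j) (C'.ne_zero j) (E.ne_zero j) (hdiff hj).symm h1.symm)
    obtain ⟨g, h0, h1, h2⟩ := ih _ hlt E rfl
    refine ⟨g.cons C G hcodim hGC (h0 ▸ hGE), rfl, h1, ?_⟩
    change g.len + 1 ≤ n
    omega

variable (g : Gallery A)

lemma step_eq {i : ι} (j : Fin g.len) (h : (g.wall j).sg ⟨i, trivial⟩ ≠ 0) :
    (g.chm j.succ).at i = (g.chm j.castSucc).at i :=
  (((g.le_right j) _).resolve_left h).symm.trans (((g.le_left j) _).resolve_left h)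

lemma sign_eq_first {i : ι} {l : Fin (g.len + 1)}
    (h : ∀ j : Fin g.len, j.castSucc < l → (g.wall j).sg ⟨i, trivial⟩ ≠ 0) :
    (g.chm l).at i = (g.chm 0).at i := by
  induction l using Fin.induction with
  | zero => rfl
  | succ l ih =>
    rw [g.step_eq l (h l Fin.castSucc_lt_succ)]
    exact ih fun j hj => h j (hj.trans Fin.castSucc_lt_succ)

lemma sign_eq_last {i : ι} {l : Fin (g.len + 1)}
    (h : ∀ j : Fin g.len, l ≤ j.castSucc → (g.wall j).sg ⟨i, trivial⟩ ≠ 0) :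
    (g.chm l).at i = (g.chm (Fin.last g.len)).at i := by
  induction l using Fin.reverseInduction with
  | last => rfl
  | cast l ih =>
    rw [← g.step_eq l (h l le_rfl)]
    exact ih fun j hj => h j (Fin.castSucc_lt_succ.le.trans hj)

lemma exists_wall {i : ι} (h : (g.chm (Fin.last g.len)).at i ≠ (g.chm 0).at i) :
    ∃ j, (g.wall j).sg ⟨i, trivial⟩ = 0 := by
  by_contra! hc
  exact h (g.sign_eq_first fun j _ => hc j)

end Gallery

namespace LineGallery

variable [Finite ι] {M : A.Line} (g : A.LineGallery M)

/-- A hypertorus is transverse to `M` if its linear hyperplane does not contain `X_M`. -/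
abbrev _root_.ToricArrangement.Transverse (M : A.Line) (i : ι) : Prop :=
  ¬ A.dirSpace M.1.1 ≤ LinearMap.ker (A.ev i)

lemma mem_diffSet_iff {i : (Set.univ : Set ι)} :
    i ∈ diffSet (g.chm 0) (g.chm (Fin.last g.len)) ↔ Transverse M i := by
  have h0 := (g.chm 0).ne_zero i
  change (g.chm (Fin.last g.len)).sg i ≠ (g.chm 0).sg i ↔ _
  rw [g.final i]
  split_ifs with h
  · simp [Transverse, h]
  · have : ∀ σ : SignType, σ ≠ 0 → -σ ≠ σ := by decide
    simp [Transverse, h, this _ h0]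

/-- The gallery must cross every hyperplane separating its ends, and by minimality and
`exists_short` it has no more steps than there are such hyperplanes. So its walls span exactly
these, the hyperplanes transverse to `M`, each once. -/
lemma wall_injective_and_transverse : Function.Injective (fun j => (g.wall j).hull) ∧
    ∀ j, ∃ i, Transverse M i ∧ (g.wall j).hull = LinearMap.ker (A.ev i) := by
  classical
  set f : ↥(Set.univ : Set ι) → Submodule ℝ (Fin d → ℝ) := fun i => LinearMap.ker (A.ev i)
  set D := diffSet (g.chm 0) (g.chm (Fin.last g.len)) with hD
  obtain ⟨g', h0, h1, h2⟩ := Gallery.exists_short (g.chm 0) (g.chm (Fin.last g.len))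
  have hmin := (g.minimal g' h0 h1).trans h2
  have hsub : f '' D ⊆ Set.range (fun j => (g.wall j).hull) := by
    rintro _ ⟨i, hi, rfl⟩
    obtain ⟨j, hj⟩ := g.exists_wall (i := i.1) hi
    exact ⟨j, hull_eq_ker_of_codim (g.codim j) hj⟩
  have hle : (Set.range (fun j => (g.wall j).hull)).ncard ≤ g.len := by
    rw [← Set.image_univ]
    refine (Set.ncard_image_le (Set.toFinite _)).trans ?_
    rw [Set.ncard_univ, Nat.card_eq_fintype_card, Fintype.card_fin]
  have heq := Set.eq_of_subset_of_ncard_le hsub (hle.trans hmin) (Set.toFinite _)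
  constructor
  · have hc : (Set.range (fun j => (g.wall j).hull)).ncard = g.len :=
      le_antisymm hle (heq ▸ hmin)
    rw [← Set.image_univ] at hc
    have := Set.injOn_of_ncard_image_eq (f := fun j => (g.wall j).hull) (s := Set.univ) (by
      rw [hc, Set.ncard_univ, Nat.card_eq_fintype_card, Fintype.card_fin]) (Set.toFinite _)
    exact Set.injOn_univ.1 this
  · intro j
    have : (g.wall j).hull ∈ f '' D := heq ▸ ⟨j, rfl⟩
    obtain ⟨i, hi, hij⟩ := this
    exact ⟨i.1, g.mem_diffSet_iff.1 hi, hij.symm⟩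

lemma wall_unique {i : ι} {j j' : Fin g.len} (h : (g.wall j).sg ⟨i, trivial⟩ = 0)
    (h' : (g.wall j').sg ⟨i, trivial⟩ = 0) : j = j' :=
  g.wall_injective_and_transverse.1 ((hull_eq_ker_of_codim (g.codim j) h).trans
    (hull_eq_ker_of_codim (g.codim j') h').symm)

lemma transverse_of_wall {i : ι} {j : Fin g.len} (h : (g.wall j).sg ⟨i, trivial⟩ = 0) :
    Transverse M i := by
  obtain ⟨i', hi', he⟩ := g.wall_injective_and_transverse.2 j
  rw [Transverse, ← hull_eq_ker_of_codim (g.codim j) h, he]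
  exact hi'

lemma exists_wall_of_transverse {i : ι} (h : Transverse M i) :
    ∃ j, (g.wall j).sg ⟨i, trivial⟩ = 0 :=
  g.exists_wall (g.mem_diffSet_iff (i := ⟨i, trivial⟩).2 h)

lemma chm_of_not_transverse {i : ι} (h : ¬ Transverse M i) (l : Fin (g.len + 1)) :
    (g.chm l).at i = (g.chm 0).at i :=
  g.sign_eq_first fun _ _ h0 => h (g.transverse_of_wall h0)

lemma chm_of_le {i : ι} {j : Fin g.len} (h : (g.wall j).sg ⟨i, trivial⟩ = 0)
    {l : Fin (g.len + 1)} (hl : l ≤ j.castSucc) : (g.chm l).at i = (g.chm 0).at i :=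
  g.sign_eq_first fun j' hj' h' => by
    rw [g.wall_unique h' h] at hj'
    exact absurd hj' (not_lt.2 hl)

lemma chm_of_gt {i : ι} {j : Fin g.len} (h : (g.wall j).sg ⟨i, trivial⟩ = 0)
    {l : Fin (g.len + 1)} (hl : j.castSucc < l) : (g.chm l).at i = -(g.chm 0).at i := by
  have h1 : (g.chm l).at i = (g.chm (Fin.last g.len)).at i :=
    g.sign_eq_last fun j' hj' h' => by
      rw [g.wall_unique h' h] at hj'
      exact absurd hl (not_lt.2 hj')
  rw [h1]
  exact (g.final ⟨i, trivial⟩).trans (if_neg (g.transverse_of_wall h))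

lemma chm_last {i : ι} (h : Transverse M i) :
    (g.chm (Fin.last g.len)).at i = -(g.chm 0).at i :=
  (g.final ⟨i, trivial⟩).trans (if_neg h)

/-- A wall that is crossed vanishes somewhere in the local arrangement. -/
lemma crosses_iff {P : A.Face} {j : Fin g.len} :
    g.Crosses P j ↔ ∃ i ∈ A.loc P, (g.wall j).sg ⟨i, trivial⟩ = 0 := by
  constructor
  · intro h
    by_contra! hc
    exact h (Chamber.ext_sg fun i => (g.step_eq j (hc i i.2)).symm)
  · rintro ⟨i, hi, h0⟩ he
    have h1 : (g.chm j.castSucc).at i = (g.chm j.succ).at i :=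
      congrArg (fun C : A.Chamber (A.loc P) => C.sg ⟨i, hi⟩) he
    rw [g.chm_of_le h0 le_rfl, g.chm_of_gt h0 Fin.castSucc_lt_succ] at h1
    have : ∀ σ : SignType, σ ≠ 0 → σ ≠ -σ := by decide
    exact this _ ((g.chm 0).ne_zero _) h1

end LineGallery

end ToricArrangement

namespace ToricArrangement

variable {ι : Type} {d : ℕ} {A : ToricArrangement ι d}

open Topology Filter

/-! ### The faces of a one-dimensional layer -/

section LineGeometry

variable {M : A.Line} {ρ : Fin d → ℝ}

lemma exists_eq_smul (hρ : ρ ∈ A.dirSpace M.1.1) (h0 : ρ ≠ 0) {v : Fin d → ℝ}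
    (hv : v ∈ A.dirSpace M.1.1) : ∃ s : ℝ, v = s • ρ := by
  have h1 : Module.finrank ℝ (A.dirSpace M.1.1) = 1 := M.2
  obtain ⟨s, hs⟩ := (finrank_eq_one_iff_of_nonzero' (⟨ρ, hρ⟩ : A.dirSpace M.1.1)
    (fun h => h0 (congrArg Subtype.val h))).1 h1 ⟨v, hv⟩
  exact ⟨s, (congrArg Subtype.val hs).symm⟩

lemma transverse_iff (hρ : ρ ∈ A.dirSpace M.1.1) (h0 : ρ ≠ 0) {i : ι} :
    Transverse M i ↔ A.ev i ρ ≠ 0 := by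
  refine not_congr ⟨fun h => h hρ, fun h v hv => ?_⟩
  obtain ⟨s, rfl⟩ := exists_eq_smul hρ h0 hv
  rw [LinearMap.mem_ker, map_smul, h, smul_zero]

lemma exists_transverse (hA : A.Essential) (M : A.Line) : ∃ i, Transverse M i := by
  have h1 : Module.finrank ℝ (A.dirSpace M.1.1) = 1 := M.2
  obtain ⟨v, hv, hv0⟩ := (Submodule.ne_bot_iff _).1 (fun h : A.dirSpace M.1.1 = ⊥ => by
    rw [h, finrank_bot] at h1
    exact zero_ne_one h1)
  by_contra hc
  exact hv0 (hA v fun i => not_not.1 (mt (transverse_iff hv hv0).2 (not_exists.1 hc i)))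

lemma transverse_iff_of_mem_loc {F : A.Face} (hF : F.pts ⊆ M.1.1) {i : ι} (hi : i ∈ A.loc F) :
    Transverse M i ↔ i ∉ A.above M.1.1 := by
  refine not_congr ⟨fun h => ?_, fun h => iInf₂_le i h⟩
  exact mem_above_layer M.1 h (hF F.rep_mem) (hi F.rep_mem)

lemma not_transverse_of_mem_above {i : ι} (h : i ∈ A.above M.1.1) : ¬ Transverse M i :=
  not_not.2 (iInf₂_le i h)

lemma above_subset_loc {L : A.Layer} {F : A.Face} (hF : F.pts ⊆ L.1) : A.above L.1 ⊆ A.loc F :=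
  fun _ hi => hF.trans hi

lemma dirSpace_le {F : A.Face} {L : A.Layer} (hF : F.pts ⊆ L.1) :
    A.dirSpace F.pts ≤ A.dirSpace L.1 := by
  intro v hv
  rw [mem_dirSpace] at hv ⊢
  exact fun i hi => hv i (above_subset_loc hF hi)

lemma dim_eq_one {F : A.Face} (hF : F.pts ⊆ M.1.1) (h : ∀ i ∈ A.loc F, ¬ Transverse M i) :
    A.dim F.pts = 1 := by
  have : A.dirSpace F.pts = A.dirSpace M.1.1 := by
    refine le_antisymm (dirSpace_le hF) fun v hv => mem_dirSpace.2 fun i hi => ?_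
    exact not_not.1 (h i hi) hv
  rw [dim, this]
  exact M.2

lemma dim_eq_zero {F : A.Face} (hF : F.pts ⊆ M.1.1) {i : ι} (hi : i ∈ A.loc F)
    (h : Transverse M i) : A.dim F.pts = 0 := by
  have hlt : A.dirSpace F.pts < A.dirSpace M.1.1 := by
    refine lt_of_le_of_ne (dirSpace_le hF) fun he => h ?_
    rw [← he]
    exact iInf₂_le i hi
  have h1 := Submodule.finrank_lt_finrank_of_lt hlt
  have h2 : Module.finrank ℝ (A.dirSpace M.1.1) = 1 := M.2
  rw [h2] at h1
  exact Nat.lt_one_iff.1 h1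

lemma not_transverse_of_dim_eq_one {F : A.Face} (hF : F.pts ⊆ M.1.1) (h : A.dim F.pts = 1)
    {i : ι} (hi : i ∈ A.loc F) : ¬ Transverse M i := fun hc => by
  rw [dim_eq_zero hF hi hc] at h
  exact zero_ne_one h

lemma exists_transverse_of_dim_eq_zero {F : A.Face} (hF : F.pts ⊆ M.1.1) (h : A.dim F.pts = 0) :
    ∃ i ∈ A.loc F, Transverse M i := by
  by_contra hc
  rw [dim_eq_one hF fun i hi ht => hc ⟨i, hi, ht⟩] at h
  exact one_ne_zero h

lemma dirVec_mem {F G : A.Face} (hF : F.pts ⊆ M.1.1) (hG : G.pts ⊆ M.1.1) (m : F ⟶ G) :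
    dirVec m ∈ A.dirSpace M.1.1 :=
  mem_dirSpace.2 fun _ hi => (germ_eq_zero_iff m (above_subset_loc hF hi)).2 (above_subset_loc hG hi)

/-- A morphism of faces of a line that points in the direction of `ρ`. -/
def PointsTo (ρ : Fin d → ℝ) {P G : A.Face} (m : P ⟶ G) : Prop := ∃ s : ℝ, 0 < s ∧ dirVec m = s • ρ

lemma PointsTo.add {P G : A.Face} {m : P ⟶ G} {s : ℝ} (h : dirVec m = s • ρ) :
    G.rep + lat m.1 = P.rep + s • ρ := by
  rw [← h, dirVec]
  abel

lemma pos_of_sign_eq {i : ι} {s : ℝ} (h0 : A.ev i ρ ≠ 0)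
    (h : SignType.sign (A.ev i (s • ρ)) = SignType.sign (A.ev i ρ)) : 0 < s := by
  rw [map_smul, smul_eq_mul, sign_mul] at h
  have h2 := sign_ne_zero.2 h0
  have : ∀ σ τ : SignType, τ ≠ 0 → σ * τ = τ → σ = 1 := by decide
  exact sign_eq_one_iff.1 (this _ _ h2 h)

lemma PointsTo.sign {P G : A.Face} {m : P ⟶ G} (h : PointsTo ρ m) (i : ι) :
    SignType.sign (A.ev i (dirVec m)) = SignType.sign (A.ev i ρ) := by
  obtain ⟨s, hs, h⟩ := h
  rw [h, map_smul, smul_eq_mul, sign_mul, sign_pos hs, one_mul]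

lemma pointsTo_or (hρ : ρ ∈ A.dirSpace M.1.1) (h0 : ρ ≠ 0) {P G : A.Face} (hP : P.pts ⊆ M.1.1)
    (hG : G.pts ⊆ M.1.1) (hP0 : A.dim P.pts = 0) (hG1 : A.dim G.pts = 1) (m : P ⟶ G) :
    PointsTo ρ m ∨ PointsTo (-ρ) m := by
  obtain ⟨s, hs⟩ := exists_eq_smul hρ h0 (dirVec_mem hP hG m)
  obtain ⟨i, hi, hti⟩ := exists_transverse_of_dim_eq_zero hP hP0
  have hs0 : s ≠ 0 := by
    rintro rfl
    rw [zero_smul] at hs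
    refine not_transverse_of_dim_eq_one hG hG1 ((germ_eq_zero_iff m hi).1 ?_) hti
    rw [hs, map_zero]
  rcases lt_or_gt_of_ne hs0 with h | h
  · exact Or.inr ⟨-s, neg_pos.2 h, by rw [hs, neg_smul_neg]⟩
  · exact Or.inl ⟨s, h, hs⟩

lemma face_eq_of_sgn_eq (hA : A.Essential) {F G : A.Face} {v w : Fin d → ℤ}
    (h : ∀ i n, A.sgn (F.rep + lat v) i n = A.sgn (G.rep + lat w) i n) : F = G ∧ v = w := by
  obtain ⟨h1, h2⟩ := mk_eq_and_tr_eq hA h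
  obtain ⟨h3, h4⟩ := mk_eq_and_tr_eq hA (F := G) (v := w) (x := G.rep + lat w) fun _ _ => rfl
  exact ⟨h1.symm.trans h3, h2.symm.trans h4⟩

/-- Both targets contain a point of the same open ray from `P`. The nearer point lies on the segment
from `P` to the farther one, hence in the same lifted face. -/
lemma PointsTo.unique (hA : A.Essential) {P G G' : A.Face} {m : P ⟶ G} {m' : P ⟶ G'}
    (h : PointsTo ρ m) (h' : PointsTo ρ m') : G = G' ∧ m.1 = m'.1 := by
  obtain ⟨s, hs, h⟩ := h
  obtain ⟨s', hs', h'⟩ := h'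
  wlog hle : s ≤ s' generalizing s s' G G'
  · obtain ⟨h1, h2⟩ := this s' hs' h' s hs h (not_le.1 hle).le
    exact ⟨h1.symm, h2.symm⟩
  refine face_eq_of_sgn_eq hA fun i n => ?_
  have e : G.rep + lat m.1 = P.rep + (s / s') • ((G'.rep + lat m'.1) - P.rep) := by
    rw [PointsTo.add h, PointsTo.add h', add_sub_cancel_left, smul_smul, div_mul_cancel₀ _ hs'.ne']
  rw [e]
  exact m'.2.sgn_segment (div_pos hs hs') ((div_le_one hs').2 hle) i n

/-- Otherwise the nearer of the two starting points would lie strictly between the farther one and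
`G`, on a segment that belongs to the lifted face `G`. -/
lemma PointsTo.unique_left (hA : A.Essential) {P P' G : A.Face} {m : P ⟶ G} {m' : P' ⟶ G}
    (h : PointsTo ρ m) (h' : PointsTo ρ m') (hPG : P ≠ G) (hPG' : P' ≠ G) : P = P' := by
  obtain ⟨s, hs, h⟩ := h
  obtain ⟨s', hs', h'⟩ := h'
  wlog hle : s ≤ s' generalizing s s' P P'
  · exact (this hPG' hPG s' hs' h' s hs h (not_le.1 hle).le).symm
  have e1 : P.rep + lat (-m.1) = G.rep - s • ρ := by
    rw [lat_neg, eq_sub_iff_add_eq, add_right_comm, ← PointsTo.add h]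
    abel
  have e2 : P'.rep + lat (-m'.1) = G.rep - s' • ρ := by
    rw [lat_neg, eq_sub_iff_add_eq, add_right_comm, ← PointsTo.add h']
    abel
  rcases hle.eq_or_lt with rfl | hlt
  · exact (face_eq_of_sgn_eq hA fun i n => by rw [e1, e2]).1
  · exfalso
    have hle' : A.FaceLE (P'.rep + lat (-m'.1)) G.rep := by
      have := m'.2.add_lat (-m'.1)
      rwa [add_assoc, ← lat_add, add_neg_cancel, lat_zero, add_zero] at this
    refine hPG (face_eq_of_sgn_eq hA (v := -m.1) (w := 0) fun i n => ?_).1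
    rw [lat_zero, add_zero]
    have e : P.rep + lat (-m.1) = (P'.rep + lat (-m'.1))
        + ((s' - s) / s') • (G.rep - (P'.rep + lat (-m'.1))) := by
      rw [e1, e2, sub_sub_cancel, smul_smul, div_mul_cancel₀ _ hs'.ne', sub_smul]
      abel
    rw [e]
    exact hle'.sgn_segment (div_pos (by linarith) hs') ((div_le_one hs').2 (by linarith)) i n

variable [Finite ι]

/-- The morphism of faces obtained by moving slightly in a given direction. -/
lemma exists_hom_toward (P : A.Face) (u : Fin d → ℝ) : ∃ (t : ℝ) (G : A.Face) (m : P ⟶ G),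
    (∀ i n, A.sgn (G.rep + lat m.1) i n = A.sgn (P.rep + t • u) i n) ∧
    ∀ i ∈ A.loc P, SignType.sign (A.ev i (dirVec m)) = SignType.sign (A.ev i u) := by
  have hcont : Tendsto (fun t : ℝ => P.rep + t • u) (𝓝[>] 0) (𝓝 P.rep) := by
    have : Continuous fun t : ℝ => P.rep + t • u := by fun_prop
    have h2 := this.tendsto 0
    rw [zero_smul, add_zero] at h2
    exact h2.mono_left nhdsWithin_le_nhds
  obtain ⟨t, ht, ht0⟩ := ((hcont.eventually (eventually_faceLE (A := A) P.rep)).and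
    self_mem_nhdsWithin).exists
  have ht0 : 0 < t := ht0
  refine ⟨t, Face.mk (P.rep + t • u), ⟨A.tr (P.rep + t • u),
    ht.trans (faceLE_of_sgn_eq fun i n => (sgn_rep_add_tr _ i n).symm)⟩, sgn_rep_add_tr _, ?_⟩
  intro i hi
  obtain ⟨n, hn⟩ := exists_sgn hi
  rw [sign_dirVec _ hn, sgn_rep_add_tr]
  unfold sgn at hn ⊢
  rw [sign_eq_zero_iff] at hn
  rw [map_add, map_smul, smul_eq_mul,
    show A.ev i P.rep + t * A.ev i u - A.shift i - n = t * A.ev i u by linarith, sign_mul,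
    sign_pos ht0, one_mul]

lemma exists_next (hρ : ρ ∈ A.dirSpace M.1.1) (h0 : ρ ≠ 0) {P : A.Face} (hP : P.pts ⊆ M.1.1)
    (hP0 : A.dim P.pts = 0) :
    ∃ (G : A.Face) (m : P ⟶ G), G.pts ⊆ M.1.1 ∧ A.dim G.pts = 1 ∧ PointsTo ρ m := by
  obtain ⟨t, G, m, hsgn, hsign⟩ := exists_hom_toward P ρ
  have hG : G.pts ⊆ M.1.1 := by
    rw [pts_subset_layer_iff G.rep_mem, ← layer_add_lat M.1 G.rep m.1,
      mem_layer_iff_of_sgn_eq M.1 hsgn]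
    exact layer_add_dirSpace M.1 (hP P.rep_mem) (Submodule.smul_mem _ _ hρ)
  refine ⟨G, m, hG, dim_eq_one hG fun i hi => ?_, ?_⟩
  · have hiP := loc_mono m hi
    rw [transverse_iff hρ h0, not_not, ← sign_eq_zero_iff, ← hsign i hiP, sign_eq_zero_iff]
    exact (germ_eq_zero_iff m hiP).2 hi
  · obtain ⟨s, hs⟩ := exists_eq_smul hρ h0 (dirVec_mem hP hG m)
    obtain ⟨i, hi, hti⟩ := exists_transverse_of_dim_eq_zero hP hP0
    refine ⟨s, ?_, hs⟩
    have := hsign i hi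
    rw [hs] at this
    exact pos_of_sign_eq ((transverse_iff hρ h0).1 hti) this

/-- Walk backwards along `ρ`. If no transverse hypertorus were reached in the closure of `G`, the
whole ray would stay in one lifted face, although some transverse form is unbounded on it and takes
values on both sides of an integer level. Essentiality provides the transverse hypertorus. -/
lemma exists_prev (hA : A.Essential) (hρ : ρ ∈ A.dirSpace M.1.1) (h0 : ρ ≠ 0) {G : A.Face}
    (hG : G.pts ⊆ M.1.1) (hG1 : A.dim G.pts = 1) :
    ∃ (P : A.Face) (m : P ⟶ G), P.pts ⊆ M.1.1 ∧ A.dim P.pts = 0 ∧ PointsTo ρ m := by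
  set x := G.rep with hx
  -- a point of the ray that lies in the closure of the face and on a transverse hypertorus
  obtain ⟨t, ht, i, hti, hpi, hle⟩ : ∃ t : ℝ, 0 ≤ t ∧ ∃ i, Transverse M i ∧
      x - t • ρ ∈ A.hyp i ∧ A.FaceLE (x - t • ρ) x := by
    by_contra! hc
    set K : Set (Fin d → ℝ) := (fun t : ℝ => x - t • ρ) '' Set.Ici 0 with hK
    have hKc : Convex ℝ K := by
      rintro _ ⟨s, hs, rfl⟩ _ ⟨t, ht, rfl⟩ a b ha hb hab
      refine ⟨a * s + b * t, add_nonneg (mul_nonneg ha hs) (mul_nonneg hb ht), ?_⟩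
      have : x = a • x + b • x := by rw [← add_smul, hab, one_smul]
      simp only [smul_sub, add_smul, mul_smul]
      nth_rewrite 1 [this]
      abel
    have hpar : ∀ p ∈ K, ∀ q ∈ K, ∀ i, ¬ Transverse M i → A.ev i p = A.ev i q := by
      rintro _ ⟨s, hs, rfl⟩ _ ⟨t, ht, rfl⟩ i hi
      have := not_not.1 (mt (transverse_iff hρ h0).2 hi)
      simp [this]
    have hxK : x ∈ K := ⟨0, Set.mem_Ici.2 le_rfl, by simp⟩
    have hxt : ∀ p ∈ K, A.FaceLE p x → ∀ i, Transverse M i → ∀ n, A.sgn p i n ≠ 0 := by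
      rintro _ ⟨t, ht, rfl⟩ hp i hi n hn
      exact hc t ht i hi ((mem_hyp_iff _ _).2 ⟨n, hn⟩) hp
    have hsgn : ∀ p ∈ K, ∀ q ∈ K, ∀ i, ¬ Transverse M i → ∀ n, A.sgn p i n = A.sgn q i n := by
      intro p hp q hq i hi n
      unfold sgn
      rw [hpar p hp q hq i hi]
    have hall := fun p hp => eq_of_faceLE_invariant (A := A) hKc
      (fun p => (∀ i n, A.sgn p i n = A.sgn x i n)) (fun p hp q hq hpq => by
        refine propext ⟨fun h i n => ?_, fun h i n => ?_⟩
        · by_cases hi : Transverse M i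
          · rcases hpq i n with h1 | h1
            · exact absurd h1 (hxt p hp (faceLE_of_sgn_eq h) i hi n)
            · rw [← h1, h]
          · exact hsgn q hq x hxK i hi n
        · by_cases hi : Transverse M i
          · rcases hpq i n with h1 | h1
            · exact absurd h1 (hxt p hp (hpq.trans (faceLE_of_sgn_eq h)) i hi n)
            · rw [h1, h]
          · exact hsgn p hp x hxK i hi n) hxK (y := p) hp
    obtain ⟨i, hi⟩ := exists_transverse hA M
    have hc0 := (transverse_iff hρ h0).1 hi
    -- This point is far enough back for `ev i` to change by `2`, which passes the integer level
    -- next to `a`.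
    have hp' : ∀ i' n, A.sgn (x - (2 / |A.ev i ρ|) • ρ) i' n = A.sgn x i' n :=
      (hall (x - (2 / |A.ev i ρ|) • ρ) ⟨_, Set.mem_Ici.2 (by positivity), rfl⟩).mp fun _ _ => rfl
    set a := A.ev i x - A.shift i with ha
    have hval : ∀ n : ℤ, SignType.sign (a - 2 / |A.ev i ρ| * A.ev i ρ - n)
        = SignType.sign (a - n) := by
      intro n
      have := hp' i n
      unfold sgn at this
      rw [(A.ev i).map_sub, (A.ev i).map_smul, smul_eq_mul, sub_right_comm (A.ev i x), ← ha] at this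
      exact this
    rcases lt_or_gt_of_ne hc0 with hneg | hpos
    · have h1 := hval ⌈a⌉
      rw [abs_of_neg hneg, div_neg, neg_mul, div_mul_cancel₀ _ hc0,
        sign_pos (by linarith [Int.ceil_lt_add_one a])] at h1
      have h2 := sign_eq_one_iff.1 h1.symm
      linarith [Int.le_ceil a]
    · have h1 := hval ⌊a⌋
      rw [abs_of_pos hpos, div_mul_cancel₀ _ hc0,
        sign_neg (by linarith [Int.lt_floor_add_one a])] at h1
      have h2 := sign_eq_neg_one_iff.1 h1.symm
      linarith [Int.floor_le a]
  set p := x - t • ρ with hp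
  have ht0 : 0 < t := by
    refine lt_of_le_of_ne ht fun h => ?_
    rw [hp, ← h, zero_smul, sub_zero] at hpi
    exact not_transverse_of_dim_eq_one hG hG1 ((mem_above_iff G i).2 hpi) hti
  have hP : (Face.mk p : A.Face).pts ⊆ M.1.1 := by
    rw [mk_subset_layer_iff, hp, sub_eq_add_neg]
    exact layer_add_dirSpace M.1 (hG G.rep_mem) (Submodule.neg_mem _ (Submodule.smul_mem _ _ hρ))
  have hiP : i ∈ A.loc (Face.mk p) := mem_loc_mk.2 hpi
  have hle2 : A.FaceLE ((Face.mk p : A.Face).rep + lat (A.tr p)) G.rep :=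
    (faceLE_of_sgn_eq (sgn_rep_add_tr p)).trans hle
  let m : Face.mk p ⟶ G := ⟨-A.tr p, by
    have := hle2.add_lat (-A.tr p)
    rwa [add_assoc, ← lat_add, add_neg_cancel, lat_zero, add_zero] at this⟩
  refine ⟨Face.mk p, m, hP, dim_eq_zero hP hiP hti, ?_⟩
  obtain ⟨s, hs⟩ := exists_eq_smul hρ h0 (dirVec_mem hP hG m)
  refine ⟨s, pos_of_sign_eq ((transverse_iff hρ h0).1 hti) ?_, hs⟩
  obtain ⟨n, hn⟩ := exists_sgn hiP
  rw [← hs, sign_dirVec m hn]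
  have hn' : A.sgn p i (n + ∑ j, A.char i j * A.tr p j) = 0 := by
    rw [← sgn_rep_add_tr p, sgn_add_lat, add_sub_cancel_right, hn]
  change A.sgn (G.rep + lat (-A.tr p)) i n = _
  rw [sgn_add_lat]
  have e : n - ∑ j, A.char i j * (-A.tr p) j = n + ∑ j, A.char i j * A.tr p j := by simp
  rw [e]
  unfold sgn at hn' ⊢
  rw [sign_eq_zero_iff] at hn'
  have e2 : A.ev i G.rep = A.ev i p + t * A.ev i ρ := by
    rw [hp, map_sub, map_smul, smul_eq_mul]
    ring
  rw [e2, show A.ev i p + t * A.ev i ρ - A.shift i - (n + ∑ j, A.char i j * A.tr p j : ℤ)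
    = t * A.ev i ρ by linarith, sign_mul, sign_pos ht0, one_mul]

end LineGeometry

end ToricArrangement

namespace ToricArrangement

variable {ι : Type} {d : ℕ} {A : ToricArrangement ι d}

/-! ### The cycles `[Λ_B^M]` -/

section Endpoints

variable [Finite ι]

lemma vtx_inj {P P' : A.Face} {C C' : A.Chamber Set.univ} (h : vtx P C = vtx P' C') :
    P = P' ∧ ∀ i ∈ A.loc P, C.at i = C'.at i := by
  obtain rfl := pt_base_eq h
  refine ⟨rfl, fun i hi => ?_⟩
  exact congrArg (fun x : A.SalPos (A.loc P) => x.ch.sg ⟨i, hi⟩) (pt_injective h)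

lemma vtx_congr {P : A.Face} {C C' : A.Chamber Set.univ} (h : ∀ i ∈ A.loc P, C.at i = C'.at i) :
    vtx P C = vtx P C' := by
  have : C.restrict (A.loc P) (Set.subset_univ _) = C'.restrict (A.loc P) (Set.subset_univ _) :=
    Chamber.ext_sg fun i => h i i.2
  simp only [vtx, this]

lemma edg_inj {P P' : A.Face} {W W' : A.LFace Set.univ} {B B' : A.Chamber Set.univ}
    (h : edg P W B = edg P' W' B') :
    P = P' ∧ ∀ i (_ : i ∈ A.loc P), W.sg ⟨i, trivial⟩ = W'.sg ⟨i, trivial⟩ := by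
  obtain rfl := pt_base_eq h
  refine ⟨rfl, fun i hi => ?_⟩
  exact congrArg (fun x : A.SalPos (A.loc P) => x.face.sg ⟨i, hi⟩) (pt_injective h)

lemma vtx_ne_edg {P P' : A.Face} {W : A.LFace Set.univ} {B C : A.Chamber Set.univ}
    (hW : ∃ i ∈ A.loc P, W.sg ⟨i, trivial⟩ = 0) : vtx P' C ≠ edg P W B := by
  intro h
  obtain rfl := pt_base_eq h
  obtain ⟨i, hi, h0⟩ := hW
  have h1 : C.at i = W.sg ⟨i, trivial⟩ :=
    congrArg (fun x : A.SalPos (A.loc P') => x.face.sg ⟨i, hi⟩) (pt_injective h)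
  exact C.ne_zero _ (h1.trans h0)

lemma base_eq_zero (hA : A.Essential) {f : Arrow A.Sal}
    (h : f.left.base.unop = f.right.base.unop) : f.hom.base.unop.1 = 0 := by
  obtain ⟨X, Y, f, rfl⟩ := Arrow.mk_surjective f
  obtain ⟨F, x, rfl⟩ := exists_pt X
  obtain ⟨F', x', rfl⟩ := exists_pt Y
  obtain ⟨m, hf, rfl⟩ := exists_arr f
  have h' : F = F' := h
  subst h'
  change m.1 = 0
  rw [hom_self_eq_id hA m]
  rfl

/-- Arrows staying over one face lie over an endomorphism of it, and by essentiality this is the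
identity. -/
lemma arrow_eq_of_endpoints (hA : A.Essential) {f g : Arrow A.Sal} (hl : f.left = g.left)
    (hr : f.right = g.right) (h : f.left.base.unop = f.right.base.unop) : f = g :=
  sal_arrow_ext hl hr ((base_eq_zero hA h).trans (base_eq_zero hA (by rw [← hl, ← hr, h])).symm)

/-- The arrow `[C, C] → [W, B_W]` over `P`, for a chamber `C` adjacent to `W`. -/
noncomputable def sideArr (P : A.Face) {C : A.Chamber Set.univ} {W : A.LFace Set.univ}
    (h : W ≤ C.toLFace) (B : A.Chamber Set.univ) : vtx P C ⟶ edg P W B :=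
  fibArr ⟨fun i => h ⟨i, trivial⟩, Chamber.ext_sg fun i => if_neg (C.ne_zero _)⟩

open Classical in
/-- The arrow between vertices over `m : P ⟶ G`. -/
noncomputable def linkArr {P G : A.Face} (m : P ⟶ G) {C C' : A.Chamber Set.univ}
    (h : ∀ i ∈ A.loc P, C'.at i = if i ∈ A.loc G then C.at i else
      SignType.sign (A.ev i (dirVec m))) : vtx G C ⟶ vtx P C' :=
  arr m (by
    have : ∀ i : A.loc P, (C'.restrict (A.loc P) (Set.subset_univ _)).sg i =
        (incl m (C.restrict (A.loc G) (Set.subset_univ _)).toLFace).sg i := by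
      intro i
      refine (h i i.2).trans ?_
      split_ifs with hi
      · rw [incl_sg_of_mem m _ i hi]; rfl
      · rw [incl_sg_of_notMem m _ i hi]; rfl
    refine ⟨fun i => Or.inr (this i), Chamber.ext_sg fun i => ?_⟩
    rw [compCh_sg]
    split_ifs with h0
    · exact this i
    · rfl)

open Classical in
lemma sign_of_link {P G : A.Face} {m : P ⟶ G} {C C' : A.Chamber Set.univ}
    {f : vtx G C ⟶ vtx P C'} (hf : f.base.unop = m) {i : ι} (hi : i ∈ A.loc P) :
    C'.at i = if i ∈ A.loc G then C.at i else SignType.sign (A.ev i (dirVec m)) := by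
  obtain ⟨m', h, rfl⟩ := exists_arr (F := G) (F' := P) f
  subst hf
  have h1 : ∀ i : A.loc P, (C'.restrict (A.loc P) (Set.subset_univ _)).sg i = 0 ∨
      (C'.restrict (A.loc P) (Set.subset_univ _)).sg i =
        (incl m' (C.restrict (A.loc G) (Set.subset_univ _)).toLFace).sg i := h.1
  have h2 := (h1 ⟨i, hi⟩).resolve_left ((C'.restrict (A.loc P) (Set.subset_univ _)).ne_zero ⟨i, hi⟩)
  refine Eq.trans h2 ?_
  split_ifs with hG
  · exact incl_sg_of_mem m' _ ⟨i, hi⟩ hG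
  · exact incl_sg_of_notMem m' _ ⟨i, hi⟩ hG

open Classical in
lemma wind_sideArr (i : ι) (P : A.Face) {C : A.Chamber Set.univ} {W : A.LFace Set.univ}
    (h : W ≤ C.toLFace) (B : A.Chamber Set.univ) :
    wind i (Arrow.mk (sideArr P h B)) =
      if i ∈ A.loc P ∧ W.sg ⟨i, trivial⟩ = 0 ∧ B.at i = 1 ∧ C.at i = 1 then 1 else 0 := by
  refine (wind_arr i (𝟙 P) _).trans ?_
  by_cases hi : i ∈ A.loc P
  · rw [dif_pos hi]
    refine if_congr ?_ rfl rfl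
    rw [incl_id]
    change C.at i = 1 ∧ W.sg ⟨i, trivial⟩ = 0 ∧
      (if W.sg ⟨i, trivial⟩ = 0 then B.at i else W.sg ⟨i, trivial⟩) = 1 ↔ _
    constructor
    · rintro ⟨h1, h2, h3⟩
      rw [if_pos h2] at h3
      exact ⟨hi, h2, h3, h1⟩
    · rintro ⟨-, h2, h3, h1⟩
      rw [if_pos h2]
      exact ⟨h1, h2, h3⟩
  · rw [dif_neg hi, if_neg fun h => hi h.1]

lemma wind_linkArr (i : ι) {P G : A.Face} (m : P ⟶ G) {C C' : A.Chamber Set.univ} (h) :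
    wind i (Arrow.mk (linkArr (C := C) (C' := C') m h)) = 0 := by
  classical
  refine (wind_arr i m _).trans ?_
  split_ifs with hi h1
  · exact absurd h1.2.1 (C'.ne_zero _)
  · rfl
  · rfl

lemma shiftForm_sideArr (l : Fin d → ℚ) (P : A.Face) {C : A.Chamber Set.univ}
    {W : A.LFace Set.univ} (h : W ≤ C.toLFace) (B : A.Chamber Set.univ) :
    shiftForm l (Arrow.mk (sideArr P h B)) = 0 := by
  have : (sideArr P h B).base.unop.1 = 0 := rfl
  simp [shiftForm, this]

lemma shiftForm_linkArr (l : Fin d → ℚ) {P G : A.Face} (m : P ⟶ G) {C C' : A.Chamber Set.univ}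
    (h) :
    shiftForm l (Arrow.mk (linkArr (C := C) (C' := C') m h)) = ∑ j, l j * (m.1 j : ℚ) := rfl

end Endpoints

/-! ### The cyclic alternation of points and edges on a one-dimensional layer. -/

section Next

variable (A) in
/-- The zero-dimensional faces of a line. -/
abbrev ZeroFace (M : A.Line) : Type := {P : A.Face // P.pts ⊆ M.1.1 ∧ A.dim P.pts = 0}

variable (A) in
/-- The one-dimensional faces of a line. -/
abbrev OneFace (M : A.Line) : Type := {G : A.Face // G.pts ⊆ M.1.1 ∧ A.dim G.pts = 1}

variable [Finite ι] {M : A.Line} {ρ : Fin d → ℝ} (hρ : ρ ∈ A.dirSpace M.1.1) (h0 : ρ ≠ 0)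

/-- The one-dimensional face that follows a zero-dimensional face in a given direction. -/
noncomputable def next (P : A.ZeroFace M) : A.OneFace M :=
  ⟨(exists_next hρ h0 P.2.1 P.2.2).choose,
    (exists_next hρ h0 P.2.1 P.2.2).choose_spec.choose_spec.1,
    (exists_next hρ h0 P.2.1 P.2.2).choose_spec.choose_spec.2.1⟩

/-- The morphism to the following one-dimensional face. -/
noncomputable def nextHom (P : A.ZeroFace M) : P.1 ⟶ (next hρ h0 P).1 :=
  (exists_next hρ h0 P.2.1 P.2.2).choose_spec.choose

lemma nextHom_pointsTo (P : A.ZeroFace M) : PointsTo ρ (nextHom hρ h0 P) :=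
  (exists_next hρ h0 P.2.1 P.2.2).choose_spec.choose_spec.2.2

lemma ZeroFace.ne (P : A.ZeroFace M) (G : A.OneFace M) : P.1 ≠ G.1 := by
  intro h
  have h1 := P.2.2
  rw [h, G.2.2] at h1
  exact one_ne_zero h1

/-- The compact layer is a circle on which points and edges alternate. This is what makes the
boundaries of the links cancel when summed over all points. -/
lemma next_bijective (hA : A.Essential) : Function.Bijective (next hρ h0) := by
  constructor
  · intro P P' h
    have key : ∀ G : A.OneFace M, ∀ m' : P'.1 ⟶ G.1, PointsTo ρ m' → next hρ h0 P = G →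
        P = P' := by
      rintro G m' hm' rfl
      exact Subtype.ext ((nextHom_pointsTo hρ h0 P).unique_left hA hm' (P.ne _) (P'.ne _))
    exact key _ _ (nextHom_pointsTo hρ h0 P') h
  · intro G
    obtain ⟨P, m, hP, hP0, hm⟩ := exists_prev hA hρ h0 G.2.1 G.2.2
    refine ⟨⟨P, hP, hP0⟩, Subtype.ext ?_⟩
    exact ((nextHom_pointsTo hρ h0 ⟨P, hP, hP0⟩).unique hA hm).1

end Next

namespace LineGallery

variable [Finite ι] {M : A.Line} (g : A.LineGallery M)

/-- The chamber `ᴹC` has a face `R` with linear hull the line `X_M`. A nonzero point of `R` has the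
signs of `ᴹC` at all hyperplanes that do not contain this line. -/
lemma exists_direction : ∃ ρ ∈ A.dirSpace M.1.1, ρ ≠ 0 ∧
    ∀ i, Transverse M i → (g.chm 0).at i = SignType.sign (A.ev i ρ) := by
  obtain ⟨R, hR, hhull⟩ := g.adjacent
  have h1 : Module.finrank ℝ (A.dirSpace M.1.1) = 1 := M.2
  obtain ⟨u, hu, hu0⟩ : ∃ u ∈ R.carrier, u ≠ 0 := by
    by_contra! hc
    have : R.hull = ⊥ := Submodule.span_eq_bot.2 hc
    rw [← hhull, this, finrank_bot] at h1
    exact zero_ne_one h1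
  refine ⟨u, hhull ▸ Submodule.subset_span hu, hu0, fun i hi => ?_⟩
  let i' : (Set.univ : Set ι) := ⟨i, trivial⟩
  refine ((hR i').resolve_left fun h => hi ?_).symm.trans (hu i')
  rw [← hhull]
  exact LFace.hull_le_ker (i := i') h

/-- A vector of `X_M` on the side of `ᴹC`. -/
noncomputable def dir : Fin d → ℝ := g.exists_direction.choose

lemma dir_mem : g.dir ∈ A.dirSpace M.1.1 := g.exists_direction.choose_spec.1

lemma dir_ne_zero : g.dir ≠ 0 := g.exists_direction.choose_spec.2.1

lemma sign_dir {i : ι} (hi : Transverse M i) : (g.chm 0).at i = SignType.sign (A.ev i g.dir) :=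
  g.exists_direction.choose_spec.2.2 i hi

lemma neg_dir_mem : -g.dir ∈ A.dirSpace M.1.1 := Submodule.neg_mem _ g.dir_mem

lemma neg_dir_ne_zero : -g.dir ≠ 0 := neg_ne_zero.2 g.dir_ne_zero

open Classical in
-- Leaving `P` in the direction `dir` one sees the first chamber of the gallery; leaving in the
-- opposite direction one sees the last (`chm_last_eq`). So the two links at `P` end at the two ends
-- of the local gallery, and the circle closes up.
lemma chm_zero_eq {P G : A.Face} {m : P ⟶ G} (hm : PointsTo g.dir m) (i : ι) (hi : i ∈ A.loc P) :
    (g.chm 0).at i = if i ∈ A.loc G then (g.chm 0).at i else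
      SignType.sign (A.ev i (dirVec m)) := by
  split_ifs with h
  · rfl
  · rw [hm.sign]
    refine g.sign_dir ?_
    rw [transverse_iff g.dir_mem g.dir_ne_zero, ← sign_ne_zero, ← hm.sign, sign_ne_zero]
    exact fun h' => h ((germ_eq_zero_iff m hi).1 h')

open Classical in
lemma chm_last_eq {P G : A.Face} (hG1 : A.dim G.pts = 1)
    (hG : G.pts ⊆ M.1.1) {m : P ⟶ G} (hm : PointsTo (-g.dir) m) (i : ι) (hi : i ∈ A.loc P) :
    (g.chm (Fin.last g.len)).at i = if i ∈ A.loc G then (g.chm 0).at i else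
      SignType.sign (A.ev i (dirVec m)) := by
  split_ifs with h
  · exact g.chm_of_not_transverse (not_transverse_of_dim_eq_one hG hG1 h) _
  · have ht : Transverse M i := by
      rw [transverse_iff g.neg_dir_mem g.neg_dir_ne_zero, ← sign_ne_zero, ← hm.sign, sign_ne_zero]
      exact fun h' => h ((germ_eq_zero_iff m hi).1 h')
    rw [hm.sign, map_neg, Left.sign_neg, g.chm_last ht, g.sign_dir ht]

variable (B : A.Chamber Set.univ)

/-- The arrow `v_j → e_j`. -/
noncomputable def fwd (P : A.Face) (j : Fin g.len) : Arrow A.Sal :=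
  Arrow.mk (sideArr P (g.le_left j) B)

/-- The arrow `v_{j+1} → e_j`. -/
noncomputable def bwd (P : A.Face) (j : Fin g.len) : Arrow A.Sal :=
  Arrow.mk (sideArr P (g.le_right j) B)

/-- The link from the following one-dimensional face. -/
noncomputable def posLink (P : A.ZeroFace M) : Arrow A.Sal :=
  Arrow.mk (linkArr (nextHom g.dir_mem g.dir_ne_zero P) (g.chm_zero_eq
    (nextHom_pointsTo g.dir_mem g.dir_ne_zero P)))

/-- The link from the preceding one-dimensional face. -/
noncomputable def negLink (P : A.ZeroFace M) : Arrow A.Sal :=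
  Arrow.mk (linkArr (nextHom g.neg_dir_mem g.neg_dir_ne_zero P) (g.chm_last_eq (next g.neg_dir_mem g.neg_dir_ne_zero P).2.2
    (next g.neg_dir_mem g.neg_dir_ne_zero P).2.1
    (nextHom_pointsTo g.neg_dir_mem g.neg_dir_ne_zero P)))

variable {B}

lemma IsForward.exists_eq (hA : A.Essential) {f : Arrow A.Sal} (hf : g.IsForward B f) :
    ∃ (P : A.ZeroFace M) (j : Fin g.len), g.Crosses P.1 j ∧ f = g.fwd B P.1 j := by
  obtain ⟨P, hP, hP0, j, hj, hl, hr⟩ := hf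
  exact ⟨⟨P, hP, hP0⟩, j, hj, arrow_eq_of_endpoints hA hl hr (by rw [hl, hr]; rfl)⟩

lemma IsBackward.exists_eq (hA : A.Essential) {f : Arrow A.Sal} (hf : g.IsBackward B f) :
    ∃ (P : A.ZeroFace M) (j : Fin g.len), g.Crosses P.1 j ∧ f = g.bwd B P.1 j := by
  obtain ⟨P, hP, hP0, j, hj, hl, hr⟩ := hf
  exact ⟨⟨P, hP, hP0⟩, j, hj, arrow_eq_of_endpoints hA hl hr (by rw [hl, hr]; rfl)⟩

lemma vtx_one_eq (G : A.OneFace M) (j : Fin (g.len + 1)) : vtx G.1 (g.chm j) = vtx G.1 (g.chm 0) :=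
  vtx_congr fun _ hi => g.chm_of_not_transverse (not_transverse_of_dim_eq_one G.2.1 G.2.2 hi) _

lemma IsLink.exists_eq (hA : A.Essential) {f : Arrow A.Sal} (hf : g.IsLink f) :
    ∃ P : A.ZeroFace M, f = g.posLink P ∨ f = g.negLink P := by
  obtain ⟨P, G, hP, hG, hP0, hG1, j, j', hl, hr⟩ := hf
  obtain ⟨X, Y, f, rfl⟩ := Arrow.mk_surjective f
  change X = _ at hl
  change Y = _ at hr
  subst hl hr
  set P' : A.ZeroFace M := ⟨P, hP, hP0⟩
  set m : P ⟶ G := f.base.unop with hm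
  have hs := fun i hi => sign_of_link (i := i) hm.symm hi
  refine ⟨P', ?_⟩
  have hvG := g.vtx_one_eq ⟨G, hG, hG1⟩ j
  rcases pointsTo_or g.dir_mem g.dir_ne_zero hP hG hP0 hG1 m with h | h
  · left
    obtain ⟨e1, e2⟩ := (nextHom_pointsTo g.dir_mem g.dir_ne_zero P').unique hA h
    refine sal_arrow_ext ?_ ?_ e2.symm
    · change vtx G (g.chm j) = vtx (next g.dir_mem g.dir_ne_zero P').1 (g.chm 0)
      rw [e1, hvG]
    · refine vtx_congr fun i hi => ?_
      rw [hs i hi, g.chm_zero_eq h i hi]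
      split_ifs with hiG
      · exact g.chm_of_not_transverse (not_transverse_of_dim_eq_one hG hG1 hiG) _
      · rfl
  · right
    obtain ⟨e1, e2⟩ := (nextHom_pointsTo g.neg_dir_mem g.neg_dir_ne_zero P').unique hA h
    refine sal_arrow_ext ?_ ?_ e2.symm
    · change vtx G (g.chm j) = vtx (next g.neg_dir_mem g.neg_dir_ne_zero P').1 (g.chm 0)
      rw [e1, hvG]
    · refine vtx_congr fun i hi => ?_
      rw [hs i hi, g.chm_last_eq hG1 hG h i hi]
      split_ifs with hiG
      · exact g.chm_of_not_transverse (not_transverse_of_dim_eq_one hG hG1 hiG) _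
      · rfl

lemma edg_injective {P P' : A.Face} {j j' : Fin g.len} (h : g.Crosses P j)
    (he : edg P (g.wall j) B = edg P' (g.wall j') B) : P = P' ∧ j = j' := by
  obtain ⟨h1, h2⟩ := edg_inj he
  obtain ⟨i, hi, h0⟩ := g.crosses_iff.1 h
  exact ⟨h1, g.wall_unique h0 ((h2 i hi).symm.trans h0)⟩

lemma vtx_first_ne_last (P : A.ZeroFace M) :
    vtx P.1 (g.chm 0) ≠ vtx P.1 (g.chm (Fin.last g.len)) := by
  intro h
  obtain ⟨i, hi, ht⟩ := exists_transverse_of_dim_eq_zero P.2.1 P.2.2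
  have h1 := (vtx_inj h).2 i hi
  rw [g.chm_last ht] at h1
  have : ∀ σ : SignType, σ ≠ 0 → σ ≠ -σ := by decide
  exact this _ ((g.chm 0).ne_zero _) h1

/-- The difference of two such cycles has no forward arrows. Then each backward arrow is the only
remaining arrow at its end `e_j` and drops out; after that, each link is the only remaining arrow at
its end over `P`. -/
lemma IsLambdaCycle.unique (hA : A.Essential) {z z' : Arrow A.Sal →₀ ℚ}
    (h : g.IsLambdaCycle B z) (h' : g.IsLambdaCycle B z') : z = z' := by
  obtain ⟨hb, hs, hf⟩ := h
  obtain ⟨hb', hs', hf'⟩ := h'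
  rw [← sub_eq_zero]
  set w := z - z' with hw
  have hwb : CatHom.bdry1 A.Sal w = 0 := by rw [hw, map_sub, hb, hb', sub_zero]
  have hws : ∀ f ∈ w.support, g.IsBackward B f ∨ g.IsLink f := by
    classical
    intro f hfw
    have hnf : ¬ g.IsForward B f := fun hc => by
      rw [Finsupp.mem_support_iff, hw, Finsupp.sub_apply, hf f hc, hf' f hc, sub_self] at hfw
      exact hfw rfl
    rcases Finset.mem_union.1 (Finsupp.support_sub hfw) with h1 | h1
    · exact (hs f h1).resolve_left hnf
    · exact (hs' f h1).resolve_left hnf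
  have hback : ∀ f, g.IsBackward B f → w f = 0 := by
    intro f hf
    obtain ⟨P, j, hj, rfl⟩ := IsBackward.exists_eq g hA hf
    have hW := g.crosses_iff.1 hj
    refine CatHom.eq_zero_of_unique_arrow hwb (edg P.1 (g.wall j) B) _
      (Or.inr ⟨vtx_ne_edg hW, rfl⟩) fun f' hf' hne => ?_
    rcases hws f' hf' with h1 | h1
    · obtain ⟨P', j', hj', rfl⟩ := IsBackward.exists_eq g hA h1
      refine ⟨vtx_ne_edg hW, fun he => hne ?_⟩
      obtain ⟨h2, h3⟩ := g.edg_injective hj' he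
      rw [h2, h3]
    · obtain ⟨P', hl | hl⟩ := IsLink.exists_eq g hA h1 <;> subst hl <;>
        exact ⟨vtx_ne_edg hW, vtx_ne_edg hW⟩
  have hlink : ∀ f ∈ w.support, ∃ P : A.ZeroFace M, f = g.posLink P ∨ f = g.negLink P := by
    intro f hfw
    rcases hws f hfw with h1 | h1
    · exact absurd (hback f h1) (Finsupp.mem_support_iff.1 hfw)
    · exact IsLink.exists_eq g hA h1
  ext f
  by_contra hfw
  obtain ⟨P, hP⟩ := hlink f (Finsupp.mem_support_iff.2 hfw)
  refine hfw (CatHom.eq_zero_of_unique_arrow hwb f.right f (Or.inr ⟨?_, rfl⟩) ?_)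
  · rcases hP with rfl | rfl
    · exact fun h => P.ne _ (pt_base_eq h).symm
    · exact fun h => P.ne _ (pt_base_eq h).symm
  · intro f' hf' hne
    obtain ⟨P', hP'⟩ := hlink f' hf'
    rcases hP with rfl | rfl <;> rcases hP' with rfl | rfl
    all_goals
      refine ⟨fun h => P.ne _ (pt_base_eq h).symm, fun h => ?_⟩
      have hPP : P' = P := Subtype.ext (vtx_inj h).1
      subst hPP
    · exact hne rfl
    · exact g.vtx_first_ne_last _ h.symm
    · exact g.vtx_first_ne_last _ h
    · exact hne rfl

end LineGallery

end ToricArrangement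

/-! ### Explicit cycles on the circles, and their periods. -/

namespace ToricArrangement

variable {ι : Type} {d : ℕ} {A : ToricArrangement ι d}

open Classical in
/-- The number of points at which a line meets a hypertorus that does not contain it. -/
noncomputable def meetCount (M : A.Line) (i : ι) : ℕ :=
  {P : A.Face | P.pts ⊆ M.1.1 ∧ i ∈ A.loc P ∧ i ∉ A.above M.1.1}.ncard

namespace LineGallery

variable [Finite ι] {M : A.Line} (g : A.LineGallery M) (B : A.Chamber Set.univ)

open Classical in
/-- The part of the cycle `[Λ_B^M]` near a zero-dimensional face. -/
noncomputable def localChain (P : A.ZeroFace M) : Arrow A.Sal →₀ ℚ :=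
  (∑ j, if g.Crosses P.1 j then
    Finsupp.single (g.fwd B P.1 j) (1 : ℚ) - Finsupp.single (g.bwd B P.1 j) 1 else 0)
  + Finsupp.single (g.posLink P) 1 - Finsupp.single (g.negLink P) 1

/-- The cycle `[Λ_B^M]`. -/
noncomputable def lambdaChain : Arrow A.Sal →₀ ℚ := ∑ᶠ P : A.ZeroFace M, g.localChain B P

/-- The boundary telescopes along the gallery; steps not seen by `𝒜[P]` contribute nothing because
their two vertices coincide. Only the two neighbouring edges of the circle remain. -/
lemma bdry_localChain (P : A.ZeroFace M) :
    CatHom.bdry1 A.Sal (g.localChain B P)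
      = Finsupp.single (vtx (next g.neg_dir_mem g.neg_dir_ne_zero P).1 (g.chm 0)) 1
        - Finsupp.single (vtx (next g.dir_mem g.dir_ne_zero P).1 (g.chm 0)) 1 := by
  classical
  have hs : ∀ f : Arrow A.Sal, CatHom.bdry1 A.Sal (Finsupp.single f 1)
      = Finsupp.single f.right 1 - Finsupp.single f.left 1 := by
    intro f
    simp [CatHom.bdry1]
  unfold localChain
  rw [map_sub, map_add, map_sum, hs, hs]
  have hj : ∀ j : Fin g.len, CatHom.bdry1 A.Sal (if g.Crosses P.1 j then
      Finsupp.single (g.fwd B P.1 j) (1 : ℚ) - Finsupp.single (g.bwd B P.1 j) 1 else 0)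
      = Finsupp.single (vtx P.1 (g.chm j.succ)) 1
        - Finsupp.single (vtx P.1 (g.chm j.castSucc)) 1 := by
    intro j
    split_ifs with h
    · rw [map_sub, hs, hs]
      change (Finsupp.single (edg P.1 (g.wall j) B) 1
        - Finsupp.single (vtx P.1 (g.chm j.castSucc)) 1)
        - (Finsupp.single (edg P.1 (g.wall j) B) 1 - Finsupp.single (vtx P.1 (g.chm j.succ)) 1) = _
      abel
    · have : vtx P.1 (g.chm j.castSucc) = vtx P.1 (g.chm j.succ) := by
        simp only [vtx, not_not.1 h]
      rw [map_zero, this, sub_self]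
  rw [Finset.sum_congr rfl fun j _ => hj j, Finset.sum_sub_distrib]
  have htel := Fin.sum_univ_succ fun l => Finsupp.single (vtx P.1 (g.chm l)) (1 : ℚ)
  rw [Fin.sum_univ_castSucc] at htel
  have e1 : (g.posLink P).right = vtx P.1 (g.chm 0) := rfl
  have e2 : (g.posLink P).left = vtx (next g.dir_mem g.dir_ne_zero P).1 (g.chm 0) := rfl
  have e3 : (g.negLink P).right = vtx P.1 (g.chm (Fin.last g.len)) := rfl
  have e4 : (g.negLink P).left = vtx (next g.neg_dir_mem g.neg_dir_ne_zero P).1 (g.chm 0) := rfl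
  rw [e1, e2, e3, e4]
  rw [← sub_eq_iff_eq_add'] at htel
  rw [← htel]
  abel

lemma lambdaChain_eq [Fintype (A.ZeroFace M)] :
    g.lambdaChain B = ∑ P : A.ZeroFace M, g.localChain B P := finsum_eq_sum_of_fintype _

lemma bdry_lambdaChain (hA : A.Essential) : CatHom.bdry1 A.Sal (g.lambdaChain B) = 0 := by
  classical
  have := Fintype.ofFinite (A.ZeroFace M)
  have := Fintype.ofFinite (A.OneFace M)
  rw [lambdaChain_eq, map_sum, Finset.sum_congr rfl fun P _ => g.bdry_localChain B P,
    Finset.sum_sub_distrib,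
    (next_bijective g.dir_mem g.dir_ne_zero hA).sum_comp
      fun G => Finsupp.single (vtx G.1 (g.chm 0)) (1 : ℚ),
    (next_bijective g.neg_dir_mem g.neg_dir_ne_zero hA).sum_comp
      fun G => Finsupp.single (vtx G.1 (g.chm 0)) (1 : ℚ), sub_self]

lemma isLink_posLink (P : A.ZeroFace M) : g.IsLink (g.posLink P) :=
  ⟨P.1, _, P.2.1, (next g.dir_mem g.dir_ne_zero P).2.1, P.2.2,
    (next g.dir_mem g.dir_ne_zero P).2.2, 0, 0, rfl, rfl⟩

lemma isLink_negLink (P : A.ZeroFace M) : g.IsLink (g.negLink P) :=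
  ⟨P.1, _, P.2.1, (next g.neg_dir_mem g.neg_dir_ne_zero P).2.1, P.2.2,
    (next g.neg_dir_mem g.neg_dir_ne_zero P).2.2, 0, Fin.last _, rfl, rfl⟩

lemma localChain_mem_supported (P : A.ZeroFace M) : g.localChain B P ∈
    Finsupp.supported ℚ ℚ {f | g.IsForward B f ∨ g.IsBackward B f ∨ g.IsLink f} := by
  classical
  refine Submodule.sub_mem _ (Submodule.add_mem _ (Submodule.sum_mem _ fun j _ => ?_) ?_) ?_
  · split_ifs with h
    · refine Submodule.sub_mem _ (Finsupp.single_mem_supported _ _ (Or.inl ?_))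
        (Finsupp.single_mem_supported _ _ (Or.inr (Or.inl ?_)))
      · exact ⟨P.1, P.2.1, P.2.2, j, h, rfl, rfl⟩
      · exact ⟨P.1, P.2.1, P.2.2, j, h, rfl, rfl⟩
    · exact Submodule.zero_mem _
  · exact Finsupp.single_mem_supported _ _ (Or.inr (Or.inr (g.isLink_posLink P)))
  · exact Finsupp.single_mem_supported _ _ (Or.inr (Or.inr (g.isLink_negLink P)))

lemma localChain_fwd {P₀ : A.ZeroFace M} {j₀ : Fin g.len} (h₀ : g.Crosses P₀.1 j₀)
    (P : A.ZeroFace M) [Decidable (P = P₀)] :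
    g.localChain B P (g.fwd B P₀.1 j₀) = if P = P₀ then 1 else 0 := by
  classical
  have hW := g.crosses_iff.1 h₀
  have hlink : ∀ f, f.right ≠ edg P₀.1 (g.wall j₀) B →
      (Finsupp.single f (1 : ℚ)) (g.fwd B P₀.1 j₀) = 0 := by
    intro f hf
    refine Finsupp.single_eq_of_ne fun h => hf ?_
    rw [← h]
    rfl
  have hj : ∀ j, (if g.Crosses P.1 j then Finsupp.single (g.fwd B P.1 j) (1 : ℚ)
      - Finsupp.single (g.bwd B P.1 j) 1 else 0 : Arrow A.Sal →₀ ℚ) (g.fwd B P₀.1 j₀)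
      = if j = j₀ then (if P = P₀ then 1 else 0) else 0 := by
    intro j
    by_cases hPj : P = P₀ ∧ j = j₀
    · obtain ⟨rfl, rfl⟩ := hPj
      rw [if_pos h₀, if_pos rfl, if_pos rfl, Finsupp.sub_apply, Finsupp.single_eq_same,
        Finsupp.single_eq_of_ne, sub_zero]
      intro h
      have h1 : vtx P.1 (g.chm j.castSucc) = vtx P.1 (g.chm j.succ) := congrArg (fun f => f.left) h
      exact h₀ (Chamber.ext_sg fun i => (vtx_inj h1).2 i i.2)
    · have e : (if j = j₀ then (if P = P₀ then (1 : ℚ) else 0) else 0) = 0 := by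
        split_ifs with h1 h2
        · exact absurd ⟨h2, h1⟩ hPj
        · rfl
        · rfl
      rw [e]
      split_ifs with hc
      · have hne : edg P.1 (g.wall j) B ≠ edg P₀.1 (g.wall j₀) B := fun h =>
          hPj ⟨Subtype.ext (g.edg_injective hc h).1, (g.edg_injective hc h).2⟩
        rw [Finsupp.sub_apply, hlink _ hne, hlink _ hne, sub_zero]
      · rfl
  unfold localChain
  rw [Finsupp.sub_apply, Finsupp.add_apply, Finsupp.finsetSum_apply,
    Finset.sum_congr rfl fun j _ => hj j, hlink _ (vtx_ne_edg hW), hlink _ (vtx_ne_edg hW),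
    Finset.sum_ite_eq' , if_pos (Finset.mem_univ _), add_zero, sub_zero]

theorem isLambdaCycle_lambdaChain (hA : A.Essential) : g.IsLambdaCycle B (g.lambdaChain B) := by
  classical
  have := Fintype.ofFinite (A.ZeroFace M)
  refine ⟨g.bdry_lambdaChain B hA, ?_, ?_⟩
  · have : g.lambdaChain B ∈
        Finsupp.supported ℚ ℚ {f | g.IsForward B f ∨ g.IsBackward B f ∨ g.IsLink f} := by
      rw [lambdaChain_eq]
      exact Submodule.sum_mem _ fun P _ => g.localChain_mem_supported B P
    intro f hf
    exact (Finsupp.mem_supported _ _).1 this hf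
  · intro f hf
    obtain ⟨P, j, hj, rfl⟩ := IsForward.exists_eq g hA hf
    rw [lambdaChain_eq, Finsupp.finsetSum_apply,
      Finset.sum_congr rfl fun P' _ => g.localChain_fwd B hj P', Finset.sum_ite_eq',
      if_pos (Finset.mem_univ _)]

open Classical in
-- Exactly one wall of the gallery lies in the `i`-th hyperplane if that is transverse, and none
-- otherwise. If `B` is positive, then at this wall `v_j → e_j` counts `+1` when `ᴹC` is positive
-- and `v_{j+1} → e_j` counts `-1` when it is negative; if `B` is negative nothing counts.
lemma wind_localChain (i : ι) (P : A.ZeroFace M) :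
    Finsupp.linearCombination ℚ (wind i) (g.localChain B P) =
      if i ∈ A.loc P.1 ∧ i ∉ A.above M.1.1 then
        (if B.at i = 1 then (((g.chm 0).at i : ℤ) : ℚ) else 0) else 0 := by
  unfold localChain
  rw [map_sub, map_add, map_sum, Finsupp.linearCombination_single,
    Finsupp.linearCombination_single]
  have hp : wind i (g.posLink P) = 0 := wind_linkArr _ _ _
  have hn : wind i (g.negLink P) = 0 := wind_linkArr _ _ _
  have hj : ∀ j, Finsupp.linearCombination ℚ (wind i) (if g.Crosses P.1 j then
      Finsupp.single (g.fwd B P.1 j) (1 : ℚ) - Finsupp.single (g.bwd B P.1 j) 1 else 0)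
      = if i ∈ A.loc P.1 ∧ (g.wall j).sg ⟨i, trivial⟩ = 0 then
        (if B.at i = 1 then (((g.chm 0).at i : ℤ) : ℚ) else 0) else 0 := by
    intro j
    by_cases h : i ∈ A.loc P.1 ∧ (g.wall j).sg ⟨i, trivial⟩ = 0
    · rw [if_pos h, if_pos (g.crosses_iff.2 ⟨i, h.1, h.2⟩), map_sub,
        Finsupp.linearCombination_single, Finsupp.linearCombination_single, one_smul, one_smul,
        fwd, bwd, wind_sideArr, wind_sideArr, g.chm_of_le h.2 le_rfl,
        g.chm_of_gt h.2 Fin.castSucc_lt_succ]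
      simp only [h.1, h.2, true_and]
      have h0 : (g.chm 0).at i ≠ 0 := (g.chm 0).ne_zero _
      generalize (g.chm 0).at i = σ at h0 ⊢
      by_cases hB : B.at i = 1
      · simp only [hB, true_and, if_true]
        cases σ
        · exact absurd rfl h0
        · simp
        · simp
      · simp [hB]
    · rw [if_neg h]
      split_ifs with hc
      · rw [map_sub, Finsupp.linearCombination_single, Finsupp.linearCombination_single, one_smul,
          one_smul, fwd, bwd, wind_sideArr, wind_sideArr, if_neg fun hh => h ⟨hh.1, hh.2.1⟩,
          if_neg fun hh => h ⟨hh.1, hh.2.1⟩, sub_zero]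
      · exact map_zero _
  rw [Finset.sum_congr rfl fun j _ => hj j, hp, hn, smul_zero, add_zero, sub_zero]
  generalize (if B.at i = 1 then (((g.chm 0).at i : ℤ) : ℚ) else 0) = c
  by_cases hi : i ∈ A.loc P.1
  · by_cases ha : i ∈ A.above M.1.1
    · rw [if_neg fun h => h.2 ha]
      refine Finset.sum_eq_zero fun j _ => if_neg fun h => ?_
      exact not_transverse_of_mem_above ha (g.transverse_of_wall h.2)
    · rw [if_pos ⟨hi, ha⟩]
      obtain ⟨j, hj⟩ := g.exists_wall_of_transverse
        ((transverse_iff_of_mem_loc P.2.1 hi).2 ha)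
      rw [Finset.sum_eq_single j (fun j' _ hne => if_neg fun h => hne (g.wall_unique h.2 hj))
        (fun h => absurd (Finset.mem_univ _) h), if_pos ⟨hi, hj⟩]
  · rw [if_neg fun h => hi h.1]
    exact Finset.sum_eq_zero fun j _ => if_neg fun h => hi h.1

open Classical in
theorem wind_lambdaChain (i : ι) :
    Finsupp.linearCombination ℚ (wind i) (g.lambdaChain B) =
      meetCount M i * (if B.at i = 1 then (((g.chm 0).at i : ℤ) : ℚ) else 0) := by
  have := Fintype.ofFinite (A.ZeroFace M)
  rw [lambdaChain_eq, map_sum, Finset.sum_congr rfl fun P _ => g.wind_localChain B i P,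
    ← Finset.sum_filter, Finset.sum_const, nsmul_eq_mul]
  congr 2
  rw [meetCount, ← Set.ncard_coe_finset]
  refine (Set.ncard_image_of_injective _ Subtype.val_injective).symm.trans ?_
  congr 1
  ext P
  constructor
  · rintro ⟨P, hP, rfl⟩
    have := (Finset.mem_filter.1 hP).2
    exact ⟨P.2.1, this.1, this.2⟩
  · rintro ⟨h1, h2, h3⟩
    refine ⟨⟨P, h1, dim_eq_zero h1 h2 ((transverse_iff_of_mem_loc h1 h2).2 h3)⟩, ?_, rfl⟩
    exact Finset.mem_filter.2 ⟨Finset.mem_univ _, h2, h3⟩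

/-- The class of the circle in the first homology of the torus. -/
noncomputable def translation : Fin d → ℚ := fun j =>
  ∑ᶠ P : A.ZeroFace M, (((nextHom g.dir_mem g.dir_ne_zero P).1 j : ℚ)
    - ((nextHom g.neg_dir_mem g.neg_dir_ne_zero P).1 j : ℚ))

/-- Only the links move between faces, and they do not involve `B`; hence the displacement depends
only on the layer and its gallery. -/
theorem shiftForm_lambdaChain (l : Fin d → ℚ) :
    Finsupp.linearCombination ℚ (shiftForm l) (g.lambdaChain B) = ∑ j, l j * g.translation j := by
  classical
  have := Fintype.ofFinite (A.ZeroFace M)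
  have hP : ∀ P : A.ZeroFace M, Finsupp.linearCombination ℚ (shiftForm l) (g.localChain B P)
      = ∑ j, l j * (((nextHom g.dir_mem g.dir_ne_zero P).1 j : ℚ)
        - ((nextHom g.neg_dir_mem g.neg_dir_ne_zero P).1 j : ℚ)) := by
    intro P
    unfold localChain
    rw [map_sub, map_add, map_sum, Finsupp.linearCombination_single,
      Finsupp.linearCombination_single, Finset.sum_eq_zero, zero_add, one_smul, one_smul,
      posLink, negLink, shiftForm_linkArr, shiftForm_linkArr, ← Finset.sum_sub_distrib]
    · simp only [mul_sub]
    · intro j _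
      split_ifs
      · rw [map_sub, Finsupp.linearCombination_single, Finsupp.linearCombination_single, fwd, bwd,
          shiftForm_sideArr, shiftForm_sideArr, sub_self]
      · exact map_zero _
  rw [lambdaChain_eq, map_sum, Finset.sum_congr rfl fun P _ => hP P, Finset.sum_comm]
  refine Finset.sum_congr rfl fun j _ => ?_
  rw [translation, finsum_eq_sum_of_fintype, Finset.mul_sum]

end LineGallery

end ToricArrangement

namespace CatHom

universe v u v' u'

variable {C : Type u} [Category.{v} C] {D : Type u'} [Category.{v'} D]

lemma pairing_pull_mk (Φ : D ⥤ C) (c : Cocycles C) (z : Cycles D) :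
    pairing (pull Φ (Submodule.Quotient.mk c)) (H1.cls D z)
      = Finsupp.linearCombination ℚ c.1 (chainMap Φ z.1) := by
  rw [pairing_pull, pairing_mk]

end CatHom

/-! ### The classes around circles and hypertori inside a stratum. -/

namespace ToricArrangement

variable {ι : Type} {d : ℕ} {A : ToricArrangement ι d} [Finite ι]

/-- If the face is already a chamber, then `C_G = G` for every `C`, so the choice of `C ≥ F₀`
imposes nothing. -/
lemma inStratum_of_chamber {s : Set ι} {F₀ : A.LFace Set.univ} {x : A.SalPos s}
    (h : ∀ i, x.face.sg i ≠ 0) : InStratum F₀ x := by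
  obtain ⟨K⟩ := nonempty_chamber A
  refine ⟨(F₀.compCh K).restrict s (Set.subset_univ _), fun i => le_compCh F₀ K _,
    Chamber.ext_sg fun i => ?_⟩
  rw [compCh_sg, if_neg (h i)]
  exact ((x.le i).resolve_left (h i)).symm

namespace LineGallery

variable {M : A.Line} (g : A.LineGallery M) {B : A.Chamber Set.univ}

lemma subProp_vtx {Y : A.Layer} {F₀ : A.LFace Set.univ} {P : A.Face} (hP : P.pts ⊆ Y.1)
    (C : A.Chamber Set.univ) : A.subProp Y F₀ (vtx P C) :=
  ⟨hP, inStratum_of_chamber (F₀ := F₀) (s := A.loc P)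
    fun i => (C.restrict (A.loc P) (Set.subset_univ _)).ne_zero i⟩

lemma subProp_edg {Y : A.Layer} {F₀ : A.LFace Set.univ} {P : A.Face} (hP : P.pts ⊆ Y.1)
    (W : A.LFace Set.univ) (hB : F₀ ≤ B.toLFace) : A.subProp Y F₀ (edg P W B) :=
  ⟨hP, inStratum_sal (W.restrict (A.loc P) (Set.subset_univ _)) hB⟩

lemma exists_cycle_subSal (hA : A.Essential) {Y : A.Layer} {F₀ : A.LFace Set.univ}
    (hM : M.1.1 ⊆ Y.1) (hB : F₀ ≤ B.toLFace) : ∃ z : CatHom.Cycles (A.SubSal Y F₀),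
      CatHom.chainMap (A.subIncl Y F₀) z.1 = g.lambdaChain B := by
  obtain ⟨hb, hs, -⟩ := g.isLambdaCycle_lambdaChain B hA
  refine CatHom.exists_chain_lift _ hb fun f hf => ?_
  rcases hs f hf with ⟨P, hP, -, j, -, hl, hr⟩ | ⟨P, hP, -, j, -, hl, hr⟩ |
    ⟨P, G, hP, hG, -, -, j, j', hl, hr⟩
  · rw [hl, hr]
    exact ⟨subProp_vtx (hP.trans hM) _, subProp_edg (hP.trans hM) _ hB⟩
  · rw [hl, hr]
    exact ⟨subProp_vtx (hP.trans hM) _, subProp_edg (hP.trans hM) _ hB⟩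
  · rw [hl, hr]
    exact ⟨subProp_vtx (hG.trans hM) _, subProp_vtx (hP.trans hM) _⟩

lemma exists_cycle_sal (hA : A.Essential) (B : A.Chamber Set.univ) : ∃ z : CatHom.Cycles A.Sal,
    CatHom.chainMap (𝟭 A.Sal) z.1 = g.lambdaChain B :=
  ⟨⟨g.lambdaChain B, g.bdry_lambdaChain B hA⟩, CatHom.chainMap_id _⟩

/-- The class is picked by choice, but any admissible cycle has image `lambdaChain` by uniqueness.
Its pairings with restricted cocycles are therefore determined. -/
theorem pairing_lambdaHat (hA : A.Essential) {D : Type} [Category.{0} D] {Φ : D ⥤ A.Sal}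
    (h : ∃ z : CatHom.Cycles D, CatHom.chainMap Φ z.1 = g.lambdaChain B)
    (c : CatHom.Cocycles A.Sal) :
    CatHom.pairing (CatHom.pull Φ (Submodule.Quotient.mk c)) (g.lambdaHat B Φ) =
      Finsupp.linearCombination ℚ c.1 (g.lambdaChain B) := by
  obtain ⟨w, hw⟩ := h
  have hspec : ∃ z : CatHom.Cycles D, CatHom.H1.cls D z = g.lambdaHat B Φ ∧
      g.IsLambdaCycle B (CatHom.chainMap Φ z.1) :=
    Classical.epsilon_spec (p := fun c => ∃ z : CatHom.Cycles D, CatHom.H1.cls D z = c ∧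
      g.IsLambdaCycle B (CatHom.chainMap Φ z.1))
      ⟨_, w, rfl, hw ▸ g.isLambdaCycle_lambdaChain B hA⟩
  obtain ⟨z, hz, hcyc⟩ := hspec
  rw [← hz, CatHom.pairing_pull_mk,
    IsLambdaCycle.unique g hA hcyc (g.isLambdaCycle_lambdaChain B hA)]

end LineGallery

/-! ### The cycles `[Ω^(m)]` -/

section Omega

variable {F G : A.Face} (m : F ⟶ G)

/-- The arrow `[C_{F_m}, C_{F_m}] → [F_m, C'_{F_m}]`. -/
noncomputable def omegaArr (C C' : A.Chamber (A.loc F)) : omegaV m C ⟶ omegaE m C' :=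
  fibArr ⟨le_compCh _ _, Chamber.ext_sg fun i => if_neg (((germ m).compCh C).ne_zero i)⟩

lemma omegaV_ne_omegaE {i : ι} (hi : i ∈ A.loc G) (C C' : A.Chamber (A.loc F)) :
    omegaV m C ≠ omegaE m C' := by
  intro h
  have h1 : ((germ m).compCh C).sg ⟨i, loc_mono m hi⟩ = (germ m).sg ⟨i, loc_mono m hi⟩ :=
    congrArg (fun x : A.SalPos (A.loc F) => x.face.sg ⟨i, loc_mono m hi⟩) (pt_injective h)
  refine ((germ m).compCh C).ne_zero _ (h1.trans (sign_eq_zero_iff.2 ?_))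
  exact (germ_eq_zero_iff m (loc_mono m hi)).2 hi

lemma compCh_germ_ne {i : ι} (hi : i ∈ A.loc G) (C : A.Chamber (A.loc F)) :
    (germ m).compCh C ≠ (germ m).compCh C.neg := by
  intro h
  have h1 := congrArg (fun x : A.Chamber (A.loc F) => x.sg ⟨i, loc_mono m hi⟩) h
  have h0 : (germ m).sg ⟨i, loc_mono m hi⟩ = 0 :=
    sign_eq_zero_iff.2 ((germ_eq_zero_iff m (loc_mono m hi)).2 hi)
  change (if (germ m).sg _ = 0 then C.sg _ else _) = if (germ m).sg _ = 0 then -C.sg _ else _ at h1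
  rw [if_pos h0, if_pos h0] at h1
  have : ∀ σ : SignType, σ ≠ 0 → σ ≠ -σ := by decide
  exact this _ (C.ne_zero _) h1

lemma omegaV_ne {i : ι} (hi : i ∈ A.loc G) (C : A.Chamber (A.loc F)) :
    omegaV m C ≠ omegaV m C.neg := fun h =>
  compCh_germ_ne m hi C (congrArg (fun x : A.SalPos (A.loc F) => x.ch) (pt_injective h))

lemma omegaE_ne {i : ι} (hi : i ∈ A.loc G) (C : A.Chamber (A.loc F)) :
    omegaE m C ≠ omegaE m C.neg := fun h =>
  compCh_germ_ne m hi C (congrArg (fun x : A.SalPos (A.loc F) => x.ch) (pt_injective h))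

/-- The cycle `[Ω^(m)]`. -/
noncomputable def omegaChain (K : A.Chamber (A.loc F)) : Arrow A.Sal →₀ ℚ :=
  Finsupp.single (Arrow.mk (omegaArr m K K)) 1 - Finsupp.single (Arrow.mk (omegaArr m K K.neg)) 1
    - Finsupp.single (Arrow.mk (omegaArr m K.neg K)) 1
    + Finsupp.single (Arrow.mk (omegaArr m K.neg K.neg)) 1

lemma bdry_omegaChain (K : A.Chamber (A.loc F)) : CatHom.bdry1 A.Sal (omegaChain m K) = 0 := by
  have hs : ∀ f : Arrow A.Sal, CatHom.bdry1 A.Sal (Finsupp.single f 1)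
      = Finsupp.single f.right 1 - Finsupp.single f.left 1 := by
    intro f
    simp [CatHom.bdry1]
  rw [omegaChain, map_add, map_sub, map_sub, hs, hs, hs, hs]
  simp only [Arrow.mk_left, Arrow.mk_right]
  abel

lemma eq_omegaArr (hA : A.Essential) {f : Arrow A.Sal} {C C' : A.Chamber (A.loc F)}
    (hl : f.left = omegaV m C) (hr : f.right = omegaE m C') : f = Arrow.mk (omegaArr m C C') :=
  arrow_eq_of_endpoints hA hl hr (by rw [hl, hr]; rfl)

theorem isOmegaCycle_omegaChain (hA : A.Essential) {i : ι} (hi : i ∈ A.loc G)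
    (K : A.Chamber Set.univ) :
    IsOmegaCycle m K (omegaChain m (K.restrict (A.loc F) (Set.subset_univ _))) := by
  classical
  refine ⟨bdry_omegaChain m _, ?_, ?_⟩
  · set K₁ := K.restrict (A.loc F) (Set.subset_univ _)
    have : omegaChain m K₁ ∈ Finsupp.supported ℚ ℚ {f : Arrow A.Sal |
        (f.left = omegaV m K₁ ∨ f.left = omegaV m K₁.neg) ∧
        (f.right = omegaE m K₁ ∨ f.right = omegaE m K₁.neg)} := by
      refine Submodule.add_mem _ (Submodule.sub_mem _ (Submodule.sub_mem _
        (Finsupp.single_mem_supported _ _ ?_) (Finsupp.single_mem_supported _ _ ?_))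
        (Finsupp.single_mem_supported _ _ ?_)) (Finsupp.single_mem_supported _ _ ?_)
      · exact ⟨Or.inl rfl, Or.inl rfl⟩
      · exact ⟨Or.inl rfl, Or.inr rfl⟩
      · exact ⟨Or.inr rfl, Or.inl rfl⟩
      · exact ⟨Or.inr rfl, Or.inr rfl⟩
    intro f hf
    exact (Finsupp.mem_supported _ _).1 this hf
  · intro f hl hr
    obtain rfl := eq_omegaArr m hA hl hr
    set K₁ := K.restrict (A.loc F) (Set.subset_univ _)
    have h1 : Arrow.mk (omegaArr m K₁ K₁) ≠ Arrow.mk (omegaArr m K₁ K₁.neg) := fun h =>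
      omegaE_ne m hi K₁ (congrArg (fun f => f.right) h)
    have h2 : Arrow.mk (omegaArr m K₁ K₁) ≠ Arrow.mk (omegaArr m K₁.neg K₁) := fun h =>
      omegaV_ne m hi K₁ (congrArg (fun f => f.left) h)
    have h3 : Arrow.mk (omegaArr m K₁ K₁) ≠ Arrow.mk (omegaArr m K₁.neg K₁.neg) := fun h =>
      omegaV_ne m hi K₁ (congrArg (fun f => f.left) h)
    rw [omegaChain, Finsupp.add_apply, Finsupp.sub_apply, Finsupp.sub_apply,
      Finsupp.single_eq_same, Finsupp.single_eq_of_ne h1, Finsupp.single_eq_of_ne h2,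
      Finsupp.single_eq_of_ne h3]
    norm_num

variable {m}

/-- The prescribed coefficient removes one arrow of the quadrilateral from the difference; the other
three are then peeled off, each being the only one left at one of its ends. -/
theorem IsOmegaCycle.unique (hA : A.Essential) {i : ι} (hi : i ∈ A.loc G)
    {K : A.Chamber Set.univ} {z z' : Arrow A.Sal →₀ ℚ} (h : IsOmegaCycle m K z)
    (h' : IsOmegaCycle m K z') : z = z' := by
  obtain ⟨hb, hs, hf⟩ := h
  obtain ⟨hb', hs', hf'⟩ := h'
  set K₁ := K.restrict (A.loc F) (Set.subset_univ _) with hK₁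
  rw [← sub_eq_zero]
  set w := z - z' with hw
  have hwb : CatHom.bdry1 A.Sal w = 0 := by rw [hw, map_sub, hb, hb', sub_zero]
  have hws : ∀ f ∈ w.support, (f.left = omegaV m K₁ ∨ f.left = omegaV m K₁.neg) ∧
      (f.right = omegaE m K₁ ∨ f.right = omegaE m K₁.neg) := by
    classical
    intro f hfw
    rcases Finset.mem_union.1 (Finsupp.support_sub hfw) with h1 | h1
    · exact hs f h1
    · exact hs' f h1
  have hVE := omegaV_ne_omegaE m hi
  have hV := omegaV_ne m hi K₁
  have hE := omegaE_ne m hi K₁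
  have h11 : ∀ f, f.left = omegaV m K₁ → f.right = omegaE m K₁ → w f = 0 := fun f hl hr => by
    rw [hw, Finsupp.sub_apply, hf f hl hr, hf' f hl hr, sub_self]
  have h12 : ∀ f, f.left = omegaV m K₁ → f.right = omegaE m K₁.neg → w f = 0 := fun f hl hr => by
    refine CatHom.eq_zero_of_unique_arrow hwb (omegaV m K₁) f (Or.inl ⟨hl, ?_⟩) fun f' hf' hne => ?_
    · rw [hr]
      exact (hVE _ _).symm
    · obtain ⟨hl' | hl', hr'⟩ := hws f' hf'
      · exfalso
        rcases hr' with hr' | hr'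
        · exact Finsupp.mem_support_iff.1 hf' (h11 f' hl' hr')
        · exact hne ((eq_omegaArr m hA hl' hr').trans (eq_omegaArr m hA hl hr).symm)
      · rw [hl']
        refine ⟨hV.symm, ?_⟩
        rcases hr' with hr' | hr' <;> rw [hr'] <;> exact (hVE _ _).symm
  have hright : ∀ C', (C' = K₁ ∨ C' = K₁.neg) → ∀ f, f.left = omegaV m K₁.neg →
      f.right = omegaE m C' → w f = 0 := by
    intro C' hC' f hl hr
    refine CatHom.eq_zero_of_unique_arrow hwb (omegaE m C') f (Or.inr ⟨?_, hr⟩) fun f' hf' hne => ?_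
    · rw [hl]
      exact hVE _ _
    · obtain ⟨hl', hr'⟩ := hws f' hf'
      refine ⟨?_, fun hr'' => ?_⟩
      · rcases hl' with hl' | hl' <;> rw [hl'] <;> exact hVE _ _
      rcases hl' with hl' | hl'
      · refine Finsupp.mem_support_iff.1 hf' ?_
        rcases hr' with hr' | hr'
        · exact h11 f' hl' hr'
        · exact h12 f' hl' hr'
      · exact hne ((eq_omegaArr m hA hl' hr'').trans (eq_omegaArr m hA hl hr).symm)
  ext f
  by_contra hfw
  obtain ⟨hl | hl, hr | hr⟩ := hws f (Finsupp.mem_support_iff.2 hfw)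
  · exact hfw (h11 f hl hr)
  · exact hfw (h12 f hl hr)
  · exact hfw (hright _ (Or.inl rfl) f hl hr)
  · exact hfw (hright _ (Or.inr rfl) f hl hr)

variable (m)

open Classical in
lemma wind_omegaArr (i : ι) (C C' : A.Chamber (A.loc F)) :
    wind i (Arrow.mk (omegaArr m C C')) = if h : i ∈ A.loc F then
      (if i ∈ A.loc G ∧ C.sg ⟨i, h⟩ = 1 ∧ C'.sg ⟨i, h⟩ = 1 then 1 else 0) else 0 := by
  refine (wind_arr i (𝟙 F) _).trans (dite_congr rfl (fun h => if_congr ?_ rfl rfl) fun _ => rfl)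
  rw [incl_id]
  have e : (germ m).sg ⟨i, h⟩ = 0 ↔ i ∈ A.loc G :=
    sign_eq_zero_iff.trans (germ_eq_zero_iff m h)
  change (if (germ m).sg ⟨i, h⟩ = 0 then C.sg ⟨i, h⟩ else (germ m).sg ⟨i, h⟩) = 1 ∧
    (germ m).sg ⟨i, h⟩ = 0 ∧
    (if (germ m).sg ⟨i, h⟩ = 0 then C'.sg ⟨i, h⟩ else (germ m).sg ⟨i, h⟩) = 1 ↔ _
  rw [← e]
  constructor
  · rintro ⟨h1, h2, h3⟩
    rw [if_pos h2] at h1 h3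
    exact ⟨h2, h1, h3⟩
  · rintro ⟨h2, h1, h3⟩
    rw [if_pos h2, if_pos h2]
    exact ⟨h1, h2, h3⟩

open Classical in
-- Of the four arrows only the one with both chambers on the positive side counts. It is one of the
-- two arrows with coefficient `+1`, whichever side `K` lies on.
lemma wind_omegaChain {i : ι} (hG : A.above G.pts = {i}) (j : ι) (K : A.Chamber (A.loc F)) :
    Finsupp.linearCombination ℚ (wind j) (omegaChain m K) = if j = i then 1 else 0 := by
  have hiff : j ∈ A.loc G ↔ j = i := by
    change j ∈ A.above G.pts ↔ _
    rw [hG]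
    rfl
  rw [omegaChain, map_add, map_sub, map_sub, Finsupp.linearCombination_single,
    Finsupp.linearCombination_single, Finsupp.linearCombination_single,
    Finsupp.linearCombination_single, wind_omegaArr, wind_omegaArr, wind_omegaArr, wind_omegaArr]
  by_cases hj : j = i
  · have hjG := hiff.2 hj
    have hjF := loc_mono m hjG
    rw [dif_pos hjF, dif_pos hjF, dif_pos hjF, dif_pos hjF, if_pos hj]
    have h0 := K.ne_zero ⟨j, hjF⟩
    have hneg : K.neg.sg ⟨j, hjF⟩ = -K.sg ⟨j, hjF⟩ := rfl
    rw [hneg]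
    simp only [hjG, true_and]
    generalize K.sg ⟨j, hjF⟩ = σ at h0 ⊢
    cases σ
    · exact absurd rfl h0
    · simp
    · simp
  · have hjG := mt hiff.1 hj
    simp [hjG, hj]

lemma shiftForm_omegaChain (l : Fin d → ℚ) (K : A.Chamber (A.loc F)) :
    Finsupp.linearCombination ℚ (shiftForm l) (omegaChain m K) = 0 := by
  have h : ∀ C C' : A.Chamber (A.loc F), shiftForm l (Arrow.mk (omegaArr m C C')) = 0 := by
    intro C C'
    have : (omegaArr m C C').base.unop.1 = 0 := rfl
    simp [shiftForm, this]
  rw [omegaChain, map_add, map_sub, map_sub, Finsupp.linearCombination_single,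
    Finsupp.linearCombination_single, Finsupp.linearCombination_single,
    Finsupp.linearCombination_single, h, h, h, h]
  simp

/-- Move from `F` in a generic direction of the `i`-th hyperplane; this leaves every other
hypertorus through `F`. -/
lemma exists_hom_above_eq {F : A.Face} {i : ι} (hi : i ∈ A.loc F) :
    ∃ (G : A.Face) (_ : F ⟶ G), A.above G.pts = {i} := by
  obtain ⟨u, hu, hgen⟩ := exists_generic (A := A) (LinearMap.ker (A.ev i)) (A.loc F \ {i})
    (fun j hj hle => hj.2 (eq_of_mem_loc hi hj.1 hle).symm)
  obtain ⟨t, G, m, -, hsign⟩ := exists_hom_toward F u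
  refine ⟨G, m, Set.eq_singleton_iff_unique_mem.2 ⟨?_, fun j hj => ?_⟩⟩
  · refine (germ_eq_zero_iff m hi).1 ?_
    rw [← sign_eq_zero_iff, hsign i hi, sign_eq_zero_iff]
    exact hu
  · by_contra hne
    have hjF := loc_mono m hj
    refine hgen j ⟨hjF, hne⟩ ?_
    rw [← sign_eq_zero_iff, ← hsign j hjF, sign_eq_zero_iff]
    exact (germ_eq_zero_iff m hjF).2 hj

lemma exists_face_loc (A : ToricArrangement ι d) (i : ι) : ∃ F : A.Face, i ∈ A.loc F := by
  obtain ⟨L, hL⟩ := exists_layer_hyp A i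
  obtain ⟨x, hx⟩ := layer_nonempty L
  exact ⟨Face.mk x, mem_loc_mk.2 (hL ▸ hx)⟩

/-- The subcomplex contains a cycle around the `i`-th hypertorus. -/
def HasOmega {D : Type} [Category.{0} D] (Φ : D ⥤ A.Sal) (K : A.Chamber Set.univ) (i : ι) : Prop :=
  ∃ (F G : A.Face) (m : F ⟶ G), A.above G.pts = {i} ∧
    ∃ z : CatHom.Cycles D, CatHom.chainMap Φ z.1
      = omegaChain m (K.restrict (A.loc F) (Set.subset_univ _))

lemma hasOmega_sal (K : A.Chamber Set.univ) (i : ι) : HasOmega (𝟭 A.Sal) K i := by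
  obtain ⟨F, hF⟩ := exists_face_loc A i
  obtain ⟨G, m, hG⟩ := exists_hom_above_eq hF
  exact ⟨F, G, m, hG, ⟨_, bdry_omegaChain m _⟩, CatHom.chainMap_id _⟩

lemma subProp_omegaV {Y : A.Layer} {F₀ : A.LFace Set.univ} (hF : F.pts ⊆ Y.1)
    (C : A.Chamber (A.loc F)) : A.subProp Y F₀ (omegaV m C) :=
  ⟨hF, inStratum_of_chamber (s := A.loc F) ((germ m).compCh C).ne_zero⟩

/-- Only the `i`-th sign of the chamber is free in `[F_m, C]`, and there `F₀` vanishes, so a chamber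
next to `F₀` can be found on either side. -/
lemma subProp_omegaE {Y : A.Layer} {F₀ : A.LFace Set.univ} (hF : F.pts ⊆ Y.1) {i : ι}
    (h0 : F₀.sg ⟨i, trivial⟩ = 0) (hG : A.above G.pts = {i}) (K : A.Chamber Set.univ)
    {C : A.Chamber (A.loc F)} (hC : ∀ j, C.sg j = K.at j) : A.subProp Y F₀ (omegaE m C) := by
  refine ⟨hF, (F₀.compCh K).restrict (A.loc F) (Set.subset_univ _), fun j => le_compCh F₀ K _,
    Chamber.ext_sg fun j => ?_⟩
  change (if (germ m).sg j = 0 then C.sg j else (germ m).sg j) = if (germ m).sg j = 0 then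
    (if F₀.sg ⟨j, trivial⟩ = 0 then K.at j else F₀.sg ⟨j, trivial⟩) else (germ m).sg j
  split_ifs with h1 h2
  · exact hC j
  · exfalso
    have hj : j.1 ∈ A.above G.pts := (germ_eq_zero_iff m j.2).1 (sign_eq_zero_iff.1 h1)
    rw [hG] at hj
    obtain ⟨j, hjF⟩ := j
    obtain rfl : j = i := hj
    exact h2 h0
  · rfl

lemma hasOmega_subSal {Y : A.Layer} {F₀ : A.LFace Set.univ} {i : ι} (hi : i ∈ A.above Y.1)
    (h0 : F₀.sg ⟨i, trivial⟩ = 0) (K : A.Chamber Set.univ) : HasOmega (A.subIncl Y F₀) K i := by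
  classical
  obtain ⟨x, hx⟩ := layer_nonempty Y
  have hF : (Face.mk x : A.Face).pts ⊆ Y.1 := mk_subset_layer_iff.2 hx
  obtain ⟨G, m, hG⟩ := exists_hom_above_eq (above_subset_loc hF hi)
  refine ⟨Face.mk x, G, m, hG, CatHom.exists_chain_lift _ (bdry_omegaChain m _) fun f hf => ?_⟩
  have hE := subProp_omegaE m hF h0 hG K
    (C := K.restrict (A.loc (Face.mk x)) (Set.subset_univ _)) fun j => rfl
  have hE' := subProp_omegaE m hF h0 hG K.neg
    (C := (K.restrict (A.loc (Face.mk x)) (Set.subset_univ _)).neg) fun j => rfl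
  set K₁ := K.restrict (A.loc (Face.mk x)) (Set.subset_univ _)
  have hmem : omegaChain m K₁ ∈ Finsupp.supported ℚ ℚ {f : Arrow A.Sal |
      A.subProp Y F₀ f.left ∧ A.subProp Y F₀ f.right} := by
    refine Submodule.add_mem _ (Submodule.sub_mem _ (Submodule.sub_mem _
      (Finsupp.single_mem_supported _ _ ?_) (Finsupp.single_mem_supported _ _ ?_))
      (Finsupp.single_mem_supported _ _ ?_)) (Finsupp.single_mem_supported _ _ ?_)
    · exact ⟨subProp_omegaV m hF _, hE⟩
    · exact ⟨subProp_omegaV m hF _, hE'⟩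
    · exact ⟨subProp_omegaV m hF _, hE⟩
    · exact ⟨subProp_omegaV m hF _, hE'⟩
  exact (Finsupp.mem_supported _ _).1 hmem hf

theorem exists_pairing_omegaHat (hA : A.Essential) {D : Type} [Category.{0} D] {Φ : D ⥤ A.Sal}
    {K : A.Chamber Set.univ} {i : ι} (h : HasOmega Φ K i) :
    ∃ (F G : A.Face) (m : F ⟶ G), A.above G.pts = {i} ∧ ∀ c : CatHom.Cocycles A.Sal,
      CatHom.pairing (CatHom.pull Φ (Submodule.Quotient.mk c)) (omegaHat K i Φ) =
        Finsupp.linearCombination ℚ c.1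
          (omegaChain m (K.restrict (A.loc F) (Set.subset_univ _))) := by
  obtain ⟨F, G, m, hG, w, hw⟩ := h
  have hi : ∀ {G : A.Face}, A.above G.pts = {i} → i ∈ A.loc G := fun h => by
    rw [loc, h]
    rfl
  have hspec : ∃ (F G : A.Face) (m : F ⟶ G), A.above G.pts = {i} ∧ ∃ z : CatHom.Cycles D,
      CatHom.H1.cls D z = omegaHat K i Φ ∧ IsOmegaCycle m K (CatHom.chainMap Φ z.1) :=
    Classical.epsilon_spec (p := fun c => ∃ (F G : A.Face) (m : F ⟶ G), A.above G.pts = {i} ∧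
      ∃ z : CatHom.Cycles D, CatHom.H1.cls D z = c ∧ IsOmegaCycle m K (CatHom.chainMap Φ z.1))
      ⟨_, F, G, m, hG, w, rfl, hw ▸ isOmegaCycle_omegaChain m hA (hi hG) K⟩
  obtain ⟨F, G, m, hG, z, hz, hcyc⟩ := hspec
  refine ⟨F, G, m, hG, fun c => ?_⟩
  rw [← hz, CatHom.pairing_pull_mk,
    hcyc.unique hA (hi hG) (isOmegaCycle_omegaChain m hA (hi hG) K)]

end Omega

end ToricArrangement

/-! ### Detecting and transporting homology classes by their pairings. -/

namespace CatHom

universe v u v' u'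

variable {C : Type u} [Category.{v} C] {D : Type u'} [Category.{v'} D]

lemma eq_zero_of_forall_pairing {x : H1 C} (h : ∀ c, pairing c x = 0) : x = 0 := by
  obtain ⟨z, rfl⟩ := cls_surjective x
  exact cls_eq_zero_of_forall_cocycle z fun c => h (Submodule.Quotient.mk c)

/-- The transpose of the restriction. -/
lemma exists_push (Φ : D ⥤ C) (y : H1 D) :
    ∃ y' : H1 C, ∀ x, pairing (pull Φ x) y = pairing x y' := by
  obtain ⟨z, rfl⟩ := cls_surjective y
  exact ⟨_, fun x => pairing_pull Φ x z⟩

end CatHom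

/-- A basis of a space that embeds into a product, adapted to one of the factors. -/
lemma exists_basis_of_block {V Q : Type*} [AddCommGroup V] [Module ℚ V] [AddCommGroup Q]
    [Module ℚ Q] [FiniteDimensional ℚ Q] {S : Type*} [Fintype S] [DecidableEq S] {k : ℕ}
    (W : V →ₗ[ℚ] (S → ℚ)) (T : V →ₗ[ℚ] Q) (hinj : ∀ x, W x = 0 → T x = 0 → x = 0)
    (hQ : Module.finrank ℚ Q ≤ k) (lam : Fin k → V) (om : S → V)
    (hom : ∀ i, W (om i) = Pi.single i 1) (hom' : ∀ i, T (om i) = 0)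
    (hlam : LinearIndependent ℚ (fun h => T (lam h))) :
    ∃ β : Module.Basis (Fin k ⊕ S) ℚ V, (∀ h, β (Sum.inl h) = lam h) ∧
      ∀ i, β (Sum.inr i) = om i := by
  -- The embedding bounds the dimension from above by `Fintype.card S + k`; the given vectors are
  -- block triangular for it, hence independent, and there are exactly that many of them.
  have hI : Function.Injective (W.prod T) := by
    rw [← LinearMap.ker_eq_bot, LinearMap.ker_eq_bot']
    intro x hx
    exact hinj x (congrArg Prod.fst hx) (congrArg Prod.snd hx)
  have hfin : FiniteDimensional ℚ V := FiniteDimensional.of_injective _ hI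
  have hle : Module.finrank ℚ V ≤ Fintype.card S + k := by
    refine (LinearMap.finrank_le_finrank_of_injective hI).trans ?_
    rw [Module.finrank_prod, Module.finrank_fintype_fun_eq_card]
    omega
  have hind : LinearIndependent ℚ (Sum.elim lam om) := by
    rw [Fintype.linearIndependent_iff] at hlam ⊢
    intro c hc
    rw [Fintype.sum_sum_type] at hc
    simp only [Sum.elim_inl, Sum.elim_inr] at hc
    have h1 : ∀ h, c (Sum.inl h) = 0 := by
      refine hlam _ ?_
      have := congrArg T hc
      rw [map_add, map_sum, map_sum, map_zero] at this
      simpa [hom'] using this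
    have h2 : ∀ i, c (Sum.inr i) = 0 := by
      intro i
      have := congrFun (congrArg W hc) i
      rw [map_add, map_sum, map_sum, map_zero] at this
      simpa [h1, hom, Pi.single_apply] using this
    rintro (h | i)
    · exact h1 h
    · exact h2 i
  have hcard : Fintype.card (Fin k ⊕ S) = Module.finrank ℚ V := by
    refine le_antisymm hind.fintype_card_le_finrank ?_
    rw [Fintype.card_sum, Fintype.card_fin]
    omega
  have hne : ∀ x, (basisOfLinearIndependentOfCardEqFinrank' _ hind hcard) x = Sum.elim lam om x :=
    fun x => by rw [coe_basisOfLinearIndependentOfCardEqFinrank']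
  exact ⟨_, fun h => hne (Sum.inl h), fun i => hne (Sum.inr i)⟩

/-! ### Winding numbers and displacement as linear maps on homology. -/

namespace ToricArrangement

variable {ι : Type} {d : ℕ} {A : ToricArrangement ι d}

variable (A) in
/-- The rational vectors annihilated by a set of characters. -/
def charKer (S : Set ι) : Submodule ℚ (Fin d → ℚ) where
  carrier := {q | ∀ i ∈ S, ∑ j, (A.char i j : ℚ) * q j = 0}
  add_mem' := by
    intro a b ha hb i hi
    simp only [Pi.add_apply, mul_add, Finset.sum_add_distrib, ha i hi, hb i hi, add_zero]
  zero_mem' := by intro i _; simp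
  smul_mem' := by
    intro r a ha i hi
    simp only [Pi.smul_apply, smul_eq_mul, mul_left_comm _ r, ← Finset.mul_sum, ha i hi, mul_zero]

/-- Rational vectors independent over `ℚ` stay independent over `ℝ`, and they lie in the space of
directions of `L`. -/
lemma finrank_charKer_le (L : A.Layer) :
    Module.finrank ℚ (A.charKer (A.above L.1)) ≤ A.dim L.1 := by
  let b := Module.finBasis ℚ (A.charKer (A.above L.1))
  have hb1 : LinearIndependent ℚ (fun n => (b n : Fin d → ℚ)) :=
    LinearIndependent.map' (v := fun n => b n) b.linearIndependent
      (A.charKer (A.above L.1)).subtype (Submodule.ker_subtype _)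
  have hb2 : LinearIndependent ℝ (fun n => algebraMap ℚ ℝ ∘ (b n : Fin d → ℚ)) :=
    (linearIndependent_algebraMap_comp_iff (R := ℚ) (S := ℝ)
      (v := fun n => (b n : Fin d → ℚ))).2 hb1
  have hmem : ∀ n, algebraMap ℚ ℝ ∘ (b n : Fin d → ℚ) ∈ A.dirSpace L.1 := by
    intro n
    rw [mem_dirSpace]
    intro i hi
    have h1 := (b n).2 i hi
    rw [ev_apply]
    have h2 := congrArg (fun q : ℚ => (q : ℝ)) h1
    push_cast at h2
    simpa using h2
  have hb3 : LinearIndependent ℝ (fun n => (⟨_, hmem n⟩ : A.dirSpace L.1)) :=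
    LinearIndependent.of_comp (A.dirSpace L.1).subtype hb2
  have := hb3.fintype_card_le_finrank
  rwa [Fintype.card_fin] at this

variable [Finite ι]

section Maps

variable {D : Type} [Category.{0} D] (Φ : D ⥤ A.Sal)

/-- The winding numbers of a class around the hypertori. -/
noncomputable def windMap : CatHom.H1 D →ₗ[ℚ] (ι → ℚ) :=
  LinearMap.pi fun i => CatHom.pairing (CatHom.pull Φ (Submodule.Quotient.mk (A.windCocycle i)))

/-- The image of a class in the first homology of the torus. -/
noncomputable def transMap : CatHom.H1 D →ₗ[ℚ] (Fin d → ℚ) :=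
  LinearMap.pi fun j =>
    CatHom.pairing (CatHom.pull Φ (Submodule.Quotient.mk (A.shiftCocycle (Pi.single j 1))))

lemma shiftCocycle_eq (l : Fin d → ℚ) :
    A.shiftCocycle l = ∑ j, l j • A.shiftCocycle (Pi.single j 1) := by
  refine Subtype.ext ?_
  rw [AddSubmonoidClass.coe_finsetSum]
  funext f
  rw [Finset.sum_apply]
  change ∑ j, l j * (f.hom.base.unop.1 j : ℚ) = _
  refine Finset.sum_congr rfl fun j _ => ?_
  change _ = l j * ∑ j', (Pi.single j 1 : Fin d → ℚ) j' * (f.hom.base.unop.1 j' : ℚ)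
  simp [Pi.single_apply]

lemma pairing_shiftCocycle (l : Fin d → ℚ) (x : CatHom.H1 D) :
    CatHom.pairing (CatHom.pull Φ (Submodule.Quotient.mk (A.shiftCocycle l))) x
      = ∑ j, l j * transMap Φ x j := by
  have h : (Submodule.Quotient.mk (A.shiftCocycle l) : CatHom.Coh1 A.Sal)
      = ∑ j, l j • Submodule.Quotient.mk (A.shiftCocycle (Pi.single j 1)) := by
    rw [shiftCocycle_eq l]
    change Submodule.mkQ _ _ = _
    rw [map_sum]
    rfl
  rw [h, map_sum, map_sum, LinearMap.sum_apply]
  refine Finset.sum_congr rfl fun j _ => ?_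
  rw [map_smul, map_smul, LinearMap.smul_apply, smul_eq_mul]
  rfl

variable {Φ}

open Classical in
lemma windMap_lambdaHat (hA : A.Essential) {M : A.Line} (g : A.LineGallery M)
    {B : A.Chamber Set.univ}
    (h : ∃ z : CatHom.Cycles D, CatHom.chainMap Φ z.1 = g.lambdaChain B) (i : ι) :
    windMap Φ (g.lambdaHat B Φ) i =
      meetCount M i * (if B.at i = 1 then (((g.chm 0).at i : ℤ) : ℚ) else 0) :=
  (g.pairing_lambdaHat hA h _).trans (g.wind_lambdaChain B i)

lemma transMap_lambdaHat (hA : A.Essential) {M : A.Line} (g : A.LineGallery M)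
    {B : A.Chamber Set.univ}
    (h : ∃ z : CatHom.Cycles D, CatHom.chainMap Φ z.1 = g.lambdaChain B) :
    transMap Φ (g.lambdaHat B Φ) = g.translation := by
  funext j
  refine (g.pairing_lambdaHat hA h _).trans ((g.shiftForm_lambdaChain B _).trans ?_)
  simp [Pi.single_apply]

lemma windMap_omegaHat (hA : A.Essential) [DecidableEq ι] {K : A.Chamber Set.univ} {i : ι}
    (h : HasOmega Φ K i) : windMap Φ (omegaHat K i Φ) = Pi.single i 1 := by
  classical
  obtain ⟨F, G, m, hG, hp⟩ := exists_pairing_omegaHat hA h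
  funext j
  refine (hp _).trans ((wind_omegaChain m hG j _).trans ?_)
  rw [Pi.single_apply]
  by_cases hji : j = i <;> simp [hji]

lemma transMap_omegaHat (hA : A.Essential) {K : A.Chamber Set.univ} {i : ι}
    (h : HasOmega Φ K i) : transMap Φ (omegaHat K i Φ) = 0 := by
  obtain ⟨F, G, m, -, hp⟩ := exists_pairing_omegaHat hA h
  funext j
  exact (hp _).trans (shiftForm_omegaChain m _ _)

end Maps

/-! ### Injectivity of the period maps -/

/-- If all cocycles of `D` are, up to coboundaries, combinations of restricted standard ones, then a
class without periods pairs to zero with all of cohomology and must vanish. -/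
lemma eq_zero_of_periods {D : Type} [Category.{0} D] {Φ : D ⥤ A.Sal} {S : Set ι}
    (h : ∀ c : CatHom.Cocycles D, ∃ (a : ι → ℚ) (l : Fin d → ℚ) (u : D → ℚ),
      (∀ i, a i ≠ 0 → i ∈ S) ∧ ∀ f : Arrow D, c.1 f =
        ∑ᶠ i, a i * wind i (Φ.mapArrow.obj f) + shiftForm l (Φ.mapArrow.obj f)
          + (u f.right - u f.left))
    {x : CatHom.H1 D} (hw : ∀ i ∈ S, windMap Φ x i = 0) (ht : transMap Φ x = 0) : x = 0 := by
  have := Fintype.ofFinite ι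
  refine CatHom.eq_zero_of_forall_pairing fun c => ?_
  obtain ⟨c, rfl⟩ := Submodule.Quotient.mk_surjective _ c
  obtain ⟨a, l, u, ha, hc⟩ := h c
  have hcoh : (Submodule.Quotient.mk c : CatHom.Coh1 D)
      = ∑ i, a i • CatHom.pull Φ (Submodule.Quotient.mk (A.windCocycle i))
        + CatHom.pull Φ (Submodule.Quotient.mk (A.shiftCocycle l)) := by
    have e : ∑ i, a i • CatHom.pull Φ (Submodule.Quotient.mk (A.windCocycle i))
        + CatHom.pull Φ (Submodule.Quotient.mk (A.shiftCocycle l))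
        = Submodule.Quotient.mk (∑ i, a i • CatHom.pullCocycles Φ (A.windCocycle i)
          + CatHom.pullCocycles Φ (A.shiftCocycle l)) := by
      change _ = Submodule.mkQ _ _
      rw [map_add, map_sum]
      rfl
    rw [e, Submodule.Quotient.eq]
    refine ⟨u, ?_⟩
    funext f
    change u f.right - u f.left = c.1 f
      - (((∑ i, a i • CatHom.pullCocycles Φ (A.windCocycle i) : CatHom.Cocycles D) :
        Arrow D → ℚ) f + shiftForm l (Φ.mapArrow.obj f))
    rw [AddSubmonoidClass.coe_finsetSum, Finset.sum_apply, hc, finsum_eq_sum_of_fintype]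
    change _ = ∑ i, a i * wind i (Φ.mapArrow.obj f) + _ + _
      - (∑ i, a i * wind i (Φ.mapArrow.obj f) + _)
    ring
  rw [hcoh, map_add, map_sum, LinearMap.add_apply, LinearMap.sum_apply, pairing_shiftCocycle, ht]
  simp only [Pi.zero_apply, mul_zero, Finset.sum_const_zero, add_zero]
  refine Finset.sum_eq_zero fun i _ => ?_
  rw [map_smul, LinearMap.smul_apply, smul_eq_mul]
  by_cases h0 : a i = 0
  · rw [h0, zero_mul]
  · exact mul_eq_zero_of_right _ (hw i (ha i h0))

/-- For `F₀ = 0` the stratum of the torus is all of `Sal(𝒜)`. Connectedness holds since a hypertorus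
given by a primitive character is itself a layer. -/
lemma sal_eq_zero_of_periods (hA : A.Essential) {x : CatHom.H1 A.Sal}
    (hw : windMap (𝟭 A.Sal) x = 0) (ht : transMap (𝟭 A.Sal) x = 0) : x = 0 := by
  have := Fintype.ofFinite ι
  refine eq_zero_of_periods (S := Set.univ) (fun c => ?_) (fun i _ => congrFun hw i) ht
  have hall : ∀ X : A.Sal, A.subProp A.torus (A.zeroFace _) X := by
    intro X
    obtain ⟨F, x, rfl⟩ := exists_pt X
    refine ⟨Set.subset_univ _, x.ch, zeroFace_le _, Chamber.ext_sg fun i => ?_⟩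
    change x.ch.sg i = if x.face.sg i = 0 then x.ch.sg i else x.face.sg i
    split_ifs with h
    · rfl
    · exact ((x.le i).resolve_left h).symm
  have hc : A.IsCocycleOn A.torus (A.zeroFace _) c.1 := by
    intro X X' X'' f g _ _ _
    have := c.2 _ _ _ f g
    linarith
  obtain ⟨a, l, u, -, h⟩ := hc.exists_standard_form hA (fun i _ _ => by
    obtain ⟨L, hL⟩ := exists_layer_hyp A i
    exact ⟨L, hL.trans (Set.univ_inter _).symm⟩)
  refine ⟨a, l, u, fun _ _ => trivial, fun f => ?_⟩
  rw [finsum_eq_sum_of_fintype]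
  exact h f.hom (hall _) (hall _)

/-- A hypertorus meeting `L` whose hyperplane contains `F₀` contains the directions of `L`, hence
all of `L`. So its intersection with `L` is `L` itself, and only windings around hypertori
containing `L` can occur. -/
lemma subSal_eq_zero_of_periods (hA : A.Essential) {L : A.Layer} {F₀ : A.LFace Set.univ}
    (hF : F₀.hull = A.dirSpace L.1) {x : CatHom.H1 (A.SubSal L F₀)}
    (hw : ∀ i ∈ A.above L.1, windMap (A.subIncl L F₀) x i = 0)
    (ht : transMap (A.subIncl L F₀) x = 0) : x = 0 := by
  classical
  have := Fintype.ofFinite ι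
  have habove : ∀ i, F₀.sg ⟨i, trivial⟩ = 0 → (∃ F : A.Face, F.pts ⊆ L.1 ∧ i ∈ A.loc F) →
      i ∈ A.above L.1 := by
    rintro i h0 ⟨F, hFL, hi⟩
    have h1 := LFace.hull_le_ker h0
    rw [hF] at h1
    exact mem_above_layer L h1 (hFL F.rep_mem) (hi F.rep_mem)
  refine eq_zero_of_periods (S := A.above L.1) (fun c => ?_) hw ht
  -- The cocycle of the stratum, extended by zero to arrows that are not between its objects.
  let c' : Arrow A.Sal → ℚ := fun f => if h : A.subProp L F₀ f.left ∧ A.subProp L F₀ f.right then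
    c.1 (Arrow.mk ((A.subProp L F₀).homMk f.hom :
      (⟨f.left, h.1⟩ : A.SubSal L F₀) ⟶ ⟨f.right, h.2⟩)) else 0
  have hc' : ∀ {X X' : A.Sal} (f : X ⟶ X') (hX : A.subProp L F₀ X) (hX' : A.subProp L F₀ X'),
      c' (Arrow.mk f) = c.1 (Arrow.mk ((A.subProp L F₀).homMk f :
        (⟨X, hX⟩ : A.SubSal L F₀) ⟶ ⟨X', hX'⟩)) := by
    intro X X' f hX hX'
    exact dif_pos (show A.subProp L F₀ (Arrow.mk f).left ∧ A.subProp L F₀ (Arrow.mk f).right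
      from ⟨hX, hX'⟩)
  have hc : A.IsCocycleOn L F₀ c' := by
    intro X X' X'' f g hX hX' hX''
    rw [hc' f hX hX', hc' g hX' hX'', hc' (f ≫ g) hX hX'']
    have := c.2 ⟨X, hX⟩ ⟨X', hX'⟩ ⟨X'', hX''⟩ ((A.subProp L F₀).homMk f)
      ((A.subProp L F₀).homMk g)
    have e : ((A.subProp L F₀).homMk f : (⟨X, hX⟩ : A.SubSal L F₀) ⟶ ⟨X', hX'⟩)
        ≫ ((A.subProp L F₀).homMk g : (⟨X', hX'⟩ : A.SubSal L F₀) ⟶ ⟨X'', hX''⟩)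
        = (A.subProp L F₀).homMk (f ≫ g) := rfl
    rw [e] at this
    linarith
  obtain ⟨a, l, u, ha, h⟩ := hc.exists_standard_form hA (fun i h0 hex => by
    exact ⟨L, (Set.inter_eq_left.2 (habove i h0 hex)).symm⟩)
  refine ⟨a, l, fun X => u X.obj, fun i hi => habove i (ha i hi).1 (ha i hi).2, fun f => ?_⟩
  rw [finsum_eq_sum_of_fintype]
  exact (hc' f.hom.hom f.left.property f.right.property).symm.trans
    (h f.hom.hom f.left.property f.right.property)

/-- The characters of the hypertori containing a layer vanish on the classes of its stratum. -/
lemma transMap_mem_charKer (L : A.Layer) (F₀ : A.LFace Set.univ)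
    (x : CatHom.H1 (A.SubSal L F₀)) : transMap (A.subIncl L F₀) x ∈ A.charKer (A.above L.1) := by
  intro i hi
  have key : CatHom.pull (A.subIncl L F₀)
      (Submodule.Quotient.mk (A.shiftCocycle fun j => (A.char i j : ℚ))) = 0 := by
    -- The integer level on which the chosen lift of the face lies is a potential for the cocycle of
    -- the `i`-th character.
    have hn : ∀ X : A.SubSal L F₀, ∃ n : ℤ, A.ev i X.obj.base.unop.rep = A.shift i + n :=
      fun X => (X.property.1.trans hi) (Face.rep_mem _)
    choose n hn using hn
    refine (Submodule.Quotient.mk_eq_zero _).2 ⟨fun X => (n X : ℚ), ?_⟩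
    funext f
    set m := f.hom.hom.base.unop with hm
    change (n f.right : ℚ) - (n f.left : ℚ) = ∑ j, (A.char i j : ℚ) * (m.1 j : ℚ)
    have h1 : f.left.obj.base.unop.rep + lat m.1 ∈ A.hyp i := by
      rw [hyp_add_lat]
      exact ⟨_, hn f.left⟩
    have h2 := hyp_iff_of_faceLE m.2 h1
    rw [map_add, ev_lat, hn f.right, hn f.left] at h2
    have h3 : ((n f.right : ℤ) : ℝ) = ((n f.left + ∑ j, A.char i j * m.1 j : ℤ) : ℝ) := by
      push_cast at h2 ⊢
      linarith
    have h4 : n f.right = n f.left + ∑ j, A.char i j * m.1 j := by exact_mod_cast h3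
    rw [h4]
    push_cast
    ring
  rw [← pairing_shiftCocycle, key, map_zero, LinearMap.zero_apply]

end ToricArrangement

/-! ### Signs, and the homology bases of the strata and of the whole complex. -/

namespace ToricArrangement

variable {ι : Type} {d : ℕ} {A : ToricArrangement ι d}

lemma meetCount_eq_zero {M : A.Line} {i : ι} (h : i ∈ A.above M.1.1) : meetCount M i = 0 := by
  have : {P : A.Face | P.pts ⊆ M.1.1 ∧ i ∈ A.loc P ∧ i ∉ A.above M.1.1} = ∅ :=
    Set.eq_empty_of_forall_notMem fun P hP => hP.2.2 h
  rw [meetCount, this, Set.ncard_empty]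

lemma eps_eq (i : ι) (K C : A.Chamber Set.univ) :
    eps i K C = (((K.at i * C.at i : SignType) : ℤ) : ℚ) := by
  have h1 : K.at i ≠ 0 := K.ne_zero _
  have h2 : C.at i ≠ 0 := C.ne_zero _
  by_cases h : Separates i K C
  · rw [eps, if_pos h, show C.at i = -K.at i from eq_neg_of_ne h1 h2 h]
    generalize K.at i = κ at h1 ⊢
    cases κ <;> simp at h1 ⊢
  · rw [eps, if_neg h, show C.at i = K.at i from (not_not.1 h).symm]
    generalize K.at i = κ at h1 ⊢
    cases κ <;> simp at h1 ⊢

/-- The sign of `ᴴC` enters twice and cancels, leaving the product of the signs of `C` and `B`. -/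
lemma eps_mul_eps (i : ι) (K C B : A.Chamber Set.univ) :
    eps i K C * eps i K B = (((C.at i * B.at i : SignType) : ℤ) : ℚ) := by
  rw [eps_eq, eps_eq]
  have h1 : K.at i ≠ 0 := K.ne_zero _
  generalize K.at i = κ at h1 ⊢
  generalize C.at i = σ
  generalize B.at i = τ
  cases κ <;> simp at h1 ⊢

variable [Finite ι]

open Classical in
-- The right side is a difference of two winding numbers. If `i` separates `B` from `B'`, exactly
-- one term survives, with the sign of `C` times that of `B`; this is the summand on the left,
-- repeated once for each point where `M` meets the hypertorus. Otherwise both sides vanish.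
lemma finsum_eps {M : A.Line} (i : ι) (K C B B' : A.Chamber Set.univ) :
    (∑ᶠ (P : A.Face) (_ : P.pts ⊆ M.1.1 ∧ i ∈ sepSet P B B' \ A.above M.1.1),
      eps i K C * eps i K B) =
    meetCount M i * (if B.at i = 1 then ((C.at i : ℤ) : ℚ) else 0)
      - meetCount M i * (if B'.at i = 1 then ((C.at i : ℤ) : ℚ) else 0) := by
  by_cases hs : Separates i B B'
  · have hset : ∀ P : A.Face, (P.pts ⊆ M.1.1 ∧ i ∈ sepSet P B B' \ A.above M.1.1) ↔
        P ∈ {P : A.Face | P.pts ⊆ M.1.1 ∧ i ∈ A.loc P ∧ i ∉ A.above M.1.1} := fun P =>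
      ⟨fun h => ⟨h.1, h.2.1.1, h.2.2⟩, fun h => ⟨h.1, ⟨h.2.1, hs⟩, h.2.2⟩⟩
    have hsum : ∀ (s : Set A.Face) (c : ℚ), ∑ᶠ P ∈ s, c = s.ncard * c := by
      intro s c
      rw [finsum_mem_eq_finite_toFinset_sum _ (Set.toFinite s), Finset.sum_const, nsmul_eq_mul,
        Set.ncard_eq_toFinset_card s (Set.toFinite s)]
    simp only [hset]
    rw [hsum, eps_mul_eps, ← meetCount, ← mul_sub]
    congr 1
    have h2 := B.ne_zero ⟨i, trivial⟩
    have h3 := B'.ne_zero ⟨i, trivial⟩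
    change B.at i ≠ B'.at i at hs
    change B.at i ≠ 0 at h2
    change B'.at i ≠ 0 at h3
    generalize B.at i = σ at h2 hs ⊢
    generalize B'.at i = τ at h3 hs ⊢
    generalize C.at i = κ
    cases σ <;> cases τ <;> simp at h2 h3 hs ⊢
  · have he : B.at i = B'.at i := not_not.1 hs
    have hf : ∀ P : A.Face, ¬ (P.pts ⊆ M.1.1 ∧ i ∈ sepSet P B B' \ A.above M.1.1) :=
      fun P h => hs h.2.1.2
    rw [he, sub_self]
    simp only [hf, finsum_false, finsum_zero]

lemma sg_eq_zero_of_mem_above {L : A.Layer} {F₀ : A.LFace Set.univ}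
    (hF : F₀.hull = A.dirSpace L.1) {i : ι} (hi : i ∈ A.above L.1) :
    F₀.sg ⟨i, trivial⟩ = 0 := by
  refine LFace.sg_eq_zero_of_hull_le ?_
  rw [hF]
  exact iInf₂_le i hi

section Stratum

variable (hA : A.Essential) (gal : ∀ M : A.Line, A.LineGallery M) {L : A.Layer}
  {F₀ : A.LFace Set.univ} {B : A.Chamber Set.univ} (hB : F₀ ≤ B.toLFace)
  (hF : F₀.hull = A.dirSpace L.1)

include hA hB hF in
-- A hypertorus containing `L` contains each `N h`, so these classes have no winding around it. On
-- their span a class with zero displacement thus has no periods, and `transMap` is injective there.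
lemma linearIndependent_translation {J : Type*} {N : J → A.Line} (hNL : ∀ h, (N h).1.1 ⊆ L.1)
    (hN : LinearIndependent ℚ (fun h => (gal (N h)).lambdaHat B (A.subIncl L F₀))) :
    LinearIndependent ℚ (fun h => (gal (N h)).translation) := by
  have hex := fun h => (gal (N h)).exists_cycle_subSal hA (hNL h) hB
  have e : (fun h => (gal (N h)).translation) = transMap (A.subIncl L F₀) ∘
      (fun h => (gal (N h)).lambdaHat B (A.subIncl L F₀)) :=
    funext fun h => (transMap_lambdaHat hA (gal (N h)) (hex h)).symm
  rw [e]
  refine hN.map (Submodule.disjoint_def.2 fun x hx hx0 => ?_)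
  refine subSal_eq_zero_of_periods hA hF (fun i hi => ?_) hx0
  have hle : Submodule.span ℚ (Set.range fun h =>
      (gal (N h)).lambdaHat B (A.subIncl L F₀)) ≤
      LinearMap.ker (LinearMap.proj i ∘ₗ windMap (A.subIncl L F₀)) := by
    rw [Submodule.span_le]
    rintro _ ⟨h, rfl⟩
    refine (windMap_lambdaHat hA (gal (N h)) (hex h) i).trans ?_
    rw [meetCount_eq_zero ((hNL h).trans hi), Nat.cast_zero, zero_mul]
  exact hle hx

include hA hB hF in
-- Windings around the hypertori containing `L` and displacements embed the homology. The
-- displacements lie in the common rational kernel of the characters of these hypertori, of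
-- dimension at most `dim L`, and this bounds the dimension by the number of given classes.
theorem exists_stratum_basis (K : ι → A.Chamber Set.univ) {N : Fin (A.dim L.1) → A.Line}
    (hNL : ∀ h, (N h).1.1 ⊆ L.1)
    (hN : LinearIndependent ℚ (fun h => (gal (N h)).lambdaHat B (A.subIncl L F₀))) :
    ∃ β : Module.Basis (Fin (A.dim L.1) ⊕ A.above L.1) ℚ (CatHom.H1 (A.SubSal L F₀)),
      (∀ h, β (Sum.inl h) = (gal (N h)).lambdaHat B (A.subIncl L F₀)) ∧
      ∀ H : A.above L.1, β (Sum.inr H) = omegaHat (K H.1) H.1 (A.subIncl L F₀) := by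
  classical
  have := Fintype.ofFinite (A.above L.1)
  have hex := fun h => (gal (N h)).exists_cycle_subSal hA (hNL h) hB
  have hom := fun H : A.above L.1 =>
    hasOmega_subSal (F₀ := F₀) H.2 (sg_eq_zero_of_mem_above hF H.2) (K H.1)
  let T : CatHom.H1 (A.SubSal L F₀) →ₗ[ℚ] A.charKer (A.above L.1) :=
    (transMap (A.subIncl L F₀)).codRestrict _ (transMap_mem_charKer L F₀)
  refine exists_basis_of_block (LinearMap.funLeft ℚ ℚ Subtype.val ∘ₗ windMap (A.subIncl L F₀)) T
    (fun x hw ht => ?_) (finrank_charKer_le L) _ _ (fun H => ?_) (fun H => ?_) ?_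
  · exact subSal_eq_zero_of_periods hA hF (fun i hi => congrFun hw ⟨i, hi⟩)
      (congrArg Subtype.val ht)
  · funext H'
    change windMap _ _ H'.1 = _
    rw [windMap_omegaHat hA (hom H), Pi.single_apply, Pi.single_apply]
    simp only [Subtype.ext_iff]
  · exact Subtype.ext (transMap_omegaHat hA (hom H))
  · refine LinearIndependent.of_comp (A.charKer (A.above L.1)).subtype ?_
    have h := linearIndependent_translation hA gal hB hF hNL hN
    have e : (fun h => (gal (N h)).translation) = (A.charKer (A.above L.1)).subtype ∘
        fun h => T ((gal (N h)).lambdaHat B (A.subIncl L F₀)) :=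
      funext fun h => (transMap_lambdaHat hA (gal (N h)) (hex h)).symm
    rwa [e] at h

include hA in
theorem exists_sal_basis (K : ι → A.Chamber Set.univ) {M : Fin d → A.Line}
    (B : A.Chamber Set.univ) (hM : LinearIndependent ℚ (fun i => (gal (M i)).translation)) :
    ∃ β : Module.Basis (Fin d ⊕ ι) ℚ (CatHom.H1 A.Sal),
      (∀ i, β (Sum.inl i) = (gal (M i)).lambdaHat B (𝟭 A.Sal)) ∧
      ∀ H, β (Sum.inr H) = omegaHat (K H) H (𝟭 A.Sal) := by
  classical
  have := Fintype.ofFinite ι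
  refine exists_basis_of_block (windMap (𝟭 A.Sal)) (transMap (𝟭 A.Sal))
    (fun x hw ht => sal_eq_zero_of_periods hA hw ht) (by simp) _ _
    (fun H => windMap_omegaHat hA (hasOmega_sal (K H) H))
    (fun H => transMap_omegaHat hA (hasOmega_sal (K H) H)) ?_
  simp only [transMap_lambdaHat hA _ ((gal _).exists_cycle_sal hA B)]
  exact hM

end Stratum

lemma windMap_push {D : Type} [Category.{0} D] {Φ : D ⥤ A.Sal} {y : CatHom.H1 D}
    {y' : CatHom.H1 A.Sal} (h : ∀ x, CatHom.pairing (CatHom.pull Φ x) y = CatHom.pairing x y') :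
    windMap (𝟭 A.Sal) y' = windMap Φ y ∧ transMap (𝟭 A.Sal) y' = transMap Φ y := by
  constructor
  · funext i
    exact (h (Submodule.Quotient.mk (A.windCocycle i))).symm
  · funext i
    exact (h (Submodule.Quotient.mk (A.shiftCocycle (Pi.single i 1)))).symm

lemma sal_eq_of_periods (hA : A.Essential) {x y : CatHom.H1 A.Sal}
    (hw : windMap (𝟭 A.Sal) x = windMap (𝟭 A.Sal) y)
    (ht : transMap (𝟭 A.Sal) x = transMap (𝟭 A.Sal) y) : x = y := by
  rw [← sub_eq_zero]
  refine sal_eq_zero_of_periods hA ?_ ?_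
  · rw [map_sub, hw, sub_self]
  · rw [map_sub, ht, sub_self]

end ToricArrangement

/-! ### The restriction map in the dual bases. -/

theorem mainTheorem6 {ι : Type} [Finite ι] {d : ℕ} (A : ToricArrangement ι d) (hA : A.Essential)
    -- the chamber and the minimal gallery attached to each one-dimensional layer
    (gal : ∀ M : A.Line, A.LineGallery M)
    -- the chamber `ᴴC` attached to each hypertorus
    (K : ι → A.Chamber Set.univ)
    -- the chambers `B(L)` and the faces `F(L)`
    (B : A.Layer → A.Chamber Set.univ) (F : A.Layer → A.LFace Set.univ)
    (hF : ∀ L : A.Layer, F L ≤ (B L).toLFace ∧ (F L).hull = A.dirSpace L.1)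
    -- the layers `M_i`, whose classes form a basis of `H₁(𝒮_T)`
    (M : Fin d → A.Line)
    (hM : LinearIndependent ℚ (fun i =>
      (gal (M i)).lambdaHat (B A.torus) (A.subIncl A.torus (F A.torus))))
    (hM' : Submodule.span ℚ (Set.range (fun i =>
      (gal (M i)).lambdaHat (B A.torus) (A.subIncl A.torus (F A.torus)))) = ⊤)
    -- the layer `L` and the layers `N_h(L)`
    (L : A.Layer) (N : Fin (A.dim L.1) → A.Line) (hNL : ∀ h, (N h).1.1 ⊆ L.1)
    (hN : LinearIndependent ℚ (fun h => (gal (N h)).lambdaHat (B L) (A.subIncl L (F L))))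
    -- the coefficients of the classes of the `N_h(L)` in terms of those of the `M_i`
    (a : Fin (A.dim L.1) → Fin d → ℚ)
    (ha : ∀ h, (gal (N h)).lambdaHat (B A.torus) (A.subIncl A.torus (F A.torus)) =
      ∑ i, a h i • (gal (M i)).lambdaHat (B A.torus) (A.subIncl A.torus (F A.torus))) :
    -- the homology bases of `Sal(𝒜)` and `𝒮_{L,F(L)}` and their dual bases in cohomology
    ∃ (β : Module.Basis (Fin d ⊕ ι) ℚ (CatHom.H1 A.Sal))
      (βd : Module.Basis (Fin d ⊕ ι) ℚ (CatHom.Coh1 A.Sal))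
      (βL : Module.Basis (Fin (A.dim L.1) ⊕ A.above L.1) ℚ (CatHom.H1 (A.SubSal L (F L))))
      (βLd : Module.Basis (Fin (A.dim L.1) ⊕ A.above L.1) ℚ (CatHom.Coh1 (A.SubSal L (F L)))),
      (∀ i, β (Sum.inl i) = (gal (M i)).lambdaHat (B A.torus) (𝟭 A.Sal)) ∧
      (∀ H, β (Sum.inr H) = ToricArrangement.omegaHat (K H) H (𝟭 A.Sal)) ∧
      (∀ x, CatHom.pairing (βd x) (β x) = 1) ∧
      (∀ x y, x ≠ y → CatHom.pairing (βd x) (β y) = 0) ∧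
      (∀ h, βL (Sum.inl h) = (gal (N h)).lambdaHat (B L) (A.subIncl L (F L))) ∧
      (∀ H : A.above L.1,
        βL (Sum.inr H) = ToricArrangement.omegaHat (K H.1) H.1 (A.subIncl L (F L))) ∧
      (∀ x, CatHom.pairing (βLd x) (βL x) = 1) ∧
      (∀ x y, x ≠ y → CatHom.pairing (βLd x) (βL y) = 0) ∧
      -- the restriction of `λ^{M_i}`
      (∀ i, CatHom.pull (A.subIncl L (F L)) (βd (Sum.inl i)) =
        ∑ h, a h i • βLd (Sum.inl h)) ∧
      -- the restriction of `ω_H` for `L ⊆ H`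
      (∀ (H : ι) (hH : H ∈ A.above L.1),
        CatHom.pull (A.subIncl L (F L)) (βd (Sum.inr H)) = βLd (Sum.inr ⟨H, hH⟩) +
          ∑ h, (∑ᶠ (P : A.Face) (_ : P.pts ⊆ (N h).1.1 ∧
              H ∈ ToricArrangement.sepSet P (B L) (B A.torus) \ A.above (N h).1.1),
            ToricArrangement.eps H (K H) ((gal (N h)).chm 0) *
              ToricArrangement.eps H (K H) (B L)) • βLd (Sum.inl h)) ∧
      -- the restriction of `ω_H` for `L ⊄ H`
      (∀ H : ι, H ∉ A.above L.1 →
        CatHom.pull (A.subIncl L (F L)) (βd (Sum.inr H)) =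
          ∑ h, (∑ᶠ (P : A.Face) (_ : P.pts ⊆ (N h).1.1 ∧
              H ∈ ToricArrangement.sepSet P (B L) (B A.torus) \ A.above (N h).1.1),
            ToricArrangement.eps H (K H) ((gal (N h)).chm 0) *
              ToricArrangement.eps H (K H) (B L)) • βLd (Sum.inl h)) := by

  classical
  have := Fintype.ofFinite ι
  have hT := ToricArrangement.linearIndependent_translation hA gal (hF A.torus).1 (hF A.torus).2
    (fun i => Set.subset_univ _) hM
  obtain ⟨β, hβl, hβo⟩ := ToricArrangement.exists_sal_basis hA gal K (B A.torus) hT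
  obtain ⟨βL, hLl, hLo⟩ :=
    ToricArrangement.exists_stratum_basis hA gal (hF L).1 (hF L).2 K hNL hN
  obtain ⟨βd, hβd⟩ := CatHom.exists_dual_basis β
  obtain ⟨βLd, hβLd⟩ := CatHom.exists_dual_basis βL
  -- periods of the basis elements
  have wM : ∀ i H, ToricArrangement.windMap (𝟭 A.Sal) (β (Sum.inl i)) H =
      ToricArrangement.windMap (A.subIncl A.torus (F A.torus))
        ((gal (M i)).lambdaHat (B A.torus) (A.subIncl A.torus (F A.torus))) H := by
    intro i H
    rw [hβl, ToricArrangement.windMap_lambdaHat hA _ ((gal _).exists_cycle_sal hA _),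
      ToricArrangement.windMap_lambdaHat hA _
        ((gal _).exists_cycle_subSal hA (Set.subset_univ _) (hF A.torus).1)]
  have tM : ∀ i, ToricArrangement.transMap (𝟭 A.Sal) (β (Sum.inl i)) =
      ToricArrangement.transMap (A.subIncl A.torus (F A.torus))
        ((gal (M i)).lambdaHat (B A.torus) (A.subIncl A.torus (F A.torus))) := by
    intro i
    rw [hβl, ToricArrangement.transMap_lambdaHat hA _ ((gal _).exists_cycle_sal hA _),
      ToricArrangement.transMap_lambdaHat hA _
        ((gal _).exists_cycle_subSal hA (Set.subset_univ _) (hF A.torus).1)]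
  have wO : ∀ H, ToricArrangement.windMap (𝟭 A.Sal) (β (Sum.inr H)) = Pi.single H 1 := by
    intro H
    rw [hβo, ToricArrangement.windMap_omegaHat hA (ToricArrangement.hasOmega_sal (K H) H)]
  have tO : ∀ H, ToricArrangement.transMap (𝟭 A.Sal) (β (Sum.inr H)) = 0 := by
    intro H
    rw [hβo, ToricArrangement.transMap_omegaHat hA (ToricArrangement.hasOmega_sal (K H) H)]
  set coef : Fin (A.dim L.1) → ι → ℚ := fun h H =>
    ∑ᶠ (P : A.Face) (_ : P.pts ⊆ (N h).1.1 ∧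
      H ∈ ToricArrangement.sepSet P (B L) (B A.torus) \ A.above (N h).1.1),
      ToricArrangement.eps H (K H) ((gal (N h)).chm 0) * ToricArrangement.eps H (K H) (B L)
    with hcoef
  -- the classes of the stratum in the homology of the whole complex
  have pushl : ∀ h x, CatHom.pairing (CatHom.pull (A.subIncl L (F L)) x) (βL (Sum.inl h)) =
      CatHom.pairing x (∑ i, a h i • β (Sum.inl i) + ∑ H, coef h H • β (Sum.inr H)) := by
    intro h x
    obtain ⟨y', hy'⟩ := CatHom.exists_push (A.subIncl L (F L)) (βL (Sum.inl h))
    obtain ⟨hw, ht⟩ := ToricArrangement.windMap_push hy'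
    rw [hy']
    congr 1
    refine ToricArrangement.sal_eq_of_periods hA ?_ ?_
    · funext H
      -- The relation `ha` gives the winding numbers of the class of `N h` for the chamber `B(T)`;
      -- replacing `B(T)` by `B(L)` changes them by the difference computed in `finsum_eps`, which
      -- is `coef h H`.
      have h1 := congrFun (congrArg
        (ToricArrangement.windMap (A.subIncl A.torus (F A.torus))) (ha h)) H
      rw [ToricArrangement.windMap_lambdaHat hA _
        ((gal _).exists_cycle_subSal hA (Set.subset_univ _) (hF A.torus).1), map_sum,
        Finset.sum_apply] at h1
      rw [hw, hLl, ToricArrangement.windMap_lambdaHat hA _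
        ((gal _).exists_cycle_subSal hA (hNL h) (hF L).1), map_add, map_sum, map_sum,
        Pi.add_apply, Finset.sum_apply, Finset.sum_apply]
      simp only [map_smul, Pi.smul_apply, smul_eq_mul, wM, wO] at h1 ⊢
      rw [← h1, hcoef]
      simp only [Pi.single_apply, mul_ite, mul_one, mul_zero, Finset.sum_ite_eq,
        Finset.mem_univ, if_true]
      rw [ToricArrangement.finsum_eps]
      simp only [mul_ite, mul_zero]
      ring
    -- Displacements do not depend on the chamber and vanish on the classes `ω̂_H`, so here `ha`
    -- suffices.
    · have h1 := congrArg (ToricArrangement.transMap (A.subIncl A.torus (F A.torus))) (ha h)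
      rw [ToricArrangement.transMap_lambdaHat hA _
        ((gal _).exists_cycle_subSal hA (Set.subset_univ _) (hF A.torus).1), map_sum] at h1
      rw [ht, hLl, ToricArrangement.transMap_lambdaHat hA _
        ((gal _).exists_cycle_subSal hA (hNL h) (hF L).1), map_add, map_sum, map_sum, h1]
      simp only [map_smul, tM, tO, smul_zero, Finset.sum_const_zero, add_zero]
  have pusho : ∀ (H : A.above L.1) x, CatHom.pairing (CatHom.pull (A.subIncl L (F L)) x)
      (βL (Sum.inr H)) = CatHom.pairing x (β (Sum.inr H.1)) := by
    intro H x
    obtain ⟨y', hy'⟩ := CatHom.exists_push (A.subIncl L (F L)) (βL (Sum.inr H))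
    obtain ⟨hw, ht⟩ := ToricArrangement.windMap_push hy'
    have hO : ToricArrangement.HasOmega (A.subIncl L (F L)) (K H.1) H.1 :=
      ToricArrangement.hasOmega_subSal H.2
        (ToricArrangement.sg_eq_zero_of_mem_above (hF L).2 H.2) (K H.1)
    rw [hy']
    congr 1
    refine ToricArrangement.sal_eq_of_periods hA ?_ ?_
    · rw [hw, hLo, ToricArrangement.windMap_omegaHat hA hO, wO]
    · rw [ht, hLo, ToricArrangement.transMap_omegaHat hA hO, tO]
  -- a cohomology class of the stratum is determined by its values on the basis
  have hext : ∀ {x y : CatHom.Coh1 (A.SubSal L (F L))},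
      (∀ h, CatHom.pairing x (βL (Sum.inl h)) = CatHom.pairing y (βL (Sum.inl h))) →
      (∀ H, CatHom.pairing x (βL (Sum.inr H)) = CatHom.pairing y (βL (Sum.inr H))) → x = y := by
    intro x y h1 h2
    refine CatHom.pairing_injective (βL.ext fun j => ?_)
    rcases j with h | H
    · exact h1 h
    · exact h2 H
  have sum_inl : ∀ (c : Fin (A.dim L.1) → ℚ) h,
      CatHom.pairing (∑ h', c h' • βLd (Sum.inl h')) (βL (Sum.inl h)) = c h := by
    intro c h
    simp [LinearMap.sum_apply, hβLd]
  have sum_inr : ∀ (c : Fin (A.dim L.1) → ℚ) H,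
      CatHom.pairing (∑ h', c h' • βLd (Sum.inl h')) (βL (Sum.inr H)) = 0 := by
    intro c H
    simp [LinearMap.sum_apply, hβLd]
  have pulll : ∀ i h, CatHom.pairing (βd (Sum.inl i))
      (∑ i, a h i • β (Sum.inl i) + ∑ H, coef h H • β (Sum.inr H)) = a h i := by
    intro i h
    simp [hβd]
  have pullo : ∀ H h, CatHom.pairing (βd (Sum.inr H))
      (∑ i, a h i • β (Sum.inl i) + ∑ H, coef h H • β (Sum.inr H)) = coef h H := by
    intro H h
    simp [hβd]
  refine ⟨β, βd, βL, βLd, hβl, hβo, fun x => by rw [hβd, if_pos rfl],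
    fun x y hxy => by rw [hβd, if_neg hxy], hLl, hLo, fun x => by rw [hβLd, if_pos rfl],
    fun x y hxy => by rw [hβLd, if_neg hxy], fun i => hext (fun h => ?_) fun H => ?_,
    fun H hH => hext (fun h => ?_) fun H' => ?_, fun H hH => hext (fun h => ?_) fun H' => ?_⟩
  · rw [pushl, pulll, sum_inl]
  · rw [pusho, hβd, if_neg (by simp), sum_inr]
  · rw [pushl, pullo, map_add, LinearMap.add_apply, sum_inl, hβLd, if_neg (by simp), zero_add]
  · rw [pusho, hβd, map_add, LinearMap.add_apply, sum_inr, hβLd, add_zero]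
    simp [Subtype.ext_iff]
  · rw [pushl, pullo, sum_inl]
  · rw [pusho, hβd, sum_inr, if_neg]
    intro h
    exact hH (Sum.inr_injective h ▸ H'.2)
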